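/- **Setting.** An instance consists of $n$ agents, $m$ indivisible goods $g_1,\dots,g_m$ (in a fixed order, used for breaking ties), values $v_i(g)\ge 0$, extended additively to sets by $v_i(S)=\sum_{g\in S}v_i(g)$ and to fractional bundles by $v_i(x)=\sum_g v_i(g)x_g$, and entitlements $w_i>0$ with $\sum_i w_i=1$. Agent $i$ orders the goods by decreasing value $v_i$, ties being broken by the fixed order. A deterministic allocation $Y=(Y_1,\dots,Y_n)$ is a partition of the goods, identified with its $0/1$ matrix. A lottery is a finite list of deterministic allocations $Y^1,\dots,Y^k$ with probabilities $\lambda_1,\dots,\lambda_k>0$, $\sum_h\lambda_h=1$; it represents the fractional allocation $X=\sum_h\lambda_hY^h$, with rows $X_i=(x_{ig})_g$. **Fairness.** A fractional allocation $X$ is $\mathsf{WSD}$-$\mathsf{EF}$ if $w_j\sum_{g\in G}x_{ig}\ge w_i\sum_{g\in G}x_{jg}$ for all agents $i,j$ and every initial segment $G$ of $i$'s ordering of the goods; it is $\mathsf{WEF}$ if $w_j\,v_i(X_i)\ge w_i\,v_i(X_j)$ for all $i,j$. A lottery has one of these properties ex-ante if the fractional allocation it represents has it. A deterministic allocation $Y$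 is $\mathsf{WPROP1}$ if for every agent $i$ either $v_i(Y_i)\ge w_i v_i(\mathcal G)$ or $v_i(Y_i\cup\{g\})\ge w_i v_i(\mathcal G)$ for some good $g\notin Y_i$, where $\mathcal G$ is the set of all goods; it is $\mathsf{WEF}(1,1)$ if for all agents $i,j$ either $Y_j=\emptyset$ or there is $g\in Y_j$ with $w_j\,(v_i(Y_i)+v_i(g))\ge w_i\,(v_i(Y_j)-v_i(g))$. A lottery has one of these properties ex-post if each $Y^h$ has it. **Eating.** In $\textsc{DifferentSpeedsEating}$ each good has one unit of supply; at any time every agent $i$ eats, at speed $w_i$, the first good in her ordering that has not been completely eaten, until no good remains. The output $X^{\mathsf{DSE}}=(x_{ig})$ records the amount $x_{ig}$ of $g$ eaten by $i$. **Decomposition.** Let $\mathcal H^{\mathsf{UG}}$ be the family of all sets $\{(i,g): i \text{ an agent}\}$ for a good $g$, all sets $\{i\}\times G$ with $i$ an agent and $G$ a nonempty initial segment of $i$'s ordering, and all singletons $\{(i,g)\}$. An $\mathcal H^{\mathsf{UG}}$-decomposition of a fractional allocation $X$ is a lottery that represents $X$ and all of whose allocations $Y$ satisfy $\lfloor x_A\rfloor\le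 y_A\le\lceil x_A\rceil$ for every $A\in\mathcal H^{\mathsf{UG}}$, where $x_A=\sum_{(i,g)\in A}x_{ig}$ and $y_A=\sum_{(i,g)\in A}y_{ig}$. **Theorem.** There is a strongly polynomial time algorithm that, given any such instance (with real values and entitlements), computes an $\mathcal H^{\mathsf{UG}}$-decomposition of $X^{\mathsf{DSE}}$ that is ex-ante $\mathsf{WSD}$-$\mathsf{EF}$, ex-ante $\mathsf{WEF}$, ex-post $\mathsf{WPROP1}$ and ex-post $\mathsf{WEF}(1,1)$. Here an algorithm is a single program that uses the real input numbers only through $+,-,\times,/$, the constants $0,1$ and comparisons, and in addition natural numbers (initially $n$ and $m$) for indices, counters and addresses of memory cells, through addition, truncated subtraction and comparisons. It is strongly polynomial if the number of elementary steps is bounded by a polynomial in $n+m$ and, whenever the input is rational, all numbers arising in the computation are rational with binary encoding length bounded by a polynomial in the encoding length of the input. -/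

import Mathlib

open scoped BigOperators

noncomputable section

namespace FairDivision

/-! ### Instances and deterministic allocations -/

/-- A fair division instance with `n` agents, `m` indivisible goods, additive valuations (given by
the non-negative values of the single goods), and positive entitlements summing to one. The order
of `Fin m` is the predefined order of the goods by which ties are broken. -/
structure Instance (n m : ℕ) where
  v : Fin n → Fin m → ℝ
  w : Fin n → ℝ
  v_nonneg : ∀ i g, 0 ≤ v i g
  w_pos : ∀ i, 0 < w i
  w_sum : ∑ i, w i = 1

/-- A deterministic (complete) allocation: every good is given to exactly one agent. -/
abbrev Allocation (n m : ℕ) := Fin m → Fin n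

/-- The bundle of agent `i`. -/
def bundle {n m : ℕ} (Y : Allocation n m) (i : Fin n) : Finset (Fin m) :=
  Finset.univ.filter fun g => Y g = i

/-- The matrix (with entries `0` and `1`) of a deterministic allocation. -/
def Allocation.matrix {n m : ℕ} (Y : Allocation n m) (i : Fin n) (g : Fin m) : ℝ :=
  if Y g = i then 1 else 0

/-- The additive value of a set of goods for agent `i`. -/
def Instance.value {n m : ℕ} (I : Instance n m) (i : Fin n) (S : Finset (Fin m)) : ℝ :=
  ∑ g ∈ S, I.v i g

/-- The value of a fractional bundle for agent `i`. -/
def Instance.fracValue {n m : ℕ} (I : Instance n m) (i : Fin n) (x : Fin m → ℝ) : ℝ :=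
  ∑ g, I.v i g * x g

/-- `g` is equal to `h` or comes before `h` in agent `i`'s ordering of the goods: by decreasing
value, ties being broken by the predefined order of the goods. -/
def Instance.Before {n m : ℕ} (I : Instance n m) (i : Fin n) (g h : Fin m) : Prop :=
  I.v i h < I.v i g ∨ (I.v i g = I.v i h ∧ g ≤ h)

open Classical in
/-- The initial segment, ending with `g`, of agent `i`'s ordering of the goods. -/
def Instance.initialSegment {n m : ℕ} (I : Instance n m) (i : Fin n) (g : Fin m) :
    Finset (Fin m) :=
  Finset.univ.filter fun h => I.Before i h g

/-! ### Fairness notions -/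

/-- `WSD-EF`: for every agent `i`, her own fractional bundle, scaled by entitlements, weakly
stochastically dominates the one of any other agent, with respect to `i`'s ordering of goods. -/
def Instance.WSDEF {n m : ℕ} (I : Instance n m) (X : Fin n → Fin m → ℝ) : Prop :=
  ∀ (i j : Fin n) (g : Fin m),
    I.w i * ∑ h ∈ I.initialSegment i g, X j h ≤ I.w j * ∑ h ∈ I.initialSegment i g, X i h

/-- `WEF` of a fractional allocation. -/
def Instance.WEF {n m : ℕ} (I : Instance n m) (X : Fin n → Fin m → ℝ) : Prop :=
  ∀ i j : Fin n, I.w i * I.fracValue i (X j) ≤ I.w j * I.fracValue i (X i)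

/-- `WEF(x, y)` of a deterministic allocation. -/
def Instance.WEFxy {n m : ℕ} (I : Instance n m) (x y : ℝ) (Y : Allocation n m) : Prop :=
  ∀ i j : Fin n, bundle Y j = ∅ ∨ ∃ g ∈ bundle Y j,
    I.w i * (I.value i (bundle Y j) - x * I.v i g) ≤
      I.w j * (I.value i (bundle Y i) + y * I.v i g)

/-- `WPROP1`: every agent gets her proportional share after adding at most one good that is not in
her bundle. -/
def Instance.WPROP1 {n m : ℕ} (I : Instance n m) (Y : Allocation n m) : Prop :=
  ∀ i : Fin n, I.w i * I.value i Finset.univ ≤ I.value i (bundle Y i) ∨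
    ∃ g ∉ bundle Y i, I.w i * I.value i Finset.univ ≤ I.value i (insert g (bundle Y i))

/-! ### Lotteries -/

/-- A lottery: a finite list of deterministic allocations with positive probabilities. -/
structure Lottery (n m : ℕ) where
  size : ℕ
  weight : Fin size → ℝ
  alloc : Fin size → Allocation n m
  weight_pos : ∀ k, 0 < weight k
  weight_sum : ∑ k, weight k = 1

/-- The fractional allocation represented by a lottery: the expected allocation matrix. -/
def Lottery.mean {n m : ℕ} (L : Lottery n m) (i : Fin n) (g : Fin m) : ℝ :=
  ∑ k, L.weight k * (L.alloc k).matrix i g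

/-! ### The algorithm `DifferentSpeedsEating` -/

/-- The variables of the algorithm: remaining goods, remaining supplies, fractional allocation. -/
structure EatingState (n m : ℕ) where
  goods : Finset (Fin m)
  supply : Fin m → ℝ
  alloc : Fin n → Fin m → ℝ

/-- `g` is agent `i`'s most favored good in `S`. -/
def Instance.IsFavorite {n m : ℕ} (I : Instance n m) (S : Finset (Fin m)) (i : Fin n)
    (g : Fin m) : Prop :=
  g ∈ S ∧ ∀ h ∈ S, I.Before i g h

open Classical in
/-- The eating speed on `g` when `S` is the set of remaining goods. -/
def Instance.speed {n m : ℕ} (I : Instance n m) (S : Finset (Fin m)) (g : Fin m) : ℝ :=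
  ∑ i ∈ Finset.univ.filter (fun i => I.IsFavorite S i g), I.w i

open Classical in
/-- The time after which `g` is finished at the current speeds; infinite if nobody eats `g`. -/
def Instance.finishTime {n m : ℕ} (I : Instance n m) (s : EatingState n m) (g : Fin m) :
    WithTop ℝ :=
  if I.speed s.goods g = 0 then ⊤ else ((s.supply g / I.speed s.goods g : ℝ) : WithTop ℝ)

/-- The time after which the first good is finished. (The value `0` of `untopD` is used only if no
good remains.) -/
def Instance.phaseLength {n m : ℕ} (I : Instance n m) (s : EatingState n m) : ℝ :=
  (s.goods.inf fun g => I.finishTime s g).untopD 0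

open Classical in
/-- One pass through the main loop: everybody eats her most favored remaining good until the first
good is finished, then the finished goods are removed. -/
def Instance.eatingStep {n m : ℕ} (I : Instance n m) (s : EatingState n m) : EatingState n m where
  goods := s.goods.filter fun g => ¬ ∀ h ∈ s.goods, I.finishTime s g ≤ I.finishTime s h
  supply g := s.supply g - I.phaseLength s * I.speed s.goods g
  alloc i g := s.alloc i g + if I.IsFavorite s.goods i g then I.phaseLength s * I.w i else 0

/-- The output of `DifferentSpeedsEating`. Every pass removes at least one remaining good and a pass
without remaining goods changes nothing, so the loop is run `m` times. -/
def Instance.eating {n m : ℕ} (I : Instance n m) : Fin n → Fin m → ℝ :=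
  (I.eatingStep^[m] ⟨Finset.univ, fun _ => 1, fun _ _ => 0⟩).alloc

/-! ### The utility-guarantee bihierarchy and its decompositions -/

/-- The bihierarchy `H^UG = H₁ ∪ H₂`. The family `H₁` consists of the columns; `H₂` consists, for
every agent `i`, of the sets `{i} × S` for `S` an initial segment of `i`'s ordering of the goods or
a single good. -/
def Instance.bihierarchy {n m : ℕ} (I : Instance n m) : Set (Finset (Fin n × Fin m)) :=
  {A | ∃ g : Fin m, A = Finset.univ ×ˢ {g}} ∪
    ({A | ∃ (i : Fin n) (g : Fin m), A = {i} ×ˢ I.initialSegment i g} ∪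
      {A | ∃ (i : Fin n) (g : Fin m), A = {(i, g)}})

/-- A lottery is an `H^UG`-decomposition of `X`: the lottery represents `X`, and all allocations in
it respect the quotas `⌊x_A⌋` and `⌈x_A⌉`, where `x_A` is the sum of the entries of `X` in `A`, for
every set `A` of the bihierarchy. -/
def Instance.IsUGDecomposition {n m : ℕ} (I : Instance n m) (X : Fin n → Fin m → ℝ)
    (L : Lottery n m) : Prop :=
  L.mean = X ∧ ∀ k, ∀ A ∈ I.bihierarchy,
    (⌊∑ e ∈ A, X e.1 e.2⌋ : ℝ) ≤ ∑ e ∈ A, (L.alloc k).matrix e.1 e.2 ∧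
      ∑ e ∈ A, (L.alloc k).matrix e.1 e.2 ≤ (⌈∑ e ∈ A, X e.1 e.2⌉ : ℝ)

/-! ### The machine model

Programs act on finitely many two-dimensional arrays of natural numbers (for indices, counters and
addresses) and of real numbers. The real numbers can be processed only by the four arithmetic
operations and by comparisons, and the natural numbers only by addition, truncated subtraction and
comparisons; all of these are elementary steps. -/

/-- The memory: an array name, a row and a column determine a cell. -/
structure Memory where
  idx : ℕ → ℕ → ℕ → ℕ
  num : ℕ → ℕ → ℕ → ℝ

/-- Store the natural number `x` in the cell `(i, j)` of the index array `a`. -/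
def Memory.writeIdx (M : Memory) (a i j x : ℕ) : Memory where
  idx a' i' j' := if a' = a ∧ i' = i ∧ j' = j then x else M.idx a' i' j'
  num := M.num

/-- Store the real number `x` in the cell `(i, j)` of the number array `a`. -/
def Memory.writeNum (M : Memory) (a i j : ℕ) (x : ℝ) : Memory where
  idx := M.idx
  num a' i' j' := if a' = a ∧ i' = i ∧ j' = j then x else M.num a' i' j'

/-- Expressions for natural numbers; `read a i j` is the cell `(i, j)` of the index array `a`. -/
inductive IdxExpr
  | const (c : ℕ)
  | read (a : ℕ) (i j : IdxExpr)
  | add (e f : IdxExpr)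
  | sub (e f : IdxExpr)

def IdxExpr.eval (M : Memory) : IdxExpr → ℕ
  | const c => c
  | read a i j => M.idx a (i.eval M) (j.eval M)
  | add e f => e.eval M + f.eval M
  | sub e f => e.eval M - f.eval M

/-- The number of elementary steps for the evaluation. -/
def IdxExpr.cost : IdxExpr → ℕ
  | const _ => 1
  | read _ i j => 1 + i.cost + j.cost
  | add e f => 1 + e.cost + f.cost
  | sub e f => 1 + e.cost + f.cost

/-- An address of a cell of a number array. -/
structure NumRef where
  arr : ℕ
  row : IdxExpr
  col : IdxExpr

def NumRef.eval (M : Memory) (r : NumRef) : ℝ :=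
  M.num r.arr (r.row.eval M) (r.col.eval M)

def NumRef.cost (r : NumRef) : ℕ :=
  1 + r.row.cost + r.col.cost

/-- The right-hand sides of assignments to cells of number arrays: at most one operation. -/
inductive NumExpr
  | zero
  | one
  | copy (r : NumRef)
  | add (r s : NumRef)
  | sub (r s : NumRef)
  | mul (r s : NumRef)
  | div (r s : NumRef)

def NumExpr.eval (M : Memory) : NumExpr → ℝ
  | zero => 0
  | one => 1
  | copy r => r.eval M
  | add r s => r.eval M + s.eval M
  | sub r s => r.eval M - s.eval M
  | mul r s => r.eval M * s.eval M
  | div r s => r.eval M / s.eval M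

def NumExpr.cost : NumExpr → ℕ
  | zero => 1
  | one => 1
  | copy r => 1 + r.cost
  | add r s => 1 + r.cost + s.cost
  | sub r s => 1 + r.cost + s.cost
  | mul r s => 1 + r.cost + s.cost
  | div r s => 1 + r.cost + s.cost

/-- Tests. -/
inductive Test
  | idxLt (e f : IdxExpr)
  | idxEq (e f : IdxExpr)
  | numLt (r s : NumRef)
  | numEq (r s : NumRef)
  | neg (c : Test)
  | conj (c d : Test)

def Test.Holds (M : Memory) : Test → Prop
  | idxLt e f => e.eval M < f.eval M
  | idxEq e f => e.eval M = f.eval M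
  | numLt r s => r.eval M < s.eval M
  | numEq r s => r.eval M = s.eval M
  | neg c => ¬ c.Holds M
  | conj c d => c.Holds M ∧ d.Holds M

def Test.cost : Test → ℕ
  | idxLt e f => 1 + e.cost + f.cost
  | idxEq e f => 1 + e.cost + f.cost
  | numLt r s => 1 + r.cost + s.cost
  | numEq r s => 1 + r.cost + s.cost
  | neg c => 1 + c.cost
  | conj c d => 1 + c.cost + d.cost

/-- Programs. -/
inductive Program
  | skip
  | setIdx (a : ℕ) (i j : IdxExpr) (e : IdxExpr)
  | setNum (a : ℕ) (i j : IdxExpr) (e : NumExpr)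
  | seq (p q : Program)
  | branch (c : Test) (p q : Program)
  | loop (c : Test) (p : Program)

/-- `Exec ok p M t M'`: started in memory `M`, the program `p` halts after exactly `t` elementary
steps in memory `M'`, and every real number that it ever stores satisfies `ok`. -/
inductive Exec (ok : ℝ → Prop) : Program → Memory → ℕ → Memory → Prop
  | skip (M : Memory) : Exec ok .skip M 1 M
  | setIdx (M : Memory) (a : ℕ) (i j e : IdxExpr) :
      Exec ok (.setIdx a i j e) M (1 + i.cost + j.cost + e.cost)
        (M.writeIdx a (i.eval M) (j.eval M) (e.eval M))
  | setNum (M : Memory) (a : ℕ) (i j : IdxExpr) (e : NumExpr) (h : ok (e.eval M)) :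
      Exec ok (.setNum a i j e) M (1 + i.cost + j.cost + e.cost)
        (M.writeNum a (i.eval M) (j.eval M) (e.eval M))
  | seq {p q : Program} {M₁ M₂ M₃ : Memory} {t u : ℕ} (hp : Exec ok p M₁ t M₂)
      (hq : Exec ok q M₂ u M₃) : Exec ok (.seq p q) M₁ (t + u) M₃
  | branchTrue {c : Test} {p q : Program} {M M' : Memory} {t : ℕ} (hc : c.Holds M)
      (hp : Exec ok p M t M') : Exec ok (.branch c p q) M (c.cost + t) M'
  | branchFalse {c : Test} {p q : Program} {M M' : Memory} {t : ℕ} (hc : ¬ c.Holds M)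
      (hq : Exec ok q M t M') : Exec ok (.branch c p q) M (c.cost + t) M'
  | loopDone {c : Test} {p : Program} {M : Memory} (hc : ¬ c.Holds M) :
      Exec ok (.loop c p) M c.cost M
  | loopStep {c : Test} {p : Program} {M₁ M₂ M₃ : Memory} {t u : ℕ} (hc : c.Holds M₁)
      (hp : Exec ok p M₁ t M₂) (hl : Exec ok (.loop c p) M₂ u M₃) :
      Exec ok (.loop c p) M₁ (c.cost + t + u) M₃

/-! ### Strongly polynomial time -/

/-- The initial memory: `n` and `m` in the cells `(0, 0)` and `(0, 1)` of the index array `0`, the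
values of the goods in the number array `0`, the entitlements in column `0` of the number array `1`;
all other cells are zero. -/
def Instance.input {n m : ℕ} (I : Instance n m) : Memory where
  idx a i j := if a = 0 ∧ i = 0 ∧ j = 0 then n else if a = 0 ∧ i = 0 ∧ j = 1 then m else 0
  num a i j :=
    if hi : i < n then
      if a = 0 then (if hj : j < m then I.v ⟨i, hi⟩ ⟨j, hj⟩ else 0)
      else if a = 1 ∧ j = 0 then I.w ⟨i, hi⟩
      else 0
    else 0

/-- The memory contains the lottery `L`: the number of its allocations in the cell `(0, 0)` of the
index array `1`, their probabilities in column `0` of the number array `2`, and the owner of the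
good `g` in the `k`-th allocation in the cell `(k, g)` of the index array `2`. -/
def Lottery.StoredIn {n m : ℕ} (L : Lottery n m) (M : Memory) : Prop :=
  M.idx 1 0 0 = L.size ∧
    ∀ k : Fin L.size, M.num 2 k 0 = L.weight k ∧ ∀ g : Fin m, M.idx 2 k g = (L.alloc k g : ℕ)

/-- The binary encoding length of a rational number (in lowest terms, up to the sign bit). -/
def ratBits (r : ℚ) : ℕ :=
  Nat.size r.num.natAbs + Nat.size r.den

/-- `I` has rational data, and its encoding length is `b`. -/
def Instance.HasEncodingLength {n m : ℕ} (I : Instance n m) (b : ℕ) : Prop :=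
  ∃ (v' : Fin n → Fin m → ℚ) (w' : Fin n → ℚ),
    (∀ i g, (v' i g : ℝ) = I.v i g) ∧ (∀ i, (w' i : ℝ) = I.w i) ∧
      b = n + m + ∑ i, ∑ g, ratBits (v' i g) + ∑ i, ratBits (w' i)

/-- There is a single program that, for every instance, computes a lottery in the relation `Spec`
to the instance, in strongly polynomial time: the number of elementary steps is bounded by a
polynomial in the numbers of agents and goods, and, if the input is rational, then all numbers
arising in the computation are rational, with encoding lengths bounded by a polynomial in the
encoding length of the input. (Natural numbers stored by the program have polynomially many bits
automatically, since they arise from `n`, `m` and constants by addition and subtraction.) -/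
def ComputableInStronglyPolynomialTime
    (Spec : ∀ {n m : ℕ}, Instance n m → Lottery n m → Prop) : Prop :=
  ∃ (P : Program) (p q : Polynomial ℕ), ∀ (n m : ℕ) (I : Instance n m),
    ∃ (L : Lottery n m) (t : ℕ) (M : Memory),
      Exec (fun x => ∀ b, I.HasEncodingLength b → ∃ r : ℚ, (r : ℝ) = x ∧ ratBits r ≤ q.eval b)
        P I.input t M ∧
      t ≤ p.eval (n + m) ∧ L.StoredIn M ∧ Spec I L

end FairDivision

end

/-! Fairness of eating. Every agent eats at the constant speed `w i`, so the time at which a set of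
goods is exhausted controls all agents at once. If the set is finished at time T, any agent `j` has
eaten at most `w j * T` of it, and an agent for whom it is an initial segment has eaten exactly `w i
* T` (`sum_eating_le`, `sum_eating_eq`). This is ex-ante `WSDEF`. Summation by parts over initial
segments (`sum_value_nonneg`) turns comparisons of amounts or of counts into comparisons of values;
it gives `WEF`, and it also reduces the ex-post properties to counting.

Ex-post fairness. The quotas pin down the number of goods that an agent gets from each initial
segment of her own ordering, with an error below one. This suffices for `WPROP1`. For `WEFxy 1 1`
the envied agent must be bounded on initial segments of somebody else's ordering; `Respects.card_le`
does so by passing to an initial segment of her own, where the singleton quotas exclude goods that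
she never ate.

Existence of the decomposition. The consumption of each agent is cut, in the order of eating, into
consecutive units of size one. The matrix of units against goods has column sums 1 and row sums at
most 1, so it can be bordered to a doubly stochastic matrix (`doublyStochastic_padded`), which is a
convex combination of permutation matrices. A unit filled completely from an initial segment
receives a good of it in every permutation, and a unit not reached by the segment never does; this
gives the floor and the ceiling (`DecompInv.respects`). Permutations are found by an auction whose
prices are bounded by a Hall-type count (`AuctionInv.level`), and subtracting the least matched
entry removes an entry from the support.

Complexity. The weakest-precondition calculus `wp` bounds the rounds of each loop, and `exec_of_wp`
converts this into a polynomial running time. Valuations are only compared. The other stored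
numbers, apart from the quotients of supply and speed, are bounded elements of a grid of multiples
of a fixed fraction. In the products of durations with entitlements the common denominator of the
entitlements cancels, so the denominator grows by at most one bounded factor per phase
(`exists_grid`). -/

namespace FairDivision

/-! ### A program logic -/

/-- The index arrays that may be written by a program. -/
def Program.idxW : Program → List ℕ
  | .skip => []
  | .setIdx a _ _ _ => [a]
  | .setNum _ _ _ _ => []
  | .seq p q => p.idxW ++ q.idxW
  | .branch _ p q => p.idxW ++ q.idxW
  | .loop _ p => p.idxW

/-- The number arrays that may be written by a program. -/
def Program.numW : Program → List ℕ
  | .skip => []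
  | .setIdx _ _ _ _ => []
  | .setNum a _ _ _ => [a]
  | .seq p q => p.numW ++ q.numW
  | .branch _ p q => p.numW ++ q.numW
  | .loop _ p => p.numW

/-- The index arrays read by an expression. -/
def IdxExpr.reads : IdxExpr → List ℕ
  | .const _ => []
  | .read a i j => a :: (i.reads ++ j.reads)
  | .add e f => e.reads ++ f.reads
  | .sub e f => e.reads ++ f.reads

/-- The memories differ at most in the given index and number arrays. -/
structure Memory.Frame (l l' : List ℕ) (M M' : Memory) : Prop where
  idx : ∀ a, a ∉ l → M'.idx a = M.idx a
  num : ∀ a, a ∉ l' → M'.num a = M.num a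

theorem Memory.Frame.refl (l l' : List ℕ) (M : Memory) : Memory.Frame l l' M M :=
  ⟨fun _ _ => rfl, fun _ _ => rfl⟩

theorem Memory.Frame.trans {l l' : List ℕ} {M₁ M₂ M₃ : Memory} (h : Memory.Frame l l' M₁ M₂)
    (h' : Memory.Frame l l' M₂ M₃) : Memory.Frame l l' M₁ M₃ :=
  ⟨fun a ha => (h'.idx a ha).trans (h.idx a ha), fun a ha => (h'.num a ha).trans (h.num a ha)⟩

theorem Memory.Frame.mono {l l' k k' : List ℕ} {M M' : Memory} (h : Memory.Frame l l' M M')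
    (hk : ∀ a ∈ l, a ∈ k) (hk' : ∀ a ∈ l', a ∈ k') : Memory.Frame k k' M M' :=
  ⟨fun a ha => h.idx a fun h' => ha (hk a h'), fun a ha => h.num a fun h' => ha (hk' a h')⟩

theorem Memory.frame_writeIdx {l l' : List ℕ} (M : Memory) {a : ℕ} (ha : a ∈ l) (i j x : ℕ) :
    Memory.Frame l l' M (M.writeIdx a i j x) := by
  refine ⟨fun b hb => ?_, fun _ _ => rfl⟩
  have : b ≠ a := fun h => hb (h ▸ ha)
  funext i' j'
  simp [Memory.writeIdx, this]

theorem Memory.frame_writeNum {l l' : List ℕ} (M : Memory) {a : ℕ} (ha : a ∈ l') (i j : ℕ)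
    (x : ℝ) : Memory.Frame l l' M (M.writeNum a i j x) := by
  refine ⟨fun _ _ => rfl, fun b hb => ?_⟩
  have : b ≠ a := fun h => hb (h ▸ ha)
  funext i' j'
  simp [Memory.writeNum, this]

theorem IdxExpr.eval_frame {l l' : List ℕ} {M M' : Memory} (h : Memory.Frame l l' M M') :
    ∀ e : IdxExpr, (∀ a ∈ e.reads, a ∉ l) → e.eval M' = e.eval M
  | .const _, _ => rfl
  | .read a i j, hr => by
    have hi := eval_frame h i fun b hb => hr b (by simp [reads, hb])
    have hj := eval_frame h j fun b hb => hr b (by simp [reads, hb])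
    simp only [eval, hi, hj, h.idx a (hr a (by simp [reads]))]
  | .add e f, hr => by
    simp only [eval, eval_frame h e fun b hb => hr b (by simp [reads, hb]),
      eval_frame h f fun b hb => hr b (by simp [reads, hb])]
  | .sub e f, hr => by
    simp only [eval, eval_frame h e fun b hb => hr b (by simp [reads, hb]),
      eval_frame h f fun b hb => hr b (by simp [reads, hb])]

/-- A precondition under which a program runs with at most `B` rounds of every loop, stores only
numbers with `ok`, and establishes `Q`. -/
def wp (ok : ℝ → Prop) (B : ℕ) : Program → (Memory → Prop) → Memory → Prop
  | .skip, Q, M => Q M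
  | .setIdx a i j e, Q, M => Q (M.writeIdx a (i.eval M) (j.eval M) (e.eval M))
  | .setNum a i j e, Q, M => ok (e.eval M) ∧ Q (M.writeNum a (i.eval M) (j.eval M) (e.eval M))
  | .seq p q, Q, M => wp ok B p (wp ok B q Q) M
  | .branch c p q, Q, M => (c.Holds M → wp ok B p Q M) ∧ (¬ c.Holds M → wp ok B q Q M)
  | .loop c p, Q, M => ∃ N ≤ B, ∃ Inv : ℕ → Memory → Prop, Inv 0 M ∧
      (∀ k < N, ∀ M', Inv k M' → c.Holds M' ∧ wp ok B p (Inv (k + 1)) M') ∧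
      ∀ M', Inv N M' → ¬ c.Holds M' ∧ Q M'

/-- The number of steps of a program as a polynomial in the maximal number of rounds of a loop. -/
noncomputable def Program.time : Program → Polynomial ℕ
  | .skip => 1
  | .setIdx _ i j e => Polynomial.C (1 + i.cost + j.cost + e.cost)
  | .setNum _ i j e => Polynomial.C (1 + i.cost + j.cost + e.cost)
  | .seq p q => p.time + q.time
  | .branch c p q => Polynomial.C c.cost + p.time + q.time
  | .loop c p => (Polynomial.X + 1) * (Polynomial.C c.cost + p.time)

theorem wp_mono {ok : ℝ → Prop} {B : ℕ} (p : Program) :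
    ∀ {Q Q' : Memory → Prop} {M : Memory}, wp ok B p Q M → (∀ M', Q M' → Q' M') →
      wp ok B p Q' M := by
  induction p with
  | skip => exact fun h hq => hq _ h
  | setIdx => exact fun h hq => hq _ h
  | setNum => exact fun h hq => ⟨h.1, hq _ h.2⟩
  | seq p q ihp ihq => exact fun h hq => ihp h fun M' h' => ihq h' hq
  | branch c p q ihp ihq => exact fun h hq => ⟨fun hc => ihp (h.1 hc) hq, fun hc => ihq (h.2 hc) hq⟩
  | loop c p _ =>
    rintro Q Q' M ⟨N, hN, Inv, h0, h1, h2⟩ hq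
    exact ⟨N, hN, Inv, h0, h1, fun M' h => ⟨(h2 M' h).1, hq _ (h2 M' h).2⟩⟩

/-- The arrays that can change are visible in the program text, so a specification need only
describe those it is about. For loops the frame condition is carried as part of the invariant. -/
theorem wp_frame {ok : ℝ → Prop} {B : ℕ} (p : Program) :
    ∀ {l l' : List ℕ}, (∀ a ∈ p.idxW, a ∈ l) → (∀ a ∈ p.numW, a ∈ l') →
    ∀ {Q : Memory → Prop} {M : Memory}, wp ok B p Q M →
      wp ok B p (fun M' => Q M' ∧ Memory.Frame l l' M M') M := by
  induction p with
  | skip => exact fun _ _ _ _ h => ⟨h, .refl _ _ _⟩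
  | setIdx a i j e =>
    exact fun hl _ _ M h => ⟨h, M.frame_writeIdx (hl a (by simp [Program.idxW])) _ _ _⟩
  | setNum a i j e =>
    exact fun _ hl _ M h => ⟨h.1, h.2, M.frame_writeNum (hl a (by simp [Program.numW])) _ _ _⟩
  | seq p q ihp ihq =>
    intro l l' hl hl' Q M h
    refine wp_mono p (ihp (l := l) (l' := l') (fun a ha => hl a (by simp [Program.idxW, ha]))
      (fun a ha => hl' a (by simp [Program.numW, ha])) h) ?_
    rintro M' ⟨h1, h2⟩
    refine wp_mono q (ihq (l := l) (l' := l') (fun a ha => hl a (by simp [Program.idxW, ha]))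
      (fun a ha => hl' a (by simp [Program.numW, ha])) h1) ?_
    exact fun M'' h3 => ⟨h3.1, h2.trans h3.2⟩
  | branch c p q ihp ihq =>
    intro l l' hl hl' Q M h
    exact ⟨fun hc => ihp (fun a ha => hl a (by simp [Program.idxW, ha]))
        (fun a ha => hl' a (by simp [Program.numW, ha])) (h.1 hc),
      fun hc => ihq (fun a ha => hl a (by simp [Program.idxW, ha]))
        (fun a ha => hl' a (by simp [Program.numW, ha])) (h.2 hc)⟩
  | loop c p ih =>
    rintro l l' hl hl' Q M ⟨N, hN, Inv, h0, h1, h2⟩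
    refine ⟨N, hN, fun k M' => Inv k M' ∧ Memory.Frame l l' M M', ⟨h0, .refl _ _ _⟩, ?_, ?_⟩
    · rintro k hk M' ⟨h3, h4⟩
      refine ⟨(h1 k hk M' h3).1, wp_mono p (ih (l := l) (l' := l') hl hl' (h1 k hk M' h3).2) ?_⟩
      exact fun M'' h5 => ⟨h5.1, h4.trans h5.2⟩
    · exact fun M' h => ⟨(h2 M' h.1).1, (h2 M' h.1).2, h.2⟩

/-- The rule of consequence, including that only the written arrays change. -/
theorem wp_conseq {ok : ℝ → Prop} {B : ℕ} {p : Program} {Q Q' : Memory → Prop} {M : Memory}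
    (h : wp ok B p Q M) (hq : ∀ M', Q M' → Memory.Frame p.idxW p.numW M M' → Q' M') :
    wp ok B p Q' M :=
  wp_mono p (wp_frame p (fun _ h => h) (fun _ h => h) h) fun M' h' => hq M' h'.1 h'.2

/-- Since the number of rounds of each loop is fixed in advance by `wp`, induction on the remaining
rounds yields termination and the time bound together; the summand 1 in the factor of `Program.time`
pays for the final failing test. -/
theorem exec_of_wp {ok : ℝ → Prop} {B : ℕ} (p : Program) :
    ∀ {Q : Memory → Prop} {M : Memory}, wp ok B p Q M →
      ∃ t M', Exec ok p M t M' ∧ t ≤ p.time.eval B ∧ Q M' := by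
  induction p with
  | skip => exact fun h => ⟨_, _, .skip _, by simp [Program.time], h⟩
  | setIdx a i j e => exact fun h => ⟨_, _, .setIdx _ _ _ _ _, by simp [Program.time], h⟩
  | setNum a i j e => exact fun h => ⟨_, _, .setNum _ _ _ _ _ h.1, by simp [Program.time], h.2⟩
  | seq p q ihp ihq =>
    intro Q M h
    obtain ⟨t, M', h1, h2, h3⟩ := ihp h
    obtain ⟨u, M'', h4, h5, h6⟩ := ihq h3
    exact ⟨_, _, .seq h1 h4, by simp only [Program.time, Polynomial.eval_add]; omega, h6⟩
  | branch c p q ihp ihq =>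
    intro Q M h
    by_cases hc : c.Holds M
    · obtain ⟨t, M', h1, h2, h3⟩ := ihp (h.1 hc)
      exact ⟨_, _, .branchTrue hc h1,
        by simp only [Program.time, Polynomial.eval_add, Polynomial.eval_C]; omega, h3⟩
    · obtain ⟨t, M', h1, h2, h3⟩ := ihq (h.2 hc)
      exact ⟨_, _, .branchFalse hc h1,
        by simp only [Program.time, Polynomial.eval_add, Polynomial.eval_C]; omega, h3⟩
  | loop c p ih =>
    rintro Q M ⟨N, hN, Inv, h0, h1, h2⟩
    have key : ∀ d k, k + d = N → ∀ M, Inv k M → ∃ t M', Exec ok (.loop c p) M t M' ∧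
        t ≤ (d + 1) * (c.cost + p.time.eval B) ∧ Q M' := by
      intro d
      induction d with
      | zero =>
        rintro k rfl M h
        exact ⟨_, _, .loopDone (h2 M h).1, by simp, (h2 M h).2⟩
      | succ d ihd =>
        intro k hk M h
        obtain ⟨hc, hw⟩ := h1 k (by omega) M h
        obtain ⟨t, M', h3, h4, h5⟩ := ih hw
        obtain ⟨u, M'', h6, h7, h8⟩ := ihd (k + 1) (by omega) M' h5
        refine ⟨_, _, .loopStep hc h3 h6, ?_, h8⟩
        linarith
    obtain ⟨t, M', h3, h4, h5⟩ := key N 0 (by omega) M h0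
    refine ⟨t, M', h3, h4.trans ?_, h5⟩
    simp only [Program.time, Polynomial.eval_add, Polynomial.eval_mul, Polynomial.eval_C,
      Polynomial.eval_X, Polynomial.eval_one]
    gcongr

/-- `for a := 0 to e - 1 do p`; the counter is the cell `(0, 0)` of the index array `a`. -/
def forLoop (a : ℕ) (e : IdxExpr) (p : Program) : Program :=
  .seq (.setIdx a (.const 0) (.const 0) (.const 0))
    (.loop (.idxLt (.read a (.const 0) (.const 0)) e)
      (.seq p (.setIdx a (.const 0) (.const 0)
        (.add (.read a (.const 0) (.const 0)) (.const 1)))))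

/-- The side conditions say that the body leaves the counter and the bound alone and that the
invariant does not see the counter. They are checked on the program text, and the step may compare
with the memory before the loop. -/
theorem wp_forLoop {ok : ℝ → Prop} {B a N : ℕ} {e : IdxExpr} {p : Program} {M : Memory}
    (Inv : ℕ → Memory → Prop) (hN : e.eval M = N) (hB : N ≤ B) (ha : a ∉ p.idxW)
    (he : ∀ b ∈ e.reads, b ∉ a :: p.idxW)
    (hInv : ∀ k M x, Inv k M → Inv k (M.writeIdx a 0 0 x)) (h0 : Inv 0 M)
    (hstep : ∀ k < N, ∀ M', Memory.Frame (a :: p.idxW) p.numW M M' → M'.idx a 0 0 = k →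
      Inv k M' → wp ok B p (Inv (k + 1)) M') :
    wp ok B (forLoop a e p) (Inv N) M := by
  refine ⟨N, hB, fun k M' => Inv k M' ∧ M'.idx a 0 0 = k ∧
    Memory.Frame (a :: p.idxW) p.numW M M', ⟨hInv _ _ _ h0, ?_, M.frame_writeIdx (by simp) _ _ _⟩,
    ?_, ?_⟩
  · simp [Memory.writeIdx, IdxExpr.eval]
  · rintro k hk M' ⟨h1, h2, h3⟩
    refine ⟨?_, ?_⟩
    · simp only [Test.Holds, IdxExpr.eval_frame h3 e he, hN]
      simpa [IdxExpr.eval, h2] using hk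
    · refine wp_mono p (wp_frame p (l := p.idxW) (l' := p.numW) (fun _ h => h) (fun _ h => h)
        (hstep k hk M' h3 h2 h1)) ?_
      rintro M'' ⟨h4, h5⟩
      have h6 : M''.idx a 0 0 = k := by rw [h5.idx a ha, h2]
      refine ⟨hInv _ _ _ h4, ?_, ?_⟩
      · simp [Memory.writeIdx, IdxExpr.eval, h6]
      · exact (h3.trans (h5.mono (fun b hb => List.mem_cons_of_mem _ hb) fun _ h => h)).trans
          (M''.frame_writeIdx (by simp) _ _ _)
  · rintro M' ⟨h1, h2, h3⟩
    refine ⟨?_, h1⟩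
    simp only [Test.Holds, IdxExpr.eval_frame h3 e he, hN]
    simp [IdxExpr.eval, h2]

/-! ### Decomposition of doubly stochastic matrices -/

/-- A nonnegative `K × K` matrix all of whose rows and columns sum up to `μ`. -/
structure DoublyStochastic (K : ℕ) (Z : ℕ → ℕ → ℝ) (μ : ℝ) : Prop where
  nonneg : ∀ r < K, ∀ c < K, 0 ≤ Z r c
  row : ∀ r < K, ∑ c ∈ Finset.range K, Z r c = μ
  col : ∀ c < K, ∑ r ∈ Finset.range K, Z r c = μ

theorem DoublyStochastic.le {K : ℕ} {Z : ℕ → ℕ → ℝ} {μ : ℝ} (h : DoublyStochastic K Z μ)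
    {r c : ℕ} (hr : r < K) (hc : c < K) : Z r c ≤ μ := by
  rw [← h.row r hr]
  exact Finset.single_le_sum (f := fun c => Z r c)
    (fun c hc => h.nonneg r hr c (Finset.mem_range.1 hc)) (Finset.mem_range.2 hc)

/-- A set of columns whose support lies in a set of rows has at most as many elements. -/
theorem DoublyStochastic.card_le {K : ℕ} {Z : ℕ → ℕ → ℝ} {μ : ℝ} (h : DoublyStochastic K Z μ)
    (hμ : 0 < μ) {A S : Finset ℕ} (hA : ∀ c ∈ A, c < K) (hS : ∀ r ∈ S, r < K)
    (hN : ∀ c ∈ A, ∀ r < K, 0 < Z r c → r ∈ S) : A.card ≤ S.card := by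
  -- Double counting: the weight of the columns in `A` lies entirely inside the rows in `S`.
  have h1 : ∑ c ∈ A, μ ≤ ∑ r ∈ S, μ := by
    calc ∑ c ∈ A, μ = ∑ c ∈ A, ∑ r ∈ S, Z r c := by
          refine Finset.sum_congr rfl fun c hc => ?_
          rw [← h.col c (hA c hc)]
          symm
          refine Finset.sum_subset (fun r hr => Finset.mem_range.2 (hS r hr)) fun r hr hr' => ?_
          by_contra h0
          exact hr' (hN c hc r (Finset.mem_range.1 hr)
            (lt_of_le_of_ne (h.nonneg r (Finset.mem_range.1 hr) c (hA c hc)) (Ne.symm h0)))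
      _ = ∑ r ∈ S, ∑ c ∈ A, Z r c := Finset.sum_comm
      _ ≤ ∑ r ∈ S, μ := by
          refine Finset.sum_le_sum fun r hr => ?_
          rw [← h.row r (hS r hr)]
          exact Finset.sum_le_sum_of_subset_of_nonneg
            (fun c hc => Finset.mem_range.2 (hA c hc))
            fun c hc _ => h.nonneg r (hS r hr) c (Finset.mem_range.1 hc)
  simp only [Finset.sum_const, nsmul_eq_mul] at h1
  exact_mod_cast le_of_mul_le_mul_right h1 hμ

/-! ### Perfect matchings by an auction -/

/-- The invariant of the auction in which the columns bid for the rows: `ρ c = r + 1` if the column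
`c` holds the row `r`, and `ρ c = 0` if it holds no row; `p` are the prices. -/
structure AuctionInv (K : ℕ) (Z : ℕ → ℕ → ℝ) (ρ p : ℕ → ℕ) : Prop where
  cheap : ∀ c < K, ∀ r, ρ c = r + 1 →
    r < K ∧ 0 < Z r c ∧ ∀ r' < K, 0 < Z r' c → p r ≤ p r' + 1
  inj : ∀ c < K, ∀ c' < K, ρ c = ρ c' → ρ c ≠ 0 → c = c'
  held : ∀ r < K, 0 < p r → ∃ c < K, ρ c = r + 1
  bound : ∀ r < K, p r ≤ K

/-- The holders of the rows priced at least `j + 1`, together with the free column `u`, have all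
their neighbors among the rows priced at least `j`, because a held row costs at most one more than
any alternative. Rows with positive price are held, so Hall's inequality makes the level sets of the
prices shrink strictly. -/
theorem AuctionInv.level {K : ℕ} {Z : ℕ → ℕ → ℝ} {ρ p : ℕ → ℕ} {μ : ℝ} (h : AuctionInv K Z ρ p)
    (hZ : DoublyStochastic K Z μ) (hμ : 0 < μ) {u : ℕ} (hu : u < K) (hρ : ρ u = 0) {j : ℕ}
    (hj : ∀ r < K, 0 < Z r u → j ≤ p r) :
    ((Finset.range K).filter fun r => j + 1 ≤ p r).card + 1 ≤
      ((Finset.range K).filter fun r => j ≤ p r).card := by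
  classical
  set S := (Finset.range K).filter fun r => j + 1 ≤ p r with hS
  set A := (Finset.range K).filter fun c => ∃ r ∈ S, ρ c = r + 1 with hA
  have huA : u ∉ A := by simp [hA, hρ]
  have h1 : S.card ≤ A.card := by
    have : S ⊆ A.image fun c => ρ c - 1 := by
      intro r hr
      have hr' := hr
      rw [hS, Finset.mem_filter, Finset.mem_range] at hr'
      obtain ⟨c, hc, hcr⟩ := h.held r hr'.1 (by omega)
      exact Finset.mem_image.2 ⟨c, by simp only [hA, Finset.mem_filter, Finset.mem_range]; exact
        ⟨hc, r, hr, hcr⟩, by omega⟩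
    exact (Finset.card_le_card this).trans Finset.card_image_le
  have h2 : (insert u A).card ≤ ((Finset.range K).filter fun r => j ≤ p r).card := by
    refine hZ.card_le hμ ?_ (fun r hr => by simp at hr; exact hr.1) ?_
    · intro c hc
      rcases Finset.mem_insert.1 hc with rfl | hc
      · exact hu
      · simp only [hA, Finset.mem_filter, Finset.mem_range] at hc; exact hc.1
    · intro c hc r hr hrc
      simp only [Finset.mem_filter, Finset.mem_range]
      refine ⟨hr, ?_⟩
      rcases Finset.mem_insert.1 hc with rfl | hc
      · exact hj r hr hrc
      · simp only [hA, hS, Finset.mem_filter, Finset.mem_range] at hc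
        obtain ⟨hc, r', ⟨_, hr'⟩, hcr⟩ := hc
        have := (h.cheap c hc r' hcr).2.2 r hr hrc
        omega
  rw [Finset.card_insert_of_notMem huA] at h2
  omega

/-- Below the cheapest price offered to a free column the level sets lose at least one row per step,
starting from at most `K` rows. Hence a bid never starts from price `K`. -/
theorem AuctionInv.lt {K : ℕ} {Z : ℕ → ℕ → ℝ} {ρ p : ℕ → ℕ} {μ : ℝ} (h : AuctionInv K Z ρ p)
    (hZ : DoublyStochastic K Z μ) (hμ : 0 < μ) {u b : ℕ} (hu : u < K) (hρ : ρ u = 0)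
    (hb : ∀ r < K, 0 < Z r u → p b ≤ p r) : p b < K := by
  have key : ∀ j ≤ p b + 1, ((Finset.range K).filter fun r => j ≤ p r).card + j ≤ K := by
    intro j
    induction j with
    | zero => intro _; simp
    | succ j ih =>
      intro hj
      have h1 := ih (by omega)
      have h2 := h.level hZ hμ hu hρ (j := j) fun r hr hrc => by
        have := hb r hr hrc
        omega
      omega
  have := key _ le_rfl
  omega

/-- A bid of the column `u` for the row `b` keeps the invariant. -/
theorem AuctionInv.bid {K : ℕ} {Z : ℕ → ℕ → ℝ} {ρ p : ℕ → ℕ} {μ : ℝ} (h : AuctionInv K Z ρ p)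
    (hZ : DoublyStochastic K Z μ) (hμ : 0 < μ) {u b : ℕ} (hu : u < K) (hρ : ρ u = 0) (hbK : b < K)
    (hbu : 0 < Z b u) (hb : ∀ r < K, 0 < Z r u → p b ≤ p r) {ρ' p' : ℕ → ℕ}
    (hρ' : ∀ c < K, ρ' c = if c = u then b + 1 else if ρ c = b + 1 then 0 else ρ c)
    (hp' : ∀ r < K, p' r = if r = b then p r + 1 else p r) : AuctionInv K Z ρ' p' := by
  have hlt := h.lt hZ hμ hu hρ hb
  have hmono : ∀ r < K, p r ≤ p' r := fun r hr => by
    rw [hp' r hr]; split_ifs <;> omega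
  have hne : ∀ c < K, c ≠ u → ∀ r, ρ' c = r + 1 → r ≠ b ∧ ρ c = r + 1 := by
    intro c hc hcu r hr
    rw [hρ' c hc, if_neg hcu] at hr
    split_ifs at hr with h1
    exact ⟨by rintro rfl; exact h1 hr, hr⟩
  have hu' : ρ' u = b + 1 := by rw [hρ' u hu, if_pos rfl]
  refine ⟨?_, ?_, ?_, ?_⟩
  · intro c hc r hr
    by_cases hcu : c = u
    · subst hcu
      obtain rfl : r = b := by omega
      refine ⟨hbK, hbu, fun r' hr' hZr => ?_⟩
      rw [hp' r hbK, if_pos rfl]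
      have := hb r' hr' hZr
      have := hmono r' hr'
      omega
    · obtain ⟨h1, h2⟩ := hne c hc hcu r hr
      obtain ⟨h3, h4, h5⟩ := h.cheap c hc r h2
      refine ⟨h3, h4, fun r' hr' hZr => ?_⟩
      rw [hp' r h3, if_neg h1]
      have := h5 r' hr' hZr
      have := hmono r' hr'
      omega
  · intro c hc c' hc' he h0
    obtain ⟨r, hr⟩ := Nat.exists_eq_succ_of_ne_zero h0
    have hr1 : ρ' c = r + 1 := hr
    have hr2 : ρ' c' = r + 1 := he ▸ hr1
    by_cases hcu : c = u
    · by_cases hcu' : c' = u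
      · rw [hcu, hcu']
      · have := (hne c' hc' hcu' r hr2).1
        subst hcu; omega
    · by_cases hcu' : c' = u
      · have := (hne c hc hcu r hr1).1
        subst hcu'; omega
      · have h1 := (hne c hc hcu r hr1).2
        have h2 := (hne c' hc' hcu' r hr2).2
        exact h.inj c hc c' hc' (by omega) (by omega)
  · intro r hr h0
    by_cases hrb : r = b
    · exact ⟨u, hu, by rw [hu', hrb]⟩
    · rw [hp' r hr, if_neg hrb] at h0
      obtain ⟨c, hc, hcr⟩ := h.held r hr h0
      refine ⟨c, hc, ?_⟩
      have : c ≠ u := by rintro rfl; omega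
      rw [hρ' c hc, if_neg this, if_neg (by omega), hcr]
  · intro r hr
    rw [hp' r hr]
    have := h.bound r hr
    split_ifs with h1
    · subst h1; omega
    · exact this

/-- As long as some column holds no row, the sum of the prices is below `K * K`. -/
theorem AuctionInv.sum_lt {K : ℕ} {Z : ℕ → ℕ → ℝ} {ρ p : ℕ → ℕ} {μ : ℝ} (h : AuctionInv K Z ρ p)
    (hZ : DoublyStochastic K Z μ) (hμ : 0 < μ) {u : ℕ} (hu : u < K) (hρ : ρ u = 0) :
    ∑ r ∈ Finset.range K, p r < K * K := by
  -- At level zero the count shows that some row has never received a bid, which makes the bound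
  -- strict.
  have h1 := h.level hZ hμ hu hρ (j := 0) fun _ _ _ => Nat.zero_le _
  have h2 : ∃ r < K, p r = 0 := by
    by_contra! hcon
    have : ((Finset.range K).filter fun r => 0 + 1 ≤ p r) = Finset.range K :=
      Finset.filter_true_of_mem fun r hr => Nat.pos_of_ne_zero (hcon r (Finset.mem_range.1 hr))
    rw [this] at h1
    simp at h1
  obtain ⟨r, hr, hr0⟩ := h2
  calc ∑ r ∈ Finset.range K, p r < ∑ r ∈ Finset.range K, K :=
        Finset.sum_lt_sum (fun r hr => h.bound r (Finset.mem_range.1 hr))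
          ⟨r, Finset.mem_range.2 hr, by omega⟩
    _ = K * K := by simp

theorem DoublyStochastic.exists_pos {K : ℕ} {Z : ℕ → ℕ → ℝ} {μ : ℝ} (hZ : DoublyStochastic K Z μ)
    (hμ : 0 < μ) {u : ℕ} (hu : u < K) : ∃ r < K, 0 < Z r u := by
  by_contra! hcon
  have := hZ.col u hu
  have h2 : ∑ r ∈ Finset.range K, Z r u ≤ 0 :=
    Finset.sum_nonpos fun r hr => hcon r (Finset.mem_range.1 hr)
  linarith

/-! ### Convex decomposition by repeated subtraction of matchings -/

open Classical in
/-- The number of nonzero entries. -/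
noncomputable def supportCard (K : ℕ) (Z : ℕ → ℕ → ℝ) : ℕ :=
  ((Finset.range K ×ˢ Finset.range K).filter fun e => Z e.1 e.2 ≠ 0).card

/-- The state of the decomposition of `Z₀`: `Z` is the remaining matrix, with row and column sums
`μ`, and the permutation matrices of `ρ k` have been subtracted with the weights `wt k`. -/
structure DecompInv (K : ℕ) (Z₀ Z : ℕ → ℕ → ℝ) (μ : ℝ) (size : ℕ) (wt : ℕ → ℝ)
    (ρ : ℕ → ℕ → ℕ) : Prop where
  ds : DoublyStochastic K Z μ
  pos : ∀ k < size, 0 < wt k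
  sum : ∑ k ∈ Finset.range size, wt k = 1 - μ
  lt : ∀ k < size, ∀ c < K, ρ k c < K
  inj : ∀ k < size, ∀ c < K, ∀ c' < K, ρ k c = ρ k c' → c = c'
  eq : ∀ r < K, ∀ c < K,
    Z₀ r c = Z r c + ∑ k ∈ Finset.range size, wt k * if ρ k c = r then 1 else 0

theorem DecompInv.step {K : ℕ} {Z₀ Z : ℕ → ℕ → ℝ} {μ : ℝ} {size : ℕ} {wt : ℕ → ℝ}
    {ρ : ℕ → ℕ → ℕ} (h : DecompInv K Z₀ Z μ size wt ρ) {σ : ℕ → ℕ} (hσ : ∀ c < K, σ c < K)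
    (hinj : ∀ c < K, ∀ c' < K, σ c = σ c' → c = c') {l : ℝ} (hl : 0 < l)
    (hle : ∀ c < K, l ≤ Z (σ c) c) {wt' : ℕ → ℝ} {ρ' : ℕ → ℕ → ℕ} {Z' : ℕ → ℕ → ℝ}
    (hwt : ∀ k < size, wt' k = wt k) (hwt' : wt' size = l)
    (hρ : ∀ k < size, ρ' k = ρ k) (hρ' : ρ' size = σ)
    (hZ' : ∀ r < K, ∀ c < K, Z' r c = if σ c = r then Z r c - l else Z r c) :
    DecompInv K Z₀ Z' (μ - l) (size + 1) wt' ρ' := by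
  have hZ'' : ∀ r < K, ∀ c < K, Z' r c = Z r c - if σ c = r then l else 0 := by
    intro r hr c hc
    rw [hZ' r hr c hc]
    split_ifs <;> ring
  -- An injection of a finite set into itself hits every row exactly once, so all row sums, like the
  -- column sums, drop by the same `l`.
  have hsurj : ∀ r < K, ∃ c < K, σ c = r := by
    intro r hr
    have := Finset.surj_on_of_inj_on_of_card_le (s := Finset.range K) (t := Finset.range K)
      (fun c _ => σ c) (fun c hc => Finset.mem_range.2 (hσ c (Finset.mem_range.1 hc)))
      (fun c c' hc hc' => hinj c (Finset.mem_range.1 hc) c' (Finset.mem_range.1 hc')) le_rfl r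
      (Finset.mem_range.2 hr)
    obtain ⟨c, hc, hcr⟩ := this
    exact ⟨c, Finset.mem_range.1 hc, hcr.symm⟩
  refine ⟨⟨?_, ?_, ?_⟩, ?_, ?_, ?_, ?_, ?_⟩
  · intro r hr c hc
    rw [hZ' r hr c hc]
    split_ifs with h1
    · have := hle c hc
      rw [h1] at this
      linarith
    · exact h.ds.nonneg r hr c hc
  · intro r hr
    rw [Finset.sum_congr rfl fun c hc => hZ'' r hr c (Finset.mem_range.1 hc),
      Finset.sum_sub_distrib, h.ds.row r hr]
    congr 1
    obtain ⟨c, hc, hcr⟩ := hsurj r hr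
    rw [Finset.sum_eq_single_of_mem c (Finset.mem_range.2 hc), if_pos hcr]
    intro c' hc' hne
    rw [if_neg]
    intro h1
    exact hne (hinj c' (Finset.mem_range.1 hc') c hc (h1.trans hcr.symm))
  · intro c hc
    rw [Finset.sum_congr rfl fun r hr => hZ'' r (Finset.mem_range.1 hr) c hc,
      Finset.sum_sub_distrib, h.ds.col c hc, Finset.sum_ite_eq,
      if_pos (Finset.mem_range.2 (hσ c hc))]
  · intro k hk
    rcases Nat.lt_succ_iff_lt_or_eq.1 hk with hk | rfl
    · rw [hwt k hk]; exact h.pos k hk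
    · rwa [hwt']
  · rw [Finset.sum_range_succ, hwt', Finset.sum_congr rfl fun k hk => hwt k (Finset.mem_range.1 hk),
      h.sum]
    ring
  · intro k hk
    rcases Nat.lt_succ_iff_lt_or_eq.1 hk with hk | rfl
    · rw [hρ k hk]; exact h.lt k hk
    · rwa [hρ']
  · intro k hk
    rcases Nat.lt_succ_iff_lt_or_eq.1 hk with hk | rfl
    · rw [hρ k hk]; exact h.inj k hk
    · rwa [hρ']
  · intro r hr c hc
    rw [Finset.sum_range_succ, hwt', hρ', h.eq r hr c hc, hZ'' r hr c hc]
    have : ∑ k ∈ Finset.range size, wt' k * (if ρ' k c = r then (1 : ℝ) else 0) =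
        ∑ k ∈ Finset.range size, wt k * if ρ k c = r then (1 : ℝ) else 0 :=
      Finset.sum_congr rfl fun k hk => by
        rw [hwt k (Finset.mem_range.1 hk), hρ k (Finset.mem_range.1 hk)]
    rw [this]
    split_ifs <;> ring

/-- The entry attaining the minimum vanishes. No entry appears, because only matched entries change
and these were at least `l > 0`. -/
theorem supportCard_lt {K : ℕ} {Z Z' : ℕ → ℕ → ℝ} {σ : ℕ → ℕ} {l : ℝ} (hl : 0 < l)
    (hZ' : ∀ r < K, ∀ c < K, Z' r c = if σ c = r then Z r c - l else Z r c)
    (hle : ∀ c < K, l ≤ Z (σ c) c) {c : ℕ} (hc : c < K) (hσ : σ c < K) (heq : Z (σ c) c = l) :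
    supportCard K Z' < supportCard K Z := by
  classical
  unfold supportCard
  refine Finset.card_lt_card ?_
  rw [Finset.ssubset_iff_of_subset]
  · refine ⟨(σ c, c), ?_, ?_⟩
    · simp [hc, hσ, heq, hl.ne']
    · simp [hc, hσ, hZ', heq]
  · rintro ⟨r, c⟩ h
    simp only [Finset.mem_filter, Finset.mem_product, Finset.mem_range] at h ⊢
    refine ⟨h.1, fun h0 => h.2 ?_⟩
    rw [hZ' r h.1.1 c h.1.2, if_neg, h0]
    rintro rfl
    have := hle c h.1.2
    linarith

theorem supportCard_le (K : ℕ) (Z : ℕ → ℕ → ℝ) : supportCard K Z ≤ K * K := by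
  classical
  refine (Finset.card_filter_le _ _).trans ?_
  simp

theorem DoublyStochastic.eq_zero_of_supportCard {K : ℕ} {Z : ℕ → ℕ → ℝ} {μ : ℝ}
    (h : DoublyStochastic K Z μ) (hK : 0 < K) (h0 : supportCard K Z = 0) : μ = 0 := by
  classical
  rw [← h.row 0 hK]
  refine Finset.sum_eq_zero fun c hc => ?_
  unfold supportCard at h0
  rw [Finset.card_eq_zero, Finset.filter_eq_empty_iff] at h0
  have := h0 (x := (0, c)) (by simpa [hK] using hc)
  simpa using this

/-! ### The phases of `DifferentSpeedsEating` -/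

variable {n m : ℕ}

theorem Instance.before_refl (I : Instance n m) (i : Fin n) (g : Fin m) : I.Before i g g :=
  Or.inr ⟨rfl, le_rfl⟩

theorem Instance.before_trans (I : Instance n m) {i : Fin n} {f g h : Fin m}
    (h1 : I.Before i f g) (h2 : I.Before i g h) : I.Before i f h := by
  unfold Instance.Before at *
  rcases h1 with h1 | ⟨h1, h1'⟩ <;> rcases h2 with h2 | ⟨h2, h2'⟩
  · exact Or.inl (h2.trans h1)
  · exact Or.inl (h2 ▸ h1)
  · exact Or.inl (h1 ▸ h2)
  · exact Or.inr ⟨h1.trans h2, h1'.trans h2'⟩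

theorem Instance.before_antisymm (I : Instance n m) {i : Fin n} {g h : Fin m}
    (h1 : I.Before i g h) (h2 : I.Before i h g) : g = h := by
  unfold Instance.Before at *
  rcases h1 with h1 | ⟨h1, h1'⟩ <;> rcases h2 with h2 | ⟨h2, h2'⟩
  · exact absurd h1 (not_lt.2 h2.le)
  · exact absurd h1 (not_lt.2 h2.ge)
  · exact absurd h2 (not_lt.2 h1.ge)
  · exact le_antisymm h1' h2'

theorem Instance.before_total (I : Instance n m) (i : Fin n) (g h : Fin m) :
    I.Before i g h ∨ I.Before i h g := by
  unfold Instance.Before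
  rcases lt_trichotomy (I.v i g) (I.v i h) with h1 | h1 | h1
  · exact Or.inr (Or.inl h1)
  · rcases le_total g h with h2 | h2
    · exact Or.inl (Or.inr ⟨h1, h2⟩)
    · exact Or.inr (Or.inr ⟨h1.symm, h2⟩)
  · exact Or.inl (Or.inl h1)

theorem Instance.exists_first (I : Instance n m) (i : Fin n) {S : Finset (Fin m)}
    (hS : S.Nonempty) : ∃ g ∈ S, ∀ h ∈ S, I.Before i g h := by
  classical
  induction hS using Finset.Nonempty.cons_induction with
  | singleton a => exact ⟨a, by simp, by simpa using I.before_refl i a⟩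
  | cons a s ha hs ih =>
    obtain ⟨g, hg, hg'⟩ := ih
    rcases I.before_total i a g with h1 | h1
    · refine ⟨a, by simp, fun h hh => ?_⟩
      rcases Finset.mem_cons.1 hh with rfl | hh
      · exact I.before_refl i h
      · exact I.before_trans h1 (hg' h hh)
    · refine ⟨g, by simp [hg], fun h hh => ?_⟩
      rcases Finset.mem_cons.1 hh with rfl | hh
      · exact h1
      · exact hg' h hh

theorem Instance.exists_last (I : Instance n m) (i : Fin n) {S : Finset (Fin m)}
    (hS : S.Nonempty) : ∃ g ∈ S, ∀ h ∈ S, I.Before i h g := by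
  classical
  induction hS using Finset.Nonempty.cons_induction with
  | singleton a => exact ⟨a, by simp, by simpa using I.before_refl i a⟩
  | cons a s ha hs ih =>
    obtain ⟨g, hg, hg'⟩ := ih
    rcases I.before_total i g a with h1 | h1
    · refine ⟨a, by simp, fun h hh => ?_⟩
      rcases Finset.mem_cons.1 hh with rfl | hh
      · exact I.before_refl i h
      · exact I.before_trans (hg' h hh) h1
    · refine ⟨g, by simp [hg], fun h hh => ?_⟩
      rcases Finset.mem_cons.1 hh with rfl | hh
      · exact h1
      · exact hg' h hh

theorem Instance.mem_initialSegment (I : Instance n m) {i : Fin n} {g h : Fin m} :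
    h ∈ I.initialSegment i g ↔ I.Before i h g := by
  simp [Instance.initialSegment]

theorem Instance.exists_favorite (I : Instance n m) (i : Fin n) {S : Finset (Fin m)}
    (hS : S.Nonempty) : ∃ g, I.IsFavorite S i g := by
  obtain ⟨g, h1, h2⟩ := I.exists_first i hS
  exact ⟨g, h1, h2⟩

theorem Instance.IsFavorite.unique {I : Instance n m} {i : Fin n} {S : Finset (Fin m)}
    {g h : Fin m} (hg : I.IsFavorite S i g) (hh : I.IsFavorite S i h) : g = h :=
  I.before_antisymm (hg.2 h hh.1) (hh.2 g hg.1)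

/-- The variables after `k` phases. -/
noncomputable def Instance.phase (I : Instance n m) (k : ℕ) : EatingState n m :=
  I.eatingStep^[k] ⟨Finset.univ, fun _ => 1, fun _ _ => 0⟩

/-- The length of phase `k`. -/
noncomputable def Instance.dur (I : Instance n m) (k : ℕ) : ℝ := I.phaseLength (I.phase k)

/-- The time at which phase `k` begins. -/
noncomputable def Instance.clock (I : Instance n m) (k : ℕ) : ℝ := ∑ j ∈ Finset.range k, I.dur j

theorem Instance.phase_succ (I : Instance n m) (k : ℕ) :
    I.phase (k + 1) = I.eatingStep (I.phase k) := Function.iterate_succ_apply' _ _ _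

theorem Instance.clock_succ (I : Instance n m) (k : ℕ) : I.clock (k + 1) = I.clock k + I.dur k :=
  Finset.sum_range_succ _ _

theorem Instance.speed_nonneg (I : Instance n m) (S : Finset (Fin m)) (g : Fin m) :
    0 ≤ I.speed S g := Finset.sum_nonneg fun i _ => (I.w_pos i).le

theorem Instance.speed_pos (I : Instance n m) {S : Finset (Fin m)} {i : Fin n} {g : Fin m}
    (h : I.IsFavorite S i g) : 0 < I.speed S g := by
  classical
  exact Finset.sum_pos (fun i _ => I.w_pos i) ⟨i, by simpa using h⟩

theorem Instance.exists_favorite_of_speed (I : Instance n m) {S : Finset (Fin m)} {g : Fin m}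
    (h : I.speed S g ≠ 0) : ∃ i, I.IsFavorite S i g := by
  classical
  obtain ⟨i, hi, _⟩ := Finset.exists_ne_zero_of_sum_ne_zero h
  exact ⟨i, by simpa using hi⟩

theorem Instance.agents_pos (I : Instance n m) : 0 < n := by
  rcases Nat.eq_zero_or_pos n with rfl | h
  · have := I.w_sum
    simp at this
  · exact h

/-- The characterization of the duration of a phase. -/
theorem Instance.phaseLength_spec (I : Instance n m) (s : EatingState n m)
    (hs : s.goods.Nonempty) :
    (∃ g ∈ s.goods, I.speed s.goods g ≠ 0 ∧ I.phaseLength s = s.supply g / I.speed s.goods g) ∧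
    (∀ g ∈ s.goods, I.speed s.goods g ≠ 0 →
      I.phaseLength s ≤ s.supply g / I.speed s.goods g) ∧
    (∀ g, g ∈ (I.eatingStep s).goods ↔
      g ∈ s.goods ∧ (I.speed s.goods g ≠ 0 →
        I.phaseLength s ≠ s.supply g / I.speed s.goods g)) := by
  classical
  obtain ⟨g₀, hg₀, hmin⟩ := Finset.exists_mem_eq_inf s.goods hs fun g => I.finishTime s g
  have hle : ∀ g ∈ s.goods, I.finishTime s g₀ ≤ I.finishTime s g := fun g hg => by
    rw [← hmin]; exact Finset.inf_le hg
  -- There is an agent, as the entitlements sum to 1, and her favorite is eaten at positive speed.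
  -- So the least finish time is finite.
  obtain ⟨g₁, hg₁⟩ := I.exists_favorite ⟨0, I.agents_pos⟩ hs
  have h1 : I.speed s.goods g₁ ≠ 0 := (I.speed_pos hg₁).ne'
  have h0 : I.speed s.goods g₀ ≠ 0 := by
    intro h0
    have := hle g₁ hg₁.1
    simp [Instance.finishTime, h0, h1] at this
  have hlen : I.phaseLength s = s.supply g₀ / I.speed s.goods g₀ := by
    unfold Instance.phaseLength
    rw [hmin, Instance.finishTime, if_neg h0]
    rfl
  have hle' : ∀ g ∈ s.goods, I.speed s.goods g ≠ 0 →
      I.phaseLength s ≤ s.supply g / I.speed s.goods g := by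
    intro g hg hg'
    have := hle g hg
    rw [Instance.finishTime, if_neg h0, Instance.finishTime, if_neg hg',
      WithTop.coe_le_coe] at this
    rwa [hlen]
  refine ⟨⟨g₀, hg₀, h0, hlen⟩, hle', fun g => ?_⟩
  simp only [Instance.eatingStep, Finset.mem_filter, and_congr_right_iff]
  intro hg
  constructor
  · intro h2 h3 h4
    refine h2 fun h hh => ?_
    refine le_trans (le_of_eq ?_) (hle h hh)
    rw [Instance.finishTime, if_neg h3, Instance.finishTime, if_neg h0, ← h4, hlen]
  · intro h2 h3
    have h4 := h3 g₀ hg₀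
    have h5 : I.speed s.goods g ≠ 0 := by
      intro h5
      rw [Instance.finishTime, if_pos h5, Instance.finishTime, if_neg h0] at h4
      simp at h4
    rw [Instance.finishTime, if_neg h5, Instance.finishTime, if_neg h0, WithTop.coe_le_coe,
      ← hlen] at h4
    exact h2 h5 (le_antisymm (hle' g hg h5) h4)

theorem Instance.phaseLength_of_empty (I : Instance n m) (s : EatingState n m)
    (hs : s.goods = ∅) : I.phaseLength s = 0 := by
  simp [Instance.phaseLength, hs]

theorem Instance.speed_of_notMem (I : Instance n m) {S : Finset (Fin m)} {g : Fin m}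
    (h : g ∉ S) : I.speed S g = 0 := by
  by_contra h0
  obtain ⟨i, hi⟩ := I.exists_favorite_of_speed h0
  exact h hi.1

theorem Instance.supply_succ (I : Instance n m) (k : ℕ) (g : Fin m) :
    (I.phase (k + 1)).supply g =
      (I.phase k).supply g - I.dur k * I.speed (I.phase k).goods g := by
  rw [I.phase_succ]; rfl

open Classical in
theorem Instance.alloc_succ (I : Instance n m) (k : ℕ) (i : Fin n) (g : Fin m) :
    (I.phase (k + 1)).alloc i g = (I.phase k).alloc i g +
      if I.IsFavorite (I.phase k).goods i g then I.dur k * I.w i else 0 := by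
  rw [I.phase_succ]; rfl

/-- The remaining goods are those with remaining supply. -/
theorem Instance.phase_inv (I : Instance n m) (k : ℕ) :
    (∀ g, 0 ≤ (I.phase k).supply g) ∧ ∀ g, g ∈ (I.phase k).goods ↔ 0 < (I.phase k).supply g := by
  induction k with
  | zero => simp [Instance.phase]
  | succ k ih =>
    obtain ⟨h1, h2⟩ := ih
    rcases (I.phase k).goods.eq_empty_or_nonempty with h0 | h0
    · have hd : I.dur k = 0 := I.phaseLength_of_empty _ h0
      have hg : (I.phase (k + 1)).goods = (I.phase k).goods := by
        rw [I.phase_succ, h0]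
        simp [Instance.eatingStep, h0]
      simp only [I.supply_succ, hd, hg, zero_mul, sub_zero]
      exact ⟨h1, h2⟩
    · obtain ⟨_, h4, h5⟩ := I.phaseLength_spec _ h0
      rw [← I.phase_succ] at h5
      change ∀ g ∈ _, _ → I.dur k ≤ _ at h4
      change ∀ g, _ ↔ _ ∧ (_ → I.dur k ≠ _) at h5
      have h6 : ∀ g, 0 ≤ (I.phase (k + 1)).supply g := by
        intro g
        rw [I.supply_succ]
        by_cases hg : I.speed (I.phase k).goods g = 0
        · rw [hg]; simpa using h1 g
        · have hgm : g ∈ (I.phase k).goods := by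
            by_contra h; exact hg (I.speed_of_notMem h)
          have := h4 g hgm hg
          rw [le_div_iff₀ (lt_of_le_of_ne (I.speed_nonneg _ _) (Ne.symm hg))] at this
          linarith
      refine ⟨h6, fun g => ?_⟩
      rw [h5 g, h2 g]
      by_cases hg : I.speed (I.phase k).goods g = 0
      · simp [I.supply_succ, hg]
      · have hgm : g ∈ (I.phase k).goods := by
          by_contra h; exact hg (I.speed_of_notMem h)
        -- A good that is being eaten runs out exactly when its own finish time equals the length of
        -- the phase.
        have h7 : 0 < (I.phase (k + 1)).supply g ↔ (I.phase (k + 1)).supply g ≠ 0 :=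
          ⟨fun h => h.ne', fun h => lt_of_le_of_ne (h6 g) (Ne.symm h)⟩
        rw [h7, I.supply_succ]
        simp only [(h2 g).1 hgm, true_and, hg, ne_eq, not_false_eq_true, true_implies]
        rw [eq_div_iff hg, sub_eq_zero, eq_comm]

theorem Instance.supply_nonneg (I : Instance n m) (k : ℕ) (g : Fin m) :
    0 ≤ (I.phase k).supply g := (I.phase_inv k).1 g

theorem Instance.mem_goods (I : Instance n m) {k : ℕ} {g : Fin m} :
    g ∈ (I.phase k).goods ↔ 0 < (I.phase k).supply g := (I.phase_inv k).2 g

theorem Instance.dur_nonneg (I : Instance n m) (k : ℕ) : 0 ≤ I.dur k := by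
  rcases (I.phase k).goods.eq_empty_or_nonempty with h0 | h0
  · exact (I.phaseLength_of_empty _ h0).ge
  · obtain ⟨⟨g, _, _, h⟩, _, _⟩ := I.phaseLength_spec _ h0
    rw [Instance.dur, h]
    exact div_nonneg (I.supply_nonneg _ _) (I.speed_nonneg _ _)

theorem Instance.goods_succ_subset (I : Instance n m) (k : ℕ) :
    (I.phase (k + 1)).goods ⊆ (I.phase k).goods := by
  classical
  rw [I.phase_succ]
  exact Finset.filter_subset _ _

theorem Instance.goods_antitone (I : Instance n m) : Antitone fun k => (I.phase k).goods :=
  antitone_nat_of_succ_le fun k => I.goods_succ_subset k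

theorem Instance.supply_le_one (I : Instance n m) (k : ℕ) (g : Fin m) :
    (I.phase k).supply g ≤ 1 := by
  induction k with
  | zero => simp [Instance.phase]
  | succ k ih =>
    rw [I.supply_succ]
    have := mul_nonneg (I.dur_nonneg k) (I.speed_nonneg (I.phase k).goods g)
    linarith

theorem Instance.card_goods (I : Instance n m) (k : ℕ) (hk : k ≤ m) :
    (I.phase k).goods.card + k ≤ m := by
  induction k with
  | zero => simp [Instance.phase]
  | succ k ih =>
    have ih := ih (by omega)
    rcases (I.phase k).goods.eq_empty_or_nonempty with h0 | h0
    · have : (I.phase (k + 1)).goods = ∅ := Finset.subset_empty.1 (h0 ▸ I.goods_succ_subset k)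
      simp [this, hk]
    · obtain ⟨⟨g, hg, hg', h⟩, _, h5⟩ := I.phaseLength_spec _ h0
      have : (I.phase (k + 1)).goods ⊂ (I.phase k).goods := by
        refine (Finset.ssubset_iff_of_subset (I.goods_succ_subset k)).2 ⟨g, hg, ?_⟩
        rw [I.phase_succ, h5]
        exact fun h6 => h6.2 hg' h
      have := Finset.card_lt_card this
      omega

theorem Instance.goods_end (I : Instance n m) : (I.phase m).goods = ∅ := by
  have := I.card_goods m le_rfl
  exact Finset.card_eq_zero.1 (by omega)

open Classical in
theorem Instance.alloc_eq (I : Instance n m) (k : ℕ) (i : Fin n) (g : Fin m) :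
    (I.phase k).alloc i g = ∑ j ∈ Finset.range k,
      if I.IsFavorite (I.phase j).goods i g then I.dur j * I.w i else 0 := by
  induction k with
  | zero => simp [Instance.phase]
  | succ k ih => rw [I.alloc_succ, ih, Finset.sum_range_succ]

open Classical in
theorem Instance.eating_eq (I : Instance n m) (i : Fin n) (g : Fin m) :
    I.eating i g = ∑ j ∈ Finset.range m,
      if I.IsFavorite (I.phase j).goods i g then I.dur j * I.w i else 0 := I.alloc_eq m i g

theorem Instance.eating_nonneg (I : Instance n m) (i : Fin n) (g : Fin m) : 0 ≤ I.eating i g := by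
  classical
  rw [I.eating_eq]
  refine Finset.sum_nonneg fun j _ => ?_
  split_ifs
  · exact mul_nonneg (I.dur_nonneg _) (I.w_pos _).le
  · exact le_rfl

/-- Conservation: the amount leaving the supply in a phase is the sum of the amounts taken by those
whose favorite the good is. -/
theorem Instance.sum_alloc (I : Instance n m) (k : ℕ) (g : Fin m) :
    ∑ i, (I.phase k).alloc i g = 1 - (I.phase k).supply g := by
  classical
  induction k with
  | zero => simp [Instance.phase]
  | succ k ih =>
    simp only [I.alloc_succ, Finset.sum_add_distrib, ih, I.supply_succ, Instance.speed,
      Finset.mul_sum, Finset.sum_filter, mul_ite, mul_zero]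
    ring

theorem Instance.sum_eating (I : Instance n m) (g : Fin m) : ∑ i, I.eating i g = 1 := by
  have h1 := I.sum_alloc m g
  have h2 : (I.phase m).supply g = 0 := by
    by_contra h
    have := I.mem_goods.2 (lt_of_le_of_ne (I.supply_nonneg m g) (Ne.symm h))
    simp [I.goods_end] at this
  rw [h2, sub_zero] at h1
  exact h1

open Classical in
/-- What an agent eats of a set of goods in a phase. -/
theorem Instance.sum_favorite_le (I : Instance n m) (S G : Finset (Fin m)) (i : Fin n) {x : ℝ}
    (hx : 0 ≤ x) : (∑ g ∈ G, if I.IsFavorite S i g then x else 0) ≤ x := by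
  rcases S.eq_empty_or_nonempty with rfl | hS
  · simpa [Instance.IsFavorite] using hx
  · obtain ⟨f, hf⟩ := I.exists_favorite i hS
    have : ∀ g, (if I.IsFavorite S i g then x else 0) = if f = g then x else 0 := fun g => by
      by_cases h : f = g
      · subst h; simp [hf]
      · rw [if_neg h, if_neg fun h' => h (hf.unique h')]
    simp only [this, Finset.sum_ite_eq]
    split_ifs
    · exact le_rfl
    · exact hx

open Classical in
theorem Instance.sum_favorite_eq (I : Instance n m) (S G : Finset (Fin m)) (i : Fin n) (x : ℝ)
    {f : Fin m} (hf : I.IsFavorite S i f) (hfG : f ∈ G) :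
    (∑ g ∈ G, if I.IsFavorite S i g then x else 0) = x := by
  rw [Finset.sum_eq_single_of_mem f hfG, if_pos hf]
  intro g _ hg
  rw [if_neg fun h' => hg (h'.unique hf)]

open Classical in
theorem Instance.sum_favorite_zero (I : Instance n m) (S G : Finset (Fin m)) (i : Fin n) (x : ℝ)
    (hG : ∀ g ∈ G, g ∉ S) :
    (∑ g ∈ G, if I.IsFavorite S i g then x else 0) = 0 :=
  Finset.sum_eq_zero fun g hg => if_neg fun h => hG g hg h.1

/-- The phase at the beginning of which a set of goods has just been finished. -/
theorem Instance.exists_finish (I : Instance n m) (G : Finset (Fin m)) : ∃ K ≤ m,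
    (∀ k, K ≤ k → ∀ g ∈ G, g ∉ (I.phase k).goods) ∧
    ∀ k < K, ∃ g ∈ G, g ∈ (I.phase k).goods := by
  classical
  have hex : ∃ K, ∀ g ∈ G, g ∉ (I.phase K).goods := ⟨m, by simp [I.goods_end]⟩
  refine ⟨Nat.find hex, Nat.find_min' hex (by simp [I.goods_end]), fun k hk g hg h => ?_,
    fun k hk => ?_⟩
  · exact Nat.find_spec hex g hg (I.goods_antitone hk h)
  · have := Nat.find_min hex hk
    push Not at this
    exact this

/-- `G` is closed under better goods. -/
def Instance.UpClosed (I : Instance n m) (i : Fin n) (G : Finset (Fin m)) : Prop :=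
  ∀ g ∈ G, ∀ h, I.Before i h g → h ∈ G

theorem Instance.upClosed_initialSegment (I : Instance n m) (i : Fin n) (g : Fin m) :
    I.UpClosed i (I.initialSegment i g) := fun a ha h hh => by
  rw [I.mem_initialSegment] at *
  exact I.before_trans hh ha

/-- This is why an agent eats only from an initial segment of her ordering until the segment is
exhausted. -/
theorem Instance.UpClosed.favorite_mem {I : Instance n m} {i : Fin n} {G S : Finset (Fin m)}
    (hG : I.UpClosed i G) {g f : Fin m} (hg : g ∈ G) (hgS : g ∈ S) (hf : I.IsFavorite S i f) :
    f ∈ G := hG g hg f (hf.2 g hgS)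

/-- In each phase the agent eats at most speed times duration, and nothing of `G` from phase `K` on.
No relation between `G` and her ordering is needed, so this applies to the segments of other agents.
-/
theorem Instance.sum_eating_le (I : Instance n m) (i : Fin n) (G : Finset (Fin m)) {K : ℕ}
    (hK : ∀ k, K ≤ k → ∀ g ∈ G, g ∉ (I.phase k).goods) :
    ∑ g ∈ G, I.eating i g ≤ I.w i * I.clock K := by
  classical
  simp only [I.eating_eq]
  rw [Finset.sum_comm]
  have hx : ∀ j, 0 ≤ I.dur j * I.w i := fun j => mul_nonneg (I.dur_nonneg j) (I.w_pos i).le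
  calc ∑ j ∈ Finset.range m, ∑ g ∈ G,
        (if I.IsFavorite (I.phase j).goods i g then I.dur j * I.w i else 0)
      ≤ ∑ j ∈ Finset.range m, (if j < K then I.dur j * I.w i else 0) := by
        refine Finset.sum_le_sum fun j _ => ?_
        split_ifs with hj
        · exact I.sum_favorite_le _ _ _ (hx j)
        · rw [I.sum_favorite_zero _ _ _ _ (hK j (by omega))]
    _ ≤ ∑ j ∈ Finset.range K, I.dur j * I.w i := by
        rw [← Finset.sum_filter]
        refine Finset.sum_le_sum_of_subset_of_nonneg (fun j hj => ?_) fun j _ _ => hx j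
        simp at hj ⊢; exact hj.2
    _ = I.w i * I.clock K := by
        rw [Instance.clock, Finset.mul_sum]
        exact Finset.sum_congr rfl fun _ _ => mul_comm _ _

/-- Up to phase `K` some good of `G` remains, so the favorite lies in `G` and the speed is spent on
`G` without loss. -/
theorem Instance.sum_eating_eq (I : Instance n m) {i : Fin n} {G : Finset (Fin m)}
    (hG : I.UpClosed i G) {K : ℕ} (hKm : K ≤ m)
    (hK : ∀ k, K ≤ k → ∀ g ∈ G, g ∉ (I.phase k).goods)
    (hK' : ∀ k < K, ∃ g ∈ G, g ∈ (I.phase k).goods) :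
    ∑ g ∈ G, I.eating i g = I.w i * I.clock K := by
  classical
  simp only [I.eating_eq]
  rw [Finset.sum_comm]
  calc ∑ j ∈ Finset.range m, ∑ g ∈ G,
        (if I.IsFavorite (I.phase j).goods i g then I.dur j * I.w i else 0)
      = ∑ j ∈ Finset.range m, (if j < K then I.dur j * I.w i else 0) := by
        refine Finset.sum_congr rfl fun j _ => ?_
        split_ifs with hj
        · obtain ⟨g, hg, hgS⟩ := hK' j hj
          obtain ⟨f, hf⟩ := I.exists_favorite i ⟨g, hgS⟩
          exact I.sum_favorite_eq _ _ _ _ hf (hG.favorite_mem hg hgS hf)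
        · rw [I.sum_favorite_zero _ _ _ _ (hK j (by omega))]
    _ = ∑ j ∈ Finset.range K, I.dur j * I.w i := by
        rw [← Finset.sum_filter]
        refine Finset.sum_congr ?_ fun _ _ => rfl
        ext j; simp; omega
    _ = I.w i * I.clock K := by
        rw [Instance.clock, Finset.mul_sum]
        exact Finset.sum_congr rfl fun _ _ => mul_comm _ _

/-! ### Ex-ante fairness -/

/-- At the moment the segment is finished, its owner has eaten her full speed times the elapsed
time, and any other agent at most hers. -/
theorem Instance.eating_wsdef (I : Instance n m) : I.WSDEF I.eating := by
  intro i j g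
  obtain ⟨K, hKm, h1, h2⟩ := I.exists_finish (I.initialSegment i g)
  rw [I.sum_eating_eq (I.upClosed_initialSegment i g) hKm h1 h2]
  have := mul_le_mul_of_nonneg_left (I.sum_eating_le j _ h1) (I.w_pos i).le
  linarith

/-- Summation by parts: nonnegative sums over the initial segments give a nonnegative value. -/
theorem Instance.sum_value_nonneg (I : Instance n m) (i : Fin n) (d : Fin m → ℝ)
    (hd : ∀ g, 0 ≤ ∑ h ∈ I.initialSegment i g, d h) : 0 ≤ ∑ g, I.v i g * d g := by
  classical
  -- A general offset `c` makes the induction work: raising it to the value of the last good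
  -- annihilates that summand, and the set without it is again closed under better goods.
  have key : ∀ (N : ℕ) (S : Finset (Fin m)), S.card = N → I.UpClosed i S →
      ∀ c, (∀ g ∈ S, c ≤ I.v i g) → 0 ≤ ∑ g ∈ S, (I.v i g - c) * d g := by
    intro N
    induction N with
    | zero =>
      intro S hS _ c _
      rw [Finset.card_eq_zero.1 hS]; simp
    | succ N ih =>
      intro S hS hup c hc
      have hne : S.Nonempty := Finset.card_pos.1 (by omega)
      obtain ⟨l, hl, hl'⟩ := I.exists_last i hne
      have hseg : I.initialSegment i l = S := by
        ext h
        rw [I.mem_initialSegment]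
        exact ⟨hup l hl h, hl' h⟩
      have h1 : ∑ g ∈ S, (I.v i g - c) * d g =
          ∑ g ∈ S, (I.v i g - I.v i l) * d g + (I.v i l - c) * ∑ g ∈ S, d g := by
        rw [Finset.mul_sum, ← Finset.sum_add_distrib]
        exact Finset.sum_congr rfl fun g _ => by ring
      have h2 : ∑ g ∈ S, (I.v i g - I.v i l) * d g =
          ∑ g ∈ S.erase l, (I.v i g - I.v i l) * d g := by
        rw [← Finset.add_sum_erase S _ hl]; simp
      have h3 := ih (S.erase l) (by rw [Finset.card_erase_of_mem hl]; omega) (by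
        intro g hg h hh
        rw [Finset.mem_erase] at hg ⊢
        refine ⟨?_, hup g hg.2 h hh⟩
        rintro rfl
        exact hg.1 (I.before_antisymm (hl' g hg.2) hh)) (I.v i l) (by
        intro g hg
        rcases hl' g (Finset.mem_of_mem_erase hg) with h | h
        · exact h.le
        · exact h.1.ge)
      have h4 := mul_nonneg (sub_nonneg.2 (hc l hl)) (hseg ▸ hd l)
      rw [h1, h2]
      linarith
  have := key _ Finset.univ rfl (fun _ _ _ _ => Finset.mem_univ _) 0 fun g _ => I.v_nonneg i g
  simpa using this

theorem Instance.WSDEF.wef {I : Instance n m} {X : Fin n → Fin m → ℝ} (h : I.WSDEF X) :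
    I.WEF X := by
  intro i j
  have := I.sum_value_nonneg i (fun g => I.w j * X i g - I.w i * X j g) fun g => by
    rw [Finset.sum_sub_distrib, ← Finset.mul_sum, ← Finset.mul_sum]
    linarith [h i j g]
  simp only [Instance.fracValue, Finset.mul_sum]
  rw [← sub_nonneg, ← Finset.sum_sub_distrib]
  convert this using 2
  ring

/-! ### Ex-post fairness -/

theorem sum_matrix_eq_card (Y : Allocation n m) (i : Fin n) (G : Finset (Fin m)) :
    ∑ g ∈ G, Y.matrix i g = ((bundle Y i ∩ G).card : ℝ) := by
  classical
  simp only [Allocation.matrix, Finset.sum_boole, bundle]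
  congr 2
  ext g
  simp [and_comm]

theorem sum_row (X : Fin n → Fin m → ℝ) (i : Fin n) (G : Finset (Fin m)) :
    ∑ e ∈ ({i} : Finset (Fin n)) ×ˢ G, X e.1 e.2 = ∑ g ∈ G, X i g := by
  rw [Finset.sum_product, Finset.sum_singleton]

theorem Instance.value_eq_sum (I : Instance n m) (i : Fin n) (S : Finset (Fin m)) :
    I.value i S = ∑ g, I.v i g * (if g ∈ S then 1 else 0) := by
  classical
  simp [Instance.value]

/-- The integral allocation `Y` respects the quotas of `X`. -/
def Instance.Respects (I : Instance n m) (X : Fin n → Fin m → ℝ) (Y : Allocation n m) : Prop :=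
  ∀ A ∈ I.bihierarchy,
    (⌊∑ e ∈ A, X e.1 e.2⌋ : ℝ) ≤ ∑ e ∈ A, Y.matrix e.1 e.2 ∧
      ∑ e ∈ A, Y.matrix e.1 e.2 ≤ (⌈∑ e ∈ A, X e.1 e.2⌉ : ℝ)

theorem Instance.Respects.segment {I : Instance n m} {X : Fin n → Fin m → ℝ} {Y : Allocation n m}
    (h : I.Respects X Y) (i : Fin n) (g : Fin m) :
    (⌊∑ h ∈ I.initialSegment i g, X i h⌋ : ℝ) ≤ ((bundle Y i ∩ I.initialSegment i g).card : ℝ) ∧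
      ((bundle Y i ∩ I.initialSegment i g).card : ℝ) ≤ (⌈∑ h ∈ I.initialSegment i g, X i h⌉ : ℝ) := by
  have := h _ (Or.inr (Or.inl ⟨i, g, rfl⟩))
  rwa [sum_row, sum_row (fun i g => Y.matrix i g), sum_matrix_eq_card] at this

/-- The upper quota of the singleton is the ceiling of zero. -/
theorem Instance.Respects.notMem {I : Instance n m} {X : Fin n → Fin m → ℝ} {Y : Allocation n m}
    (h : I.Respects X Y) {i : Fin n} {g : Fin m} (h0 : X i g = 0) : g ∉ bundle Y i := by
  have := (h _ (Or.inr (Or.inr ⟨i, g, rfl⟩))).2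
  intro hg
  simp only [bundle, Finset.mem_filter] at hg
  simp [h0, Allocation.matrix, hg.2] at this

/-- The total speed is 1, so finishing `G` takes at least `G.card` units of time, during which the
agent eats only from `G`. -/
theorem Instance.eating_share (I : Instance n m) (i : Fin n) (G : Finset (Fin m))
    (hG : I.UpClosed i G) : I.w i * G.card ≤ ∑ g ∈ G, I.eating i g := by
  obtain ⟨K, hKm, h1, h2⟩ := I.exists_finish G
  rw [I.sum_eating_eq hG hKm h1 h2]
  have h3 : (G.card : ℝ) = ∑ j, ∑ g ∈ G, I.eating j g := by
    rw [Finset.sum_comm]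
    simp [I.sum_eating]
  have h4 : (G.card : ℝ) ≤ ∑ j, I.w j * I.clock K := by
    rw [h3]
    exact Finset.sum_le_sum fun j _ => I.sum_eating_le j G h1
  rw [← Finset.sum_mul, I.w_sum, one_mul] at h4
  exact mul_le_mul_of_nonneg_left h4 (I.w_pos i).le

/-- The good to add is the best one that the agent lacks. A segment containing it gains one good,
which compensates for the rounding down of her share; a segment without it belongs to her entirely.
Summation by parts then compares the values. -/
theorem Instance.Respects.wprop1 {I : Instance n m} {Y : Allocation n m}
    (h : I.Respects I.eating Y) : I.WPROP1 Y := by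
  classical
  intro i
  rcases (bundle Y i)ᶜ.eq_empty_or_nonempty with h0 | h0
  · left
    rw [Finset.compl_eq_empty_iff] at h0
    rw [h0]
    have h1 : I.w i ≤ 1 := by
      rw [← I.w_sum]
      exact Finset.single_le_sum (fun j _ => (I.w_pos j).le) (Finset.mem_univ i)
    have h2 : 0 ≤ I.value i Finset.univ := Finset.sum_nonneg fun g _ => I.v_nonneg i g
    nlinarith
  · right
    obtain ⟨t, ht, ht'⟩ := I.exists_first i h0
    refine ⟨t, by simpa using ht, ?_⟩
    rw [I.value_eq_sum, I.value_eq_sum, Finset.mul_sum, ← sub_nonneg, ← Finset.sum_sub_distrib]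
    have := I.sum_value_nonneg i (fun g => (if g ∈ insert t (bundle Y i) then 1 else 0) - I.w i) ?_
    · convert this using 2
      simp only [Finset.mem_univ, if_true]
      ring
    · intro g
      rw [Finset.sum_sub_distrib, Finset.sum_const, Finset.sum_boole, nsmul_eq_mul]
      have h3 := I.eating_share i _ (I.upClosed_initialSegment i g)
      have hw := (I.w_pos i).le
      have hw1 : I.w i ≤ 1 := by
        rw [← I.w_sum]
        exact Finset.single_le_sum (fun j _ => (I.w_pos j).le) (Finset.mem_univ i)
      by_cases hg : I.Before i t g
      · have h4 := (h.segment i g).1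
        have h5 : ((bundle Y i ∩ I.initialSegment i g).card : ℝ) + 1 ≤
            (({x ∈ I.initialSegment i g | x ∈ insert t (bundle Y i)} : Finset (Fin m)).card : ℝ) := by
          have : insert t (bundle Y i ∩ I.initialSegment i g) ⊆
              ({x ∈ I.initialSegment i g | x ∈ insert t (bundle Y i)} : Finset (Fin m)) := by
            intro x hx
            rcases Finset.mem_insert.1 hx with rfl | hx
            · simpa [I.mem_initialSegment] using hg
            · rw [Finset.mem_inter] at hx
              simp [hx.1, hx.2]
          have h6 := Finset.card_le_card this
          rw [Finset.card_insert_of_notMem (by simp at ht; simp [ht])] at h6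
          exact_mod_cast h6
        -- One more good than the floor is at least the amount eaten, hence at least the
        -- proportional share of the segment.
        have h7 := Int.lt_floor_add_one (∑ h ∈ I.initialSegment i g, I.eating i h)
        linarith
      · have h4 : ({x ∈ I.initialSegment i g | x ∈ insert t (bundle Y i)} : Finset (Fin m)) =
            I.initialSegment i g := by
          refine Finset.filter_true_of_mem fun x hx => Finset.mem_insert_of_mem ?_
          by_contra hx'
          rw [I.mem_initialSegment] at hx
          exact hg (I.before_trans (ht' x (by simpa using hx')) hx)
        rw [h4]
        have : (0 : ℝ) ≤ (I.initialSegment i g).card := Nat.cast_nonneg _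
        nlinarith

/-- The goods of a finished set that an agent gets are, up to one, at most what she has eaten until
the set was finished. -/
theorem Instance.Respects.card_le {I : Instance n m} {Y : Allocation n m}
    (h : I.Respects I.eating Y) (j : Fin n) (G : Finset (Fin m)) {K : ℕ}
    (hK : ∀ k, K ≤ k → ∀ g ∈ G, g ∉ (I.phase k).goods) :
    ((bundle Y j ∩ G).card : ℝ) ≤ I.w j * I.clock K + 1 := by
  classical
  -- `P` consists of the goods that `j` strictly prefers to everything left at phase `K`: an initial
  -- segment of her own ordering (or empty), to which the quotas apply although `G` itself may be no
  -- segment for her.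
  set P : Finset (Fin m) := Finset.univ.filter fun x => ∀ g ∈ (I.phase K).goods, ¬ I.Before j g x
    with hP
  have hup : I.UpClosed j P := by
    intro g hg x hx
    simp only [hP, Finset.mem_filter, Finset.mem_univ, true_and] at hg ⊢
    exact fun a ha hax => hg a ha (I.before_trans hax hx)
  have hPK : ∀ k, K ≤ k → ∀ g ∈ P, g ∉ (I.phase k).goods := by
    intro k hk g hg hgk
    simp only [hP, Finset.mem_filter, Finset.mem_univ, true_and] at hg
    exact hg g (I.goods_antitone hk hgk) (I.before_refl j g)
  have hsub : bundle Y j ∩ G ⊆ bundle Y j ∩ P := by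
    intro x hx
    rw [Finset.mem_inter] at hx ⊢
    refine ⟨hx.1, ?_⟩
    by_contra hxP
    simp only [hP, Finset.mem_filter, Finset.mem_univ, true_and] at hxP
    push Not at hxP
    obtain ⟨f, hf, hfx⟩ := hxP
    -- A good of `G` outside `P` was never eaten by `j`: before phase `K` the preferred good `f` was
    -- still available, and from then on the good was gone.
    refine h.notMem ?_ hx.1
    rw [I.eating_eq]
    refine Finset.sum_eq_zero fun k _ => if_neg fun hfav => ?_
    rcases lt_or_ge k K with hk | hk
    · have h1 := hfav.2 f (I.goods_antitone hk.le hf)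
      have h2 := I.before_antisymm h1 hfx
      rw [h2] at hx
      exact hK K le_rfl f hx.2 hf
    · exact hK k hk x hx.2 hfav.1
  have h1 : ((bundle Y j ∩ G).card : ℝ) ≤ ((bundle Y j ∩ P).card : ℝ) := by
    exact_mod_cast Finset.card_le_card hsub
  refine h1.trans ?_
  have hclock : 0 ≤ I.w j * I.clock K :=
    mul_nonneg (I.w_pos j).le (Finset.sum_nonneg fun k _ => I.dur_nonneg k)
  rcases P.eq_empty_or_nonempty with h0 | h0
  · rw [h0]; simp; linarith
  · obtain ⟨l, hl, hl'⟩ := I.exists_last j h0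
    have hseg : I.initialSegment j l = P := by
      ext x
      rw [I.mem_initialSegment]
      exact ⟨hup l hl x, hl' x⟩
    have h2 := (h.segment j l).2
    rw [hseg] at h2
    have h3 := Int.ceil_lt_add_one (∑ x ∈ P, I.eating j x)
    have h4 := I.sum_eating_le j P hPK
    linarith

/-- The good to transfer is the best one for `i` in the bundle of `j`. On a segment containing it,
`i` has more than her eaten amount minus one and `j` at most hers plus one; the transfer cancels
both errors, and the eaten bounds are proportional to the entitlements. -/
theorem Instance.Respects.wef11 {I : Instance n m} {Y : Allocation n m}
    (h : I.Respects I.eating Y) : I.WEFxy 1 1 Y := by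
  classical
  intro i j
  rcases (bundle Y j).eq_empty_or_nonempty with h0 | h0
  · exact Or.inl h0
  · right
    obtain ⟨t, ht, ht'⟩ := I.exists_first i h0
    refine ⟨t, ht, ?_⟩
    have hv : I.v i t = ∑ g, I.v i g * (if g = t then (1 : ℝ) else 0) := by simp
    rw [I.value_eq_sum, I.value_eq_sum, one_mul, hv, ← Finset.sum_sub_distrib,
      ← Finset.sum_add_distrib, Finset.mul_sum, Finset.mul_sum, ← sub_nonneg,
      ← Finset.sum_sub_distrib]
    have := I.sum_value_nonneg i (fun g =>
      I.w j * ((if g ∈ bundle Y i then 1 else 0) + (if g = t then 1 else 0)) -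
      I.w i * ((if g ∈ bundle Y j then 1 else 0) - (if g = t then 1 else 0))) ?_
    · convert this using 2
      ring
    · intro g
      have hwi := I.w_pos i
      have hwj := I.w_pos j
      have hc : ∀ l : Fin n, ∑ x ∈ I.initialSegment i g, (if x ∈ bundle Y l then (1 : ℝ) else 0) =
          ((bundle Y l ∩ I.initialSegment i g).card : ℝ) := fun l => by
        rw [Finset.sum_boole, Finset.filter_mem_eq_inter, Finset.inter_comm]
      rw [Finset.sum_sub_distrib, ← Finset.mul_sum, ← Finset.mul_sum, Finset.sum_add_distrib,
        Finset.sum_sub_distrib, hc, hc, Finset.sum_ite_eq']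
      by_cases hg : I.Before i t g
      · rw [if_pos (I.mem_initialSegment.2 hg)]
        obtain ⟨K, hKm, h1, h2⟩ := I.exists_finish (I.initialSegment i g)
        have h3 := h.card_le j _ h1
        have h4 := (h.segment i g).1
        rw [I.sum_eating_eq (I.upClosed_initialSegment i g) hKm h1 h2] at h4
        have h5 := Int.lt_floor_add_one (I.w i * I.clock K)
        have h6 : I.w i * I.clock K ≤ ((bundle Y i ∩ I.initialSegment i g).card : ℝ) + 1 := by
          linarith
        have h7 := mul_le_mul_of_nonneg_left h6 hwj.le
        have h8 := mul_le_mul_of_nonneg_left h3 hwi.le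
        linarith
      · rw [if_neg fun h' => hg (I.mem_initialSegment.1 h')]
        -- A segment that misses the best good of `j`'s bundle misses the whole bundle.
        have h1 : bundle Y j ∩ I.initialSegment i g = ∅ := by
          ext x
          simp only [Finset.mem_inter, I.mem_initialSegment, Finset.notMem_empty, iff_false]
          exact fun hx => hg (I.before_trans (ht' x hx.1) hx.2)
        rw [h1]
        have := mul_nonneg hwj.le (Nat.cast_nonneg (α := ℝ) (bundle Y i ∩ I.initialSegment i g).card)
        simpa using this

/-! ### Splitting the consumption of an agent into units -/

/-- How full the `q`-th unit of capacity is when an amount `x` has been consumed. -/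
def unitFill (x : ℝ) (q : ℕ) : ℝ := max 0 (min 1 (x - q))

/-- The case distinction is the one made by `clamp`. -/
theorem unitFill_eq (x : ℝ) (q : ℕ) :
    unitFill x q = if x - q < 0 then 0 else if 1 < x - q then 1 else x - q := by
  unfold unitFill
  split_ifs with h1 h2
  · rw [min_eq_right (by linarith), max_eq_left h1.le]
  · rw [min_eq_left h2.le]; simp
  · rw [min_eq_right (by linarith), max_eq_right (by linarith)]

theorem unitFill_nonneg (x : ℝ) (q : ℕ) : 0 ≤ unitFill x q := le_max_left _ _

theorem unitFill_le_one (x : ℝ) (q : ℕ) : unitFill x q ≤ 1 :=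
  max_le zero_le_one (min_le_left _ _)

theorem unitFill_mono {x y : ℝ} (h : x ≤ y) (q : ℕ) : unitFill x q ≤ unitFill y q := by
  unfold unitFill
  gcongr

theorem sum_unitFill {x : ℝ} (hx : 0 ≤ x) (N : ℕ) :
    ∑ q ∈ Finset.range N, unitFill x q = min x N := by
  induction N with
  | zero => simp [hx]
  | succ N ih =>
    rw [Finset.sum_range_succ, ih, unitFill_eq]
    push_cast
    have hN : (0 : ℝ) ≤ N := Nat.cast_nonneg N
    split_ifs with h1 h2
    · rw [min_eq_left (by linarith), min_eq_left (by linarith)]; ring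
    · rw [min_eq_right (by linarith), min_eq_right (by linarith)]
    · rw [min_eq_right (by linarith), min_eq_left (by linarith)]; ring

open Classical in
/-- What the `q`-th unit of agent `i` contains of the good `g` after `k` phases. -/
noncomputable def Instance.fill (I : Instance n m) (k : ℕ) (i : Fin n) (q : ℕ) (g : Fin m) : ℝ :=
  ∑ j ∈ Finset.range k, if I.IsFavorite (I.phase j).goods i g then
    unitFill (I.w i * I.clock (j + 1)) q - unitFill (I.w i * I.clock j) q else 0

theorem Instance.clock_nonneg (I : Instance n m) (k : ℕ) : 0 ≤ I.clock k :=
  Finset.sum_nonneg fun k _ => I.dur_nonneg k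

theorem Instance.clock_mono (I : Instance n m) : Monotone I.clock :=
  monotone_nat_of_le_succ fun k => by
    rw [I.clock_succ]; linarith [I.dur_nonneg k]

theorem Instance.fill_nonneg (I : Instance n m) (k : ℕ) (i : Fin n) (q : ℕ) (g : Fin m) :
    0 ≤ I.fill k i q g := by
  classical
  refine Finset.sum_nonneg fun j _ => ?_
  split_ifs
  · exact sub_nonneg.2 (unitFill_mono (mul_le_mul_of_nonneg_left (I.clock_mono j.le_succ)
      (I.w_pos i).le) q)
  · exact le_rfl

/-- The content of the units within a set of best goods. -/
theorem Instance.sum_fill (I : Instance n m) {i : Fin n} {G : Finset (Fin m)}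
    (hG : I.UpClosed i G) (q : ℕ) :
    ∑ g ∈ G, I.fill m i q g = unitFill (∑ g ∈ G, I.eating i g) q := by
  classical
  obtain ⟨K, hKm, h1, h2⟩ := I.exists_finish G
  rw [I.sum_eating_eq hG hKm h1 h2]
  simp only [Instance.fill]
  rw [Finset.sum_comm]
  calc _ = ∑ j ∈ Finset.range m, (if j < K then
        unitFill (I.w i * I.clock (j + 1)) q - unitFill (I.w i * I.clock j) q else 0) := by
        refine Finset.sum_congr rfl fun j _ => ?_
        split_ifs with hj
        · obtain ⟨g, hg, hgS⟩ := h2 j hj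
          obtain ⟨f, hf⟩ := I.exists_favorite i ⟨g, hgS⟩
          exact I.sum_favorite_eq _ _ _ _ hf (hG.favorite_mem hg hgS hf)
        · rw [I.sum_favorite_zero _ _ _ _ (h1 j (by omega))]
    _ = ∑ j ∈ Finset.range K,
        (unitFill (I.w i * I.clock (j + 1)) q - unitFill (I.w i * I.clock j) q) := by
        rw [← Finset.sum_filter]
        refine Finset.sum_congr ?_ fun _ _ => rfl
        ext j; simp; omega
    _ = unitFill (I.w i * I.clock K) q := by
        -- While the segment lasts, each increase of the fill level comes from one of its goods, so
        -- the contributions telescope.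
        rw [Finset.sum_range_sub fun j => unitFill (I.w i * I.clock j) q]
        simp [Instance.clock, unitFill]

theorem Instance.eating_le_one (I : Instance n m) (i : Fin n) (g : Fin m) : I.eating i g ≤ 1 := by
  rw [← I.sum_eating g]
  exact Finset.single_le_sum (f := fun i => I.eating i g) (fun j _ => I.eating_nonneg j g)
    (Finset.mem_univ i)

theorem Instance.clock_eq_of_finished (I : Instance n m) {K : ℕ}
    (hK : (I.phase K).goods = ∅) {k : ℕ} (hk : K ≤ k) : I.clock k = I.clock K := by
  unfold Instance.clock
  symm
  refine Finset.sum_subset (fun x hx => by simp at hx ⊢; omega) fun j _ hj => ?_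
  exact I.phaseLength_of_empty _ (Finset.subset_empty.1
    (hK ▸ I.goods_antitone (by simpa using hj)))

theorem Instance.sum_eating_univ (I : Instance n m) (i : Fin n) :
    ∑ g, I.eating i g = I.w i * I.clock m := by
  obtain ⟨K, hKm, h2, h3⟩ := I.exists_finish (Finset.univ : Finset (Fin m))
  rw [I.sum_eating_eq (fun _ _ _ _ => Finset.mem_univ _) hKm h2 h3, I.clock_eq_of_finished
    (Finset.eq_empty_of_forall_notMem fun g => h2 K le_rfl g (Finset.mem_univ g)) hKm]

/-- An agent consumes at most `m`. -/
theorem Instance.w_mul_clock_le (I : Instance n m) (i : Fin n) (k : ℕ) :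
    I.w i * I.clock k ≤ m := by
  have h1 : I.clock k ≤ I.clock m := by
    rcases le_total k m with h | h
    · exact I.clock_mono h
    · exact (I.clock_eq_of_finished I.goods_end h).le
  refine (mul_le_mul_of_nonneg_left h1 (I.w_pos i).le).trans ?_
  rw [← I.sum_eating_univ]
  calc ∑ g, I.eating i g ≤ ∑ g : Fin m, 1 := Finset.sum_le_sum fun g _ => I.eating_le_one i g
    _ = m := by simp

/-- An agent eats at most `m`, so the units cover her whole consumption. The spare unit also keeps
the padded matrix nonempty when there are no goods. -/
theorem Instance.sum_units (I : Instance n m) (i : Fin n) (g : Fin m) :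
    ∑ q ∈ Finset.range (m + 1), I.fill m i q g = I.eating i g := by
  classical
  simp only [Instance.fill, I.eating_eq]
  rw [Finset.sum_comm]
  refine Finset.sum_congr rfl fun j _ => ?_
  split_ifs
  · have h0 : ∀ k, ∑ q ∈ Finset.range (m + 1), unitFill (I.w i * I.clock k) q =
        I.w i * I.clock k := fun k => by
      rw [sum_unitFill (mul_nonneg (I.w_pos i).le (I.clock_nonneg k)), min_eq_left]
      push_cast
      linarith [I.w_mul_clock_le i k]
    rw [Finset.sum_sub_distrib, h0, h0, I.clock_succ]
    ring
  · simp

/-! ### Padding to a doubly stochastic matrix -/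

/-- An `R × m` matrix `F` with column sums `1` and row sums at most `1`, bordered by the transpose
of `F` and the missing parts of the row sums. -/
noncomputable def padded (R m : ℕ) (F : ℕ → ℕ → ℝ) (r c : ℕ) : ℝ :=
  if r < R then
    if c < m then F r c else if c = m + r then 1 - ∑ g ∈ Finset.range m, F r g else 0
  else if c < m then 0 else F (c - m) (r - R)

theorem padded_left {R m : ℕ} {F : ℕ → ℕ → ℝ} {r c : ℕ} (hr : r < R) (hc : c < m) :
    padded R m F r c = F r c := by
  simp [padded, hr, hc]

/-- The blocks are `F` and the diagonal of the row defects on top, zero and the transpose of `F`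
below. A right-hand column adds a defect to the corresponding row sum of `F`, and a lower row is a
column of `F`, of sum 1. -/
theorem doublyStochastic_padded {R m : ℕ} {F : ℕ → ℕ → ℝ}
    (h0 : ∀ r < R, ∀ g < m, 0 ≤ F r g) (hrow : ∀ r < R, ∑ g ∈ Finset.range m, F r g ≤ 1)
    (hcol : ∀ g < m, ∑ r ∈ Finset.range R, F r g = 1) :
    DoublyStochastic (R + m) (padded R m F) 1 := by
  refine ⟨fun r hr c hc => ?_, fun r hr => ?_, fun c hc => ?_⟩
  · unfold padded
    split_ifs with h1 h2 h3 h4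
    · exact h0 r h1 c h2
    · linarith [hrow r h1]
    · exact le_rfl
    · exact le_rfl
    · exact h0 _ (by omega) _ (by omega)
  · rw [Nat.add_comm R m, Finset.sum_range_add]
    by_cases h1 : r < R
    · have h2 : ∀ c ∈ Finset.range m, padded R m F r c = F r c := fun c hc =>
        padded_left h1 (Finset.mem_range.1 hc)
      have h3 : ∀ r' ∈ Finset.range R, padded R m F r (m + r') =
          if r' = r then 1 - ∑ g ∈ Finset.range m, F r g else 0 := fun r' _ => by
        simp [padded, h1]
      rw [Finset.sum_congr rfl h2, Finset.sum_congr rfl h3, Finset.sum_ite_eq',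
        if_pos (Finset.mem_range.2 h1)]
      ring
    · have h2 : ∀ c ∈ Finset.range m, padded R m F r c = 0 := fun c hc => by
        simp [padded, h1, Finset.mem_range.1 hc]
      have h3 : ∀ r' ∈ Finset.range R, padded R m F r (m + r') = F r' (r - R) := fun r' _ => by
        simp [padded, h1]
      rw [Finset.sum_congr rfl h2, Finset.sum_congr rfl h3, Finset.sum_const_zero, zero_add,
        hcol _ (by omega)]
  · rw [Finset.sum_range_add]
    by_cases h1 : c < m
    · have h2 : ∀ r ∈ Finset.range R, padded R m F r c = F r c := fun r hr =>
        padded_left (Finset.mem_range.1 hr) h1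
      have h3 : ∀ g ∈ Finset.range m, padded R m F (R + g) c = 0 := fun g _ => by
        simp [padded, h1]
      rw [Finset.sum_congr rfl h2, Finset.sum_congr rfl h3, Finset.sum_const_zero, add_zero,
        hcol _ h1]
    · have h2 : ∀ r ∈ Finset.range R, padded R m F r c =
          if r = c - m then 1 - ∑ g ∈ Finset.range m, F (c - m) g else 0 := fun r hr => by
        have : c = m + r ↔ r = c - m := by omega
        simp only [padded, Finset.mem_range.1 hr, h1, if_true, if_false, this]
        split_ifs with h
        · rw [h]
        · rfl
      have h3 : ∀ g ∈ Finset.range m, padded R m F (R + g) c = F (c - m) g := fun g _ => by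
        simp [padded, h1]
      rw [Finset.sum_congr rfl h2, Finset.sum_congr rfl h3, Finset.sum_ite_eq',
        if_pos (Finset.mem_range.2 (by omega))]
      ring

theorem sum_range_mul' (f : ℕ → ℝ) (n M : ℕ) :
    ∑ r ∈ Finset.range (n * M), f r = ∑ i : Fin n, ∑ q ∈ Finset.range M, f (i * M + q) := by
  rw [← Finset.sum_range fun i => ∑ q ∈ Finset.range M, f (i * M + q)]
  induction n with
  | zero => simp
  | succ n ih => rw [Nat.succ_mul, Finset.sum_range_add, ih, Finset.sum_range_succ]

theorem unit_lt {i M q : ℕ} (hi : i < n) (hq : q < M) : i * M + q < n * M := by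
  have : (i + 1) * M ≤ n * M := Nat.mul_le_mul_right M hi
  rw [Nat.succ_mul] at this
  omega

theorem exists_unit {r M : ℕ} (hr : r < n * M) : ∃ i : Fin n, ∃ q < M, r = i * M + q := by
  have hM : 0 < M := by
    rcases Nat.eq_zero_or_pos M with rfl | h
    · simp at hr
    · exact h
  refine ⟨⟨r / M, (Nat.div_lt_iff_lt_mul hM).2 hr⟩, r % M, Nat.mod_lt _ hM, ?_⟩
  exact (Nat.div_add_mod' r M).symm

theorem unit_div {i M q : ℕ} (hq : q < M) : (i * M + q) / M = i := by
  rw [Nat.add_comm, Nat.add_mul_div_right _ _ (by omega), Nat.div_eq_of_lt hq, Nat.zero_add]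

/-- The rows of `F` are the contents of the units of the agents. -/
def Instance.IsUnitMatrix (I : Instance n m) (F : ℕ → ℕ → ℝ) : Prop :=
  ∀ (i : Fin n), ∀ q < m + 1, ∀ g : Fin m, F (i * (m + 1) + q) g = I.fill m i q g

theorem Instance.IsUnitMatrix.row_sum {I : Instance n m} {F : ℕ → ℕ → ℝ} (hF : I.IsUnitMatrix F)
    (i : Fin n) {q : ℕ} (hq : q < m + 1) :
    ∑ g ∈ Finset.range m, F (i * (m + 1) + q) g = unitFill (I.w i * I.clock m) q := by
  rw [Finset.sum_range, ← I.sum_eating_univ, ← I.sum_fill (i := i) (G := Finset.univ) fun _ _ _ _ => Finset.mem_univ _]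
  exact Finset.sum_congr rfl fun g _ => hF i q hq g

/-- Row sums are fill levels, hence at most 1; column sums are 1 because every good is eaten
completely. -/
theorem Instance.IsUnitMatrix.doublyStochastic {I : Instance n m} {F : ℕ → ℕ → ℝ}
    (hF : I.IsUnitMatrix F) :
    DoublyStochastic (n * (m + 1) + m) (padded (n * (m + 1)) m F) 1 := by
  refine doublyStochastic_padded (fun r hr g hg => ?_) (fun r hr => ?_) fun g hg => ?_
  · obtain ⟨i, q, hq, rfl⟩ := exists_unit hr
    rw [hF i q hq ⟨g, hg⟩]
    exact I.fill_nonneg _ _ _ _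
  · obtain ⟨i, q, hq, rfl⟩ := exists_unit hr
    rw [hF.row_sum i hq]
    exact unitFill_le_one _ _
  · rw [sum_range_mul', ← I.sum_eating ⟨g, hg⟩]
    refine Finset.sum_congr rfl fun i _ => ?_
    rw [← I.sum_units]
    exact Finset.sum_congr rfl fun q hq => hF i q (Finset.mem_range.1 hq) ⟨g, hg⟩

/-- Through this lemma and the next one, an extreme average forces the same value in every
allocation of the lottery; it is the source of the quotas. -/
theorem eq_zero_of_average {size : ℕ} {wt z : ℕ → ℝ} (hwt : ∀ k < size, 0 < wt k)
    (hz : ∀ k < size, 0 ≤ z k) (h : ∑ k ∈ Finset.range size, wt k * z k = 0) {k : ℕ}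
    (hk : k < size) : z k = 0 := by
  have := (Finset.sum_eq_zero_iff_of_nonneg fun k hk =>
    mul_nonneg (hwt k (Finset.mem_range.1 hk)).le (hz k (Finset.mem_range.1 hk))).1 h k
      (Finset.mem_range.2 hk)
  exact (mul_eq_zero.1 this).resolve_left (hwt k hk).ne'

theorem eq_one_of_average {size : ℕ} {wt z : ℕ → ℝ} (hwt : ∀ k < size, 0 < wt k)
    (hsum : ∑ k ∈ Finset.range size, wt k = 1)
    (hz : ∀ k < size, z k ≤ 1) (h : ∑ k ∈ Finset.range size, wt k * z k = 1) {k : ℕ}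
    (hk : k < size) : z k = 1 := by
  have := eq_zero_of_average (z := fun k => 1 - z k) hwt (fun k hk => sub_nonneg.2 (hz k hk)) (by
    simp only [mul_sub, mul_one, Finset.sum_sub_distrib, h, hsum, sub_self]) hk
  linarith

/-- The integral allocation that assigns the goods to the owners of the units. -/
def unitAllocation (R : ℕ → ℕ) (h : ∀ g < m, R g < n * (m + 1)) : Allocation n m := fun g =>
  ⟨R g / (m + 1), (Nat.div_lt_iff_lt_mul (Nat.succ_pos m)).2 (h g g.2)⟩

theorem unitAllocation_matrix {R : ℕ → ℕ} (h : ∀ g < m, R g < n * (m + 1)) (i : Fin n)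
    (g : Fin m) : (unitAllocation R h).matrix i g =
      ∑ q ∈ Finset.range (m + 1), if R g = i * (m + 1) + q then (1 : ℝ) else 0 := by
  obtain ⟨i', q', hq', hR⟩ := exists_unit (h g g.2)
  have h1 : (unitAllocation R h) g = i' := by
    apply Fin.ext
    change R g / (m + 1) = i'
    rw [hR, unit_div hq']
  simp only [Allocation.matrix, h1]
  by_cases hi : i' = i
  · subst hi
    rw [if_pos rfl, hR, Finset.sum_eq_single_of_mem q' (Finset.mem_range.2 hq'), if_pos rfl]
    intro q _ hq
    rw [if_neg]
    omega
  · rw [if_neg hi]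
    symm
    refine Finset.sum_eq_zero fun q hq => if_neg fun h2 => hi ?_
    have h3 := unit_div (i := (i : ℕ)) (Finset.mem_range.1 hq)
    rw [← h2, hR, unit_div hq'] at h3
    exact Fin.ext h3

/-! ### From permutation matrices to a lottery respecting the quotas -/

section Decomposition

variable {I : Instance n m} {F Z : ℕ → ℕ → ℝ} {size : ℕ} {wt : ℕ → ℝ} {ρ : ℕ → ℕ → ℕ}

/-- With row sums 0 and nonnegative entries, nothing remains of the matrix. -/
theorem DecompInv.entry {K : ℕ} {Z₀ : ℕ → ℕ → ℝ} (h : DecompInv K Z₀ Z 0 size wt ρ) {r c : ℕ}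
    (hr : r < K) (hc : c < K) :
    ∑ k ∈ Finset.range size, wt k * (if ρ k c = r then 1 else 0) = Z₀ r c := by
  have h1 : Z r c = 0 := le_antisymm (h.ds.le hr hc) (h.ds.nonneg r hr c hc)
  rw [h.eq r hr c hc, h1, zero_add]

/-- The lower left block of the padded matrix is zero, so no permutation of positive weight sends a
good to a padding row. -/
theorem DecompInv.lt_units
    (h : DecompInv (n * (m + 1) + m) (padded (n * (m + 1)) m F) Z 0 size wt ρ) {k : ℕ}
    (hk : k < size) {g : ℕ} (hg : g < m) : ρ k g < n * (m + 1) := by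
  by_contra hcon
  have h1 := h.lt k hk g (by omega)
  have h2 := h.entry h1 (show g < n * (m + 1) + m by omega)
  rw [padded, if_neg hcon, if_pos hg] at h2
  have := eq_zero_of_average (z := fun k' => if ρ k' g = ρ k g then 1 else 0) h.pos
    (fun k' _ => by positivity) h2 hk
  simp at this

theorem DecompInv.mean (hF : I.IsUnitMatrix F)
    (h : DecompInv (n * (m + 1) + m) (padded (n * (m + 1)) m F) Z 0 size wt ρ) (i : Fin n)
    (g : Fin m) : ∑ k : Fin size, wt k *
      (unitAllocation (ρ k) fun _ hg => h.lt_units k.2 hg).matrix i g = I.eating i g := by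
  simp only [unitAllocation_matrix]
  rw [← Finset.sum_range fun k => wt k *
    ∑ q ∈ Finset.range (m + 1), if ρ k g = i * (m + 1) + q then (1 : ℝ) else 0]
  simp only [Finset.mul_sum]
  rw [Finset.sum_comm, ← I.sum_units]
  refine Finset.sum_congr rfl fun q hq => ?_
  have h1 := unit_lt i.2 (Finset.mem_range.1 hq)
  rw [h.entry (by omega) (by omega), padded_left h1 g.2, hF i q (Finset.mem_range.1 hq)]

/-- Only the segments need the units: the units below the floor of the eaten amount are full, those
from the ceiling on are untouched, and at most one unit in between is undecided. Columns are
trivial, and singletons follow from the mean. -/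
theorem DecompInv.respects (hF : I.IsUnitMatrix F)
    (h : DecompInv (n * (m + 1) + m) (padded (n * (m + 1)) m F) Z 0 size wt ρ) (k : Fin size) :
    I.Respects I.eating (unitAllocation (ρ k) fun _ hg => h.lt_units k.2 hg) := by
  classical
  have hsum : ∑ k ∈ Finset.range size, wt k = 1 := by rw [h.sum, sub_zero]
  rintro A (⟨g, rfl⟩ | ⟨i, g, rfl⟩ | ⟨i, g, rfl⟩)
  · have h1 : ∀ X : Fin n → Fin m → ℝ,
        ∑ e ∈ (Finset.univ : Finset (Fin n)) ×ˢ ({g} : Finset (Fin m)), X e.1 e.2 =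
          ∑ i, X i g := fun X => by simp
    rw [h1 I.eating, I.sum_eating, h1]
    simp [Allocation.matrix]
  · rw [sum_row, sum_row fun i g => Allocation.matrix _ i g]
    set G := I.initialSegment i g with hG
    set s := ∑ h ∈ G, I.eating i h with hs
    have hs0 : 0 ≤ s := Finset.sum_nonneg fun h _ => I.eating_nonneg i h
    have hsm : s ≤ m := by
      calc s ≤ ∑ h ∈ G, (1 : ℝ) := Finset.sum_le_sum fun g _ => I.eating_le_one i g
        _ = G.card := by simp
        _ ≤ m := by exact_mod_cast (Finset.card_le_univ G).trans (by simp)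
    -- The number of goods of `G` matched to unit `q` in the `k`-th permutation; it is at most 1 by
    -- injectivity, and its average is the fill level.
    let z : ℕ → ℕ → ℝ := fun q k => ∑ h ∈ G, if ρ k h = i * (m + 1) + q then (1 : ℝ) else 0
    have hz0 : ∀ q k, 0 ≤ z q k := fun q k => Finset.sum_nonneg fun h _ => by positivity
    have hz1 : ∀ q, ∀ k < size, z q k ≤ 1 := by
      intro q k hk
      simp only [z, Finset.sum_boole]
      have : (G.filter fun h : Fin m => ρ k h = i * (m + 1) + q).card ≤ 1 := by
        rw [Finset.card_le_one]
        intro a ha b hb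
        simp only [Finset.mem_filter] at ha hb
        exact Fin.ext (h.inj k hk a (by omega) b (by omega) (ha.2.trans hb.2.symm))
      exact_mod_cast this
    have hzs : ∀ q < m + 1, ∑ k ∈ Finset.range size, wt k * z q k = unitFill s q := by
      intro q hq
      simp only [z, Finset.mul_sum]
      rw [Finset.sum_comm, hs, ← I.sum_fill (I.upClosed_initialSegment i g)]
      refine Finset.sum_congr rfl fun a _ => ?_
      have h1 := unit_lt i.2 hq
      rw [h.entry (by omega) (by omega), padded_left h1 a.2, hF i q hq]
    have hy : ∑ a ∈ G, (unitAllocation (ρ k) fun _ hg => h.lt_units k.2 hg).matrix i a =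
        ∑ q ∈ Finset.range (m + 1), z q k := by
      simp only [unitAllocation_matrix, z]
      exact Finset.sum_comm
    rw [hy]
    constructor
    · have h1 : ∀ q ∈ Finset.range (m + 1), (if (q : ℝ) + 1 ≤ s then (1 : ℝ) else 0) ≤ z q k := by
        intro q hq
        split_ifs with hqs
        · refine (eq_one_of_average h.pos hsum (hz1 q) ?_ k.2).ge
          rw [hzs q (Finset.mem_range.1 hq), unitFill, min_eq_left (by linarith)]
          simp
        · exact hz0 q k
      refine le_trans (le_of_eq ?_) (Finset.sum_le_sum h1)
      rw [Finset.sum_boole]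
      have : ((Finset.range (m + 1)).filter fun q : ℕ => (q : ℝ) + 1 ≤ s) =
          Finset.range ⌊s⌋₊ := by
        ext q
        have h2 : (q : ℝ) + 1 ≤ s ↔ q + 1 ≤ ⌊s⌋₊ := by
          rw [Nat.le_floor_iff hs0]; push_cast; rfl
        have h3 : ⌊s⌋₊ ≤ m := Nat.floor_le_of_le hsm
        simp only [Finset.mem_filter, Finset.mem_range, h2]
        omega
      rw [this, Finset.card_range, natCast_floor_eq_intCast_floor hs0]
    · have h1 : ∀ q ∈ Finset.range (m + 1), z q k ≤ (if (q : ℝ) < s then (1 : ℝ) else 0) := by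
        intro q hq
        split_ifs with hqs
        · exact hz1 q k k.2
        · refine (eq_zero_of_average h.pos (fun k _ => hz0 q k) ?_ k.2).le
          rw [hzs q (Finset.mem_range.1 hq), unitFill, min_eq_right (by linarith),
            max_eq_left (by linarith)]
      refine le_trans (Finset.sum_le_sum h1) (le_of_eq ?_)
      rw [Finset.sum_boole]
      have : ((Finset.range (m + 1)).filter fun q : ℕ => (q : ℝ) < s) =
          Finset.range ⌈s⌉₊ := by
        ext q
        have h2 : (q : ℝ) < s ↔ q < ⌈s⌉₊ := Nat.lt_ceil.symm
        have h3 : ⌈s⌉₊ ≤ m := Nat.ceil_le.2 hsm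
        simp only [Finset.mem_filter, Finset.mem_range, h2]
        omega
      rw [this, Finset.card_range, natCast_ceil_eq_intCast_ceil hs0]
  · simp only [Finset.sum_singleton]
    have h0 : ∀ k : Fin size, 0 ≤
        (unitAllocation (ρ k) fun _ hg => h.lt_units k.2 hg).matrix i g := fun k => by
      unfold Allocation.matrix; positivity
    have h1 : ∀ k : Fin size,
        (unitAllocation (ρ k) fun _ hg => h.lt_units k.2 hg).matrix i g ≤ 1 := fun k => by
      unfold Allocation.matrix; split_ifs <;> norm_num
    have h2 := h.mean hF i g
    have h3 : wt k * (unitAllocation (ρ k) fun _ hg => h.lt_units k.2 hg).matrix i g ≤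
        I.eating i g := by
      rw [← h2]
      exact Finset.single_le_sum (f := fun k : Fin size => wt k *
        (unitAllocation (ρ k) fun _ hg => h.lt_units k.2 hg).matrix i g)
        (fun k _ => mul_nonneg (h.pos k k.2).le (h0 k)) (Finset.mem_univ k)
    -- The same estimate for the complementary event: a good withheld with positive probability is
    -- not eaten entirely by `i`.
    have h4 : wt k * (1 - (unitAllocation (ρ k) fun _ hg => h.lt_units k.2 hg).matrix i g) ≤
        1 - I.eating i g := by
      have h5 : 1 - I.eating i g = ∑ k : Fin size, (wt k - wt k *
          (unitAllocation (ρ k) fun _ hg => h.lt_units k.2 hg).matrix i g) := by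
        rw [Finset.sum_sub_distrib, h2, ← Finset.sum_range, hsum]
      rw [h5]
      refine le_trans ?_ (Finset.single_le_sum (f := fun k : Fin size => wt k - wt k *
        (unitAllocation (ρ k) fun _ hg => h.lt_units k.2 hg).matrix i g)
        (fun k _ => ?_) (Finset.mem_univ k))
      · exact le_of_eq (by ring)
      · have := mul_le_mul_of_nonneg_left (h1 k) (h.pos k k.2).le
        linarith
    have hk := h.pos k k.2
    have hm : (unitAllocation (ρ k) fun _ hg => h.lt_units k.2 hg).matrix i g = 0 ∨
        (unitAllocation (ρ k) fun _ hg => h.lt_units k.2 hg).matrix i g = 1 := by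
      unfold Allocation.matrix; split_ifs <;> simp
    rcases hm with hm | hm
    · rw [hm] at h4 ⊢
      constructor
      · have : ⌊I.eating i g⌋ ≤ 0 := Int.floor_le_iff.2 (by push_cast; linarith)
        exact_mod_cast this
      · exact_mod_cast Int.ceil_nonneg (I.eating_nonneg i g)
    · rw [hm] at h3 ⊢
      constructor
      · have : ⌊I.eating i g⌋ ≤ 1 := Int.floor_le_iff.2 (by
          push_cast; linarith [I.eating_le_one i g])
        exact_mod_cast this
      · have : 1 ≤ ⌈I.eating i g⌉ := Int.one_le_ceil_iff.2 (by linarith)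
        exact_mod_cast this

/-- The lottery described by a complete decomposition. -/
theorem DecompInv.exists_lottery (hF : I.IsUnitMatrix F)
    (h : DecompInv (n * (m + 1) + m) (padded (n * (m + 1)) m F) Z 0 size wt ρ) {M : Memory}
    (hM : M.idx 1 0 0 = size)
    (hM' : ∀ k < size, M.num 2 k 0 = wt k ∧ ∀ g < m, M.idx 2 k g = ρ k g / (m + 1)) :
    ∃ L : Lottery n m, L.StoredIn M ∧ I.IsUGDecomposition I.eating L ∧
      I.WSDEF L.mean ∧ I.WEF L.mean ∧ ∀ k, I.WPROP1 (L.alloc k) ∧ I.WEFxy 1 1 (L.alloc k) := by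
  let L : Lottery n m :=
    { size := size
      weight := fun k => wt k
      alloc := fun k => unitAllocation (ρ k) fun _ hg => h.lt_units k.2 hg
      weight_pos := fun k => h.pos k k.2
      weight_sum := by rw [← Finset.sum_range, h.sum, sub_zero] }
  have hmean : L.mean = I.eating := by
    funext i g
    exact h.mean hF i g
  have hres : ∀ k, I.Respects I.eating (L.alloc k) := fun k => h.respects hF k
  refine ⟨L, ⟨hM, fun k => ⟨(hM' k k.2).1, fun g => (hM' k k.2).2 g g.2⟩⟩, ⟨hmean, hres⟩, ?_, ?_,
    fun k => ⟨(hres k).wprop1, (hres k).wef11⟩⟩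
  · rw [hmean]; exact I.eating_wsdef
  · rw [hmean]; exact I.eating_wsdef.wef

end Decomposition

/-! ### Encoding lengths -/

/-- Reduction to lowest terms can only shrink numerator and denominator. -/
theorem ratBits_div_le {a : ℤ} {d E : ℕ} (hd : 0 < d) (ha : a.natAbs < 2 ^ E) (hd' : d < 2 ^ E) :
    ratBits ((a : ℚ) / d) ≤ 2 * E := by
  have hdz : (d : ℤ) ≠ 0 := by exact_mod_cast hd.ne'
  have he : ((a : ℚ) / d) = Rat.divInt a d := by rw [Rat.divInt_eq_div]; simp
  have h1 : ((a : ℚ) / d).num.natAbs < 2 ^ E := by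
    rcases eq_or_ne a 0 with rfl | h0
    · simp
    · refine lt_of_le_of_lt (Nat.le_of_dvd (Int.natAbs_pos.2 h0) ?_) ha
      rw [he]
      exact Int.natAbs_dvd_natAbs.2 (Rat.num_dvd a hdz)
  have h2 : ((a : ℚ) / d).den < 2 ^ E := by
    refine lt_of_le_of_lt (Nat.le_of_dvd hd ?_) hd'
    rw [he]
    exact_mod_cast Rat.den_dvd a d
  have := Nat.size_le.2 h1
  have := Nat.size_le.2 h2
  unfold ratBits
  omega

/-- The multiples of `1 / D`. -/
def grid (D : ℕ) : AddSubgroup ℝ where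
  carrier := {x | ∃ a : ℤ, x * D = a}
  zero_mem' := ⟨0, by simp⟩
  add_mem' := by
    rintro x y ⟨a, ha⟩ ⟨b, hb⟩
    exact ⟨a + b, by push_cast; rw [add_mul, ha, hb]⟩
  neg_mem' := by
    rintro x ⟨a, ha⟩
    exact ⟨-a, by push_cast; rw [neg_mul, ha]⟩

theorem mem_grid {D : ℕ} {x : ℝ} : x ∈ grid D ↔ ∃ a : ℤ, x * D = a := Iff.rfl

theorem one_mem_grid (D : ℕ) : (1 : ℝ) ∈ grid D := ⟨D, by simp⟩

theorem grid_mul_right (D D' : ℕ) : grid D ≤ grid (D * D') := by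
  rintro x ⟨a, ha⟩
  exact ⟨a * D', by push_cast; rw [← mul_assoc, ha]⟩

theorem exists_rat_of_mul_eq {x : ℝ} {a : ℤ} {d E : ℕ} (h : x * d = a) (hd : 0 < d)
    (ha : a.natAbs < 2 ^ E) (hd' : d < 2 ^ E) : ∃ r : ℚ, (r : ℝ) = x ∧ ratBits r ≤ 2 * E := by
  refine ⟨(a : ℚ) / d, ?_, ratBits_div_le hd ha hd'⟩
  have : (d : ℝ) ≠ 0 := by exact_mod_cast hd.ne'
  push_cast
  rw [← h]
  field_simp

theorem natAbs_le_of_mul_eq {x : ℝ} {a : ℤ} {d c : ℕ} (h : x * d = a) (hx : |x| ≤ c) :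
    a.natAbs ≤ c * d := by
  have h1 : |(a : ℝ)| ≤ c * d := by
    rw [← h, abs_mul, Nat.abs_cast]
    exact mul_le_mul_of_nonneg_right hx (Nat.cast_nonneg d)
  rw [← Int.cast_abs, Int.abs_eq_natAbs] at h1
  exact_mod_cast h1

theorem Instance.speed_le_one (I : Instance n m) (S : Finset (Fin m)) (g : Fin m) :
    I.speed S g ≤ 1 := by
  rw [← I.w_sum]
  exact Finset.sum_le_sum_of_subset_of_nonneg (Finset.subset_univ _) fun i _ _ => (I.w_pos i).le

theorem Instance.speed_mem (I : Instance n m) {H : AddSubgroup ℝ} (hw : ∀ i, I.w i ∈ H)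
    (S : Finset (Fin m)) (g : Fin m) : I.speed S g ∈ H :=
  H.sum_mem fun i _ => hw i

theorem Instance.dur_mul_speed_mem (I : Instance n m) {H : AddSubgroup ℝ} {k : ℕ}
    (hw : ∀ i, I.dur k * I.w i ∈ H) (S : Finset (Fin m)) (g : Fin m) :
    I.dur k * I.speed S g ∈ H := by
  rw [Instance.speed, Finset.mul_sum]
  exact H.sum_mem fun i _ => hw i

/-- A duration is a quotient of a supply `a / D` and a speed `s / W`. Multiplied by an entitlement
`u / W` it becomes `a * u / (D * s)`: the denominator `W` cancels, and the factor `s` is at most `W`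
because speeds are at most 1. Durations themselves need not lie on the grid, so only such products
are tracked. -/
theorem Instance.exists_grid (I : Instance n m) {W : ℕ} (hW : 0 < W) (hw : ∀ i, I.w i ∈ grid W)
    (k : ℕ) : ∃ D, 0 < D ∧ D ≤ W ^ k ∧ (∀ j ≤ k, ∀ g, (I.phase j).supply g ∈ grid D) ∧
      ∀ j < k, ∀ i, I.dur j * I.w i ∈ grid D := by
  induction k with
  | zero =>
    refine ⟨1, one_pos, by simp, fun j hj g => ?_, fun j hj => by omega⟩
    obtain rfl : j = 0 := by omega
    exact one_mem_grid 1
  | succ k ih =>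
    obtain ⟨D, hD, hDW, h1, h2⟩ := ih
    have key : ∃ D', 0 < D' ∧ D' ≤ W ∧ ∀ i, I.dur k * I.w i ∈ grid (D * D') := by
      rcases (I.phase k).goods.eq_empty_or_nonempty with h0 | h0
      · refine ⟨1, one_pos, hW, fun i => ?_⟩
        rw [Instance.dur, I.phaseLength_of_empty _ h0, zero_mul]
        exact zero_mem _
      · obtain ⟨⟨f, hf, hf', hd⟩, _, _⟩ := I.phaseLength_spec _ h0
        obtain ⟨s, hs⟩ := mem_grid.1 (I.speed_mem hw (I.phase k).goods f)
        have hspos := lt_of_le_of_ne (I.speed_nonneg (I.phase k).goods f) (Ne.symm hf')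
        have hW' : (0 : ℝ) < W := by exact_mod_cast hW
        have hs0 : 0 < s := by
          have : (0 : ℝ) < s := by rw [← hs]; positivity
          exact_mod_cast this
        have hsW : s ≤ W := by
          have : (s : ℝ) ≤ W := by
            rw [← hs]
            exact mul_le_of_le_one_left hW'.le (I.speed_le_one _ _)
          exact_mod_cast this
        refine ⟨s.toNat, by omega, by omega, fun i => ?_⟩
        obtain ⟨a, ha⟩ := mem_grid.1 (h1 k le_rfl f)
        obtain ⟨u, hu⟩ := mem_grid.1 (hw i)
        refine ⟨a * u, ?_⟩
        have hst : ((s.toNat : ℕ) : ℝ) = s := by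
          exact_mod_cast congrArg (fun z : ℤ => (z : ℝ)) (Int.toNat_of_nonneg hs0.le)
        rw [Instance.dur, hd]
        push_cast
        rw [hst, ← hs, ← ha, ← hu]
        field_simp
    obtain ⟨D', hD', hDW', h3⟩ := key
    refine ⟨D * D', by positivity, ?_, ?_, ?_⟩
    · rw [pow_succ]; exact Nat.mul_le_mul hDW hDW'
    · intro j hj g
      rcases Nat.lt_or_ge k j with h | h
      · obtain rfl : j = k + 1 := by omega
        rw [I.supply_succ]
        exact sub_mem (grid_mul_right D D' (h1 k le_rfl g)) (I.dur_mul_speed_mem h3 _ _)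
      · exact grid_mul_right D D' (h1 j h g)
    · intro j hj i
      rcases Nat.lt_succ_iff_lt_or_eq.1 hj with h | rfl
      · exact grid_mul_right D D' (h2 j h i)
      · exact h3 i

/-- `H` contains the numbers that arise by addition and subtraction, and the condition `ok` holds
for the small elements of `H` and for the quotients of supplies and speeds. -/
structure Instance.NumContext (I : Instance n m) (ok : ℝ → Prop) (H : AddSubgroup ℝ) : Prop where
  one_mem : (1 : ℝ) ∈ H
  w_mem : ∀ i, I.w i ∈ H
  supply_mem : ∀ k ≤ m, ∀ g, (I.phase k).supply g ∈ H
  dur_mem : ∀ k < m, ∀ i, I.dur k * I.w i ∈ H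
  ok_of_mem : ∀ x ∈ H, |x| ≤ m + 2 → ok x
  ok_quot : ∀ k < m, ∀ g, I.speed (I.phase k).goods g ≠ 0 →
    ok ((I.phase k).supply g / I.speed (I.phase k).goods g)

/-- The condition on stored numbers quantifies over all encoding lengths; uniqueness allows working
with one. -/
theorem HasEncodingLength.unique {I : Instance n m} {b b' : ℕ} (h : I.HasEncodingLength b)
    (h' : I.HasEncodingLength b') : b = b' := by
  obtain ⟨v, w, hv, hw, rfl⟩ := h
  obtain ⟨v', w', hv', hw', rfl⟩ := h'
  have h1 : v = v' := by
    funext i g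
    exact Rat.cast_injective (α := ℝ) ((hv i g).trans (hv' i g).symm)
  have h2 : w = w' := by
    funext i
    exact Rat.cast_injective (α := ℝ) ((hw i).trans (hw' i).symm)
  rw [h1, h2]

/-- The polynomial bounding the encoding lengths. -/
noncomputable def bitBound : Polynomial ℕ := 2 * (Polynomial.X ^ 2 + 2 * Polynomial.X + 2)

theorem bitBound_eval (b : ℕ) : bitBound.eval b = 2 * (b ^ 2 + 2 * b + 2) := by
  simp [bitBound]

/-- With `W` the product of the denominators of the entitlements, `W` is at most `2 ^ b` and there
are at most `b` phases, so every denominator is at most `2 ^ (b * (b + 1))`. Bounded grid elements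
then have numerators of similar size. -/
theorem Instance.exists_numContext (I : Instance n m) : ∃ H, I.NumContext
    (fun x => ∀ b, I.HasEncodingLength b → ∃ r : ℚ, (r : ℝ) = x ∧ ratBits r ≤ bitBound.eval b)
    H := by
  by_cases hex : ∃ b, I.HasEncodingLength b
  swap
  · push Not at hex
    -- Data that are not all rational have no encoding length, so nothing is required of the stored
    -- numbers.
    exact ⟨⊤, ⟨trivial, fun _ => trivial, fun _ _ _ => trivial, fun _ _ _ => trivial,
      fun x _ _ b hb => absurd hb (hex b), fun k _ g _ b hb => absurd hb (hex b)⟩⟩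
  obtain ⟨b, hb⟩ := hex
  have hb' := hb
  obtain ⟨v', w', _, hw', hbe⟩ := hb'
  have hmb : m ≤ b := by omega
  set W := ∏ i, (w' i).den with hWdef
  have hW : 0 < W := Finset.prod_pos fun i _ => (w' i).pos
  have hWb : W ≤ 2 ^ b := by
    calc W ≤ ∏ i, 2 ^ ratBits (w' i) := by
          refine Finset.prod_le_prod' fun i _ => ?_
          refine (Nat.lt_size_self _).le.trans (Nat.pow_le_pow_right (by norm_num) ?_)
          unfold ratBits
          omega
      _ = 2 ^ ∑ i, ratBits (w' i) := Finset.prod_pow_eq_pow_sum _ _ _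
      _ ≤ 2 ^ b := Nat.pow_le_pow_right (by norm_num) (by omega)
  have hw : ∀ i, I.w i ∈ grid W := by
    intro i
    refine ⟨(w' i).num * ∏ j ∈ Finset.univ.erase i, ((w' j).den : ℤ), ?_⟩
    rw [hWdef, ← Finset.mul_prod_erase _ _ (Finset.mem_univ i), ← hw' i]
    push_cast
    rw [← mul_assoc]
    congr 1
    exact_mod_cast Rat.mul_den_eq_num (w' i)
  obtain ⟨D, hD, hDW, h1, h2⟩ := I.exists_grid hW hw m
  have hpow : ∀ k ≤ m, W ^ k * W ≤ 2 ^ (b * (b + 1)) := by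
    intro k hk
    rw [← pow_succ, pow_mul]
    exact (Nat.pow_le_pow_left hWb _).trans
      (Nat.pow_le_pow_right (Nat.pos_of_ne_zero (by positivity)) (by omega))
  have hlt : 2 ^ (b * (b + 1)) < 2 ^ (b ^ 2 + 2 * b + 2) :=
    Nat.pow_lt_pow_right (by norm_num) (by nlinarith)
  have hlt' : (m + 2) * 2 ^ (b * (b + 1)) < 2 ^ (b ^ 2 + 2 * b + 2) := by
    have h3 : m + 2 ≤ 2 ^ (b + 1) := by
      have := Nat.lt_two_pow_self (n := b + 1)
      omega
    calc (m + 2) * 2 ^ (b * (b + 1)) ≤ 2 ^ (b + 1) * 2 ^ (b * (b + 1)) :=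
          Nat.mul_le_mul_right _ h3
      _ = 2 ^ (b + 1 + b * (b + 1)) := (pow_add _ _ _).symm
      _ < 2 ^ (b ^ 2 + 2 * b + 2) := Nat.pow_lt_pow_right (by norm_num) (by nlinarith)
  refine ⟨grid (D * W), ⟨one_mem_grid _, fun i => ?_, fun k hk g => grid_mul_right _ _ (h1 k hk g),
    fun k hk i => grid_mul_right _ _ (h2 k hk i), ?_, ?_⟩⟩
  · rw [mul_comm]; exact grid_mul_right _ _ (hw i)
  · rintro x ⟨a, ha⟩ hx b' hb'
    rw [← HasEncodingLength.unique hb hb', bitBound_eval]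
    have h3 : D * W ≤ 2 ^ (b * (b + 1)) := (Nat.mul_le_mul_right W hDW).trans (hpow m le_rfl)
    refine exists_rat_of_mul_eq ha (by positivity) ?_ (lt_of_le_of_lt h3 hlt)
    have h4 := natAbs_le_of_mul_eq (c := m + 2) ha (by push_cast; exact hx)
    exact lt_of_le_of_lt (h4.trans (Nat.mul_le_mul_left _ h3)) hlt'
  · intro k hk g hg b' hb'
    rw [← HasEncodingLength.unique hb hb', bitBound_eval]
    obtain ⟨D', hD', hDW', h3, _⟩ := I.exists_grid hW hw k
    obtain ⟨a, ha⟩ := mem_grid.1 (h3 k le_rfl g)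
    obtain ⟨s, hs⟩ := mem_grid.1 (I.speed_mem hw (I.phase k).goods g)
    have hspos := lt_of_le_of_ne (I.speed_nonneg (I.phase k).goods g) (Ne.symm hg)
    have hW' : (0 : ℝ) < W := by exact_mod_cast hW
    have hs0 : 0 < s := by
      have : (0 : ℝ) < s := by rw [← hs]; positivity
      exact_mod_cast this
    have hsW : s ≤ W := by
      have : (s : ℝ) ≤ W := by
        rw [← hs]
        exact mul_le_of_le_one_left hW'.le (I.speed_le_one _ _)
      exact_mod_cast this
    have hst : ((s.toNat : ℕ) : ℝ) = s := by
      exact_mod_cast congrArg (fun z : ℤ => (z : ℝ)) (Int.toNat_of_nonneg hs0.le)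
    have ha' : a.natAbs ≤ D' := by
      have := natAbs_le_of_mul_eq (c := 1) ha (by
        rw [abs_of_nonneg (I.supply_nonneg k g)]; exact_mod_cast I.supply_le_one k g)
      omega
    -- The quotient of `a / D'` by `s / W`. The numerator is controlled by `a.natAbs ≤ D'`, as a
    -- supply is at most 1.
    refine exists_rat_of_mul_eq (a := a * W) (d := D' * s.toNat) ?_ ?_ ?_ ?_
    · push_cast
      rw [hst, ← hs, ← ha]
      field_simp
    · have : 0 < s.toNat := by omega
      positivity
    · rw [Int.natAbs_mul, Int.natAbs_natCast]
      exact lt_of_le_of_lt ((Nat.mul_le_mul_right W (ha'.trans hDW')).trans (hpow k hk.le)) hlt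
    · refine lt_of_le_of_lt ((Nat.mul_le_mul hDW' ?_).trans (hpow k hk.le)) hlt
      omega

/-! ### The program -/

/-- The cell `(i, 0)` of an index array. -/
abbrev IdxExpr.get (a : ℕ) (i : IdxExpr) : IdxExpr := .read a i (.const 0)

/-- The cell `(0, 0)` of an index array. -/
abbrev IdxExpr.var (a : ℕ) : IdxExpr := .get a (.const 0)

/-- The cell `(i, 0)` of a number array. -/
abbrev NumRef.get (a : ℕ) (i : IdxExpr) : NumRef := ⟨a, i, .const 0⟩

/-- The cell `(0, 0)` of a number array. -/
abbrev NumRef.var (a : ℕ) : NumRef := .get a (.const 0)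

/-- Disjunction of tests. -/
abbrev Test.disj (c d : Test) : Test := .neg (.conj (.neg c) (.neg d))

/-- Assignment to the cell `(0, 0)` of an index array. -/
abbrev Program.setVar (a : ℕ) (e : IdxExpr) : Program := .setIdx a (.const 0) (.const 0) e

/-- Assignment to the cell `(0, 0)` of a number array. -/
abbrev Program.setReal (a : ℕ) (e : NumExpr) : Program := .setNum a (.const 0) (.const 0) e

/-- `e - 1`. -/
abbrev IdxExpr.pred (e : IdxExpr) : IdxExpr := .sub e (.const 1)

/-- `e + 1`. -/
abbrev IdxExpr.succ (e : IdxExpr) : IdxExpr := .add e (.const 1)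

/-- The number of agents. -/
abbrev agents : IdxExpr := .var 0

/-- The number of goods. -/
abbrev items : IdxExpr := .read 0 (.const 0) (.const 1)

/-- Numbering of the units: index array `3` contains the number of the unit `q` of agent `i`, index
array `4` the owner of a unit, and the variables `10`, `11`, `12` the number of units, the size of
the padded matrix, and the number of units of an agent. -/
def numberUnits : Program :=
  .seq (.setVar 12 (.succ items)) <|
  .seq (.setVar 10 (.const 0)) <|
  .seq
    (forLoop 20 agents <| forLoop 21 (.var 12) <|
      .seq (.setIdx 3 (.var 20) (.var 21) (.var 10)) <|
      .seq (.setIdx 4 (.var 10) (.const 0) (.var 20)) <|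
      .setVar 10 (.succ (.var 10))) <|
  .setVar 11 (.add (.var 10) items)

/-- The constant `1` in the number variable `14`, and full supplies in the number array `3`. -/
def initSupply : Program :=
  .seq (.setReal 14 .one) <| forLoop 20 items <| .setNum 3 (.var 20) (.const 0) .one

/-- The favorite remaining goods, increased by one, in the index array `6`. -/
def findFavorites : Program :=
  forLoop 20 agents <|
    .seq (.setVar 13 (.const 0)) <|
    .seq
      (forLoop 21 items <|
        .branch
          (.conj (.numLt (.var 9) (.get 3 (.var 21)))
            (.disj (.idxEq (.var 13) (.const 0))
              (.numLt ⟨0, .var 20, .pred (.var 13)⟩ ⟨0, .var 20, .var 21⟩)))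
          (.setVar 13 (.succ (.var 21))) .skip) <|
    .setIdx 6 (.var 20) (.const 0) (.var 13)

/-- The eating speeds in the number array `4`. -/
def findSpeeds : Program :=
  forLoop 20 items <|
    .seq (.setReal 10 .zero) <|
    .seq
      (forLoop 21 agents <|
        .branch (.idxEq (.get 6 (.var 21)) (.succ (.var 20)))
          (.setReal 10 (.add (.var 10) (.get 1 (.var 21)))) .skip) <|
    .setNum 4 (.var 20) (.const 0) (.copy (.var 10))

/-- The duration of the phase in the number variable `5`. -/
def findDuration : Program :=
  .seq (.setReal 5 .zero) <|
  forLoop 20 items <|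
    .branch (.numLt (.var 9) (.get 4 (.var 20)))
      (.seq (.setReal 10 (.div (.get 3 (.var 20)) (.get 4 (.var 20)))) <|
        .branch (.disj (.numEq (.var 5) (.var 9)) (.numLt (.var 10) (.var 5)))
          (.setReal 5 (.copy (.var 10))) .skip)
      .skip

/-- The update of the supplies. -/
def updateSupply : Program :=
  forLoop 20 items <|
    .seq (.setReal 10 (.mul (.var 5) (.get 4 (.var 20)))) <|
    .setNum 3 (.var 20) (.const 0) (.sub (.get 3 (.var 20)) (.var 10))

/-- The number variable `12` is set to the number variable `11`, restricted to `[0, 1]`. -/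
def clamp : Program :=
  .branch (.numLt (.var 11) (.var 9)) (.setReal 12 .zero) <|
  .branch (.numLt (.var 14) (.var 11)) (.setReal 12 .one) (.setReal 12 (.copy (.var 11)))

/-- The update of the consumed amounts (number array `6`), the fill levels of the units (number
array `7`) and the contents of the units (number array `8`). -/
def updateUnits : Program :=
  forLoop 20 agents <|
    .seq (.setReal 10 (.mul (.var 5) (.get 1 (.var 20)))) <|
    .seq (.setNum 6 (.var 20) (.const 0) (.add (.get 6 (.var 20)) (.var 10))) <|
    .seq (.setReal 11 (.copy (.get 6 (.var 20)))) <|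
    forLoop 21 (.var 12) <|
      .seq clamp <|
      .seq (.setReal 10 (.sub (.var 12) (.get 7 (.read 3 (.var 20) (.var 21))))) <|
      .seq (.setNum 7 (.read 3 (.var 20) (.var 21)) (.const 0) (.copy (.var 12))) <|
      .seq (.setNum 8 (.read 3 (.var 20) (.var 21)) (.pred (.get 6 (.var 20)))
        (.add ⟨8, .read 3 (.var 20) (.var 21), .pred (.get 6 (.var 20))⟩ (.var 10))) <|
      .setReal 11 (.sub (.var 11) (.var 14))

/-- The contents of the units after the eating. -/
def eatAll : Program :=
  forLoop 25 items <|
    .seq findFavorites <| .seq findSpeeds <| .seq findDuration <| .seq updateSupply updateUnits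

/-- Padding of the matrix in the number array `8`. -/
def padMatrix : Program :=
  forLoop 20 (.var 10) <|
    .seq (.setNum 8 (.var 20) (.add items (.var 20)) (.sub (.var 14) (.get 7 (.var 20)))) <|
    forLoop 21 items <|
      .setNum 8 (.add (.var 10) (.var 21)) (.add items (.var 20))
        (.copy ⟨8, .var 20, .var 21⟩)

/-- The auction starts without holders (index array `7`) and with prices (index array `8`) `0`. -/
def initAuction : Program :=
  forLoop 22 (.var 11) <|
    .seq (.setIdx 7 (.var 22) (.const 0) (.const 0)) (.setIdx 8 (.var 22) (.const 0) (.const 0))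

/-- A column without a row, increased by one, in the index variable `14`. -/
def findBidder : Program :=
  .seq (.setVar 14 (.const 0)) <|
  forLoop 24 (.var 11) <|
    .branch (.idxEq (.get 7 (.var 24)) (.const 0)) (.setVar 14 (.succ (.var 24))) .skip

/-- The cheapest row in the support, increased by one, in the index variable `13`. -/
def findRow : Program :=
  .seq (.setVar 13 (.const 0)) <|
  forLoop 24 (.var 11) <|
    .branch
      (.conj (.numLt (.var 9) ⟨8, .var 24, .pred (.var 14)⟩)
        (.disj (.idxEq (.var 13) (.const 0))
          (.idxLt (.get 8 (.var 24)) (.get 8 (.pred (.var 13))))))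
      (.setVar 13 (.succ (.var 24))) .skip

/-- The bidder gets the row from its previous holder. -/
def assignRow : Program :=
  .seq
    (forLoop 24 (.var 11) <|
      .branch (.idxEq (.get 7 (.var 24)) (.var 13))
        (.setIdx 7 (.var 24) (.const 0) (.const 0)) .skip) <|
  .seq (.setIdx 7 (.pred (.var 14)) (.const 0) (.var 13)) <|
  .setIdx 8 (.pred (.var 13)) (.const 0) (.succ (.get 8 (.pred (.var 13))))

/-- A perfect matching of the support of the matrix. -/
def auction : Program :=
  .seq initAuction <|
  forLoop 22 (.var 11) <| forLoop 23 (.var 11) <|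
    .seq findBidder <| .branch (.idxEq (.var 14) (.const 0)) .skip (.seq findRow assignRow)

/-- The least entry of the matching in the number variable `13`. -/
def findWeight : Program :=
  .seq (.setReal 13 (.copy ⟨8, .pred (.var 7), .const 0⟩)) <|
  forLoop 22 (.var 11) <|
    .branch (.numLt ⟨8, .pred (.get 7 (.var 22)), .var 22⟩ (.var 13))
      (.setReal 13 (.copy ⟨8, .pred (.get 7 (.var 22)), .var 22⟩)) .skip

/-- The matching gives an allocation of the lottery. -/
def output : Program :=
  .seq (.setNum 2 (.var 1) (.const 0) (.copy (.var 13))) <|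
  .seq
    (forLoop 22 items <|
      .setIdx 2 (.var 1) (.var 22) (.get 4 (.pred (.get 7 (.var 22))))) <|
  .setVar 1 (.succ (.var 1))

/-- The matching is subtracted. -/
def subtract : Program :=
  .seq
    (forLoop 22 (.var 11) <|
      .setNum 8 (.pred (.get 7 (.var 22))) (.var 22)
        (.sub ⟨8, .pred (.get 7 (.var 22)), .var 22⟩ (.var 13))) <|
  .setReal 15 (.sub (.var 15) (.var 13))

/-- The decomposition; the number variable `15` contains the remaining row sums. -/
def decompose : Program :=
  .seq (.setReal 15 .one) <|
  .seq (.setVar 1 (.const 0)) <|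
  forLoop 20 (.var 11) <| forLoop 21 (.var 11) <|
    .branch (.numLt (.var 9) (.var 15))
      (.seq auction <| .seq findWeight <| .seq output subtract) .skip

/-- The complete program. -/
def lotteryProgram : Program :=
  .seq numberUnits <| .seq initSupply <| .seq eatAll <| .seq padMatrix decompose

/-! ### Correctness of the program -/

@[simp]
theorem Memory.writeIdx_num (M : Memory) (a i j x : ℕ) : (M.writeIdx a i j x).num = M.num := rfl

@[simp]
theorem Memory.writeNum_idx (M : Memory) (a i j : ℕ) (x : ℝ) :
    (M.writeNum a i j x).idx = M.idx := rfl

theorem Memory.writeIdx_idx (M : Memory) (a i j x a' i' j' : ℕ) : (M.writeIdx a i j x).idx a' i' j' =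
    if a' = a ∧ i' = i ∧ j' = j then x else M.idx a' i' j' := rfl

theorem Memory.writeNum_num (M : Memory) (a i j : ℕ) (x : ℝ) (a' i' j' : ℕ) :
    (M.writeNum a i j x).num a' i' j' =
      if a' = a ∧ i' = i ∧ j' = j then x else M.num a' i' j' := rfl

/-- The input and the tables that are not changed during the main part of the program. -/
structure Instance.Base (I : Instance n m) (M : Memory) : Prop where
  n_eq : M.idx 0 0 0 = n
  m_eq : M.idx 0 0 1 = m
  v_eq : ∀ (i : Fin n) (g : Fin m), M.num 0 i g = I.v i g
  w_eq : ∀ i : Fin n, M.num 1 i 0 = I.w i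
  unit_eq : ∀ i : Fin n, ∀ q < m + 1, M.idx 3 i q = i * (m + 1) + q
  owner_eq : ∀ r < n * (m + 1), M.idx 4 r 0 = r / (m + 1)
  units_eq : M.idx 10 0 0 = n * (m + 1)
  size_eq : M.idx 11 0 0 = n * (m + 1) + m
  m1_eq : M.idx 12 0 0 = m + 1
  zero_eq : M.num 9 0 0 = 0
  one_eq : M.num 14 0 0 = 1

theorem Instance.Base.frame {I : Instance n m} {M M' : Memory} (h : I.Base M) {l l' : List ℕ}
    (hf : Memory.Frame l l' M M') (hl : ∀ a ∈ [0, 3, 4, 10, 11, 12], a ∉ l)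
    (hl' : ∀ a ∈ [0, 1, 9, 14], a ∉ l') : I.Base M' := by
  have hi : ∀ a ∈ [0, 3, 4, 10, 11, 12], M'.idx a = M.idx a := fun a ha => hf.idx a (hl a ha)
  have hn : ∀ a ∈ [0, 1, 9, 14], M'.num a = M.num a := fun a ha => hf.num a (hl' a ha)
  simp only [List.mem_cons, List.not_mem_nil, or_false, forall_eq_or_imp, forall_eq] at hi hn
  obtain ⟨h0, h3, h4, h10, h11, h12⟩ := hi
  obtain ⟨k0, k1, k9, k14⟩ := hn
  constructor
  · rw [h0]; exact h.n_eq
  · rw [h0]; exact h.m_eq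
  · rw [k0]; exact h.v_eq
  · rw [k1]; exact h.w_eq
  · rw [h3]; exact h.unit_eq
  · rw [h4]; exact h.owner_eq
  · rw [h10]; exact h.units_eq
  · rw [h11]; exact h.size_eq
  · rw [h12]; exact h.m1_eq
  · rw [k9]; exact h.zero_eq
  · rw [k14]; exact h.one_eq

/-! ### Initialization -/

section Init

variable {I : Instance n m} {ok : ℝ → Prop} {B : ℕ}

/-- The machine can neither multiply nor divide indices, so `i * (m + 1) + q` and the owner `r / (m
+ 1)` are tabulated by counting. The two nested loops share one invariant, indexed by the number of
units seen so far. -/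
theorem numberUnits_spec {M : Memory} (hn : M.idx 0 0 0 = n) (hm : M.idx 0 0 1 = m) (hnB : n ≤ B)
    (hmB : m + 1 ≤ B) : wp ok B numberUnits (fun M' =>
      (∀ i : Fin n, ∀ q < m + 1, M'.idx 3 i q = i * (m + 1) + q) ∧
      (∀ r < n * (m + 1), M'.idx 4 r 0 = r / (m + 1)) ∧ M'.idx 10 0 0 = n * (m + 1) ∧
      M'.idx 11 0 0 = n * (m + 1) + m ∧ M'.idx 12 0 0 = m + 1) M := by
  let Inv : ℕ → Memory → Prop := fun t M' =>
    (∀ i : Fin n, ∀ q < m + 1, i * (m + 1) + q < t → M'.idx 3 i q = i * (m + 1) + q) ∧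
    (∀ r < t, M'.idx 4 r 0 = r / (m + 1)) ∧ M'.idx 10 0 0 = t ∧ M'.idx 12 0 0 = m + 1
  simp only [numberUnits, wp, IdxExpr.eval]
  refine wp_conseq (Q := Inv (n * (m + 1))) (wp_forLoop (N := n) (fun i M' => Inv (i * (m + 1)) M')
    ?_ hnB (by decide) (by decide) (fun k M x h => by simpa [Inv, Memory.writeIdx_idx] using h)
    ?_ ?_) ?_
  · simp [IdxExpr.eval, Memory.writeIdx_idx, hn]
  · simp [Inv, Memory.writeIdx_idx, hm]
  · intro i hi M₁ hf hc hInv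
    have h4 : (i + 1) * (m + 1) = i * (m + 1) + (m + 1) := Nat.succ_mul _ _
    rw [h4]
    refine wp_forLoop (N := m + 1) (fun q M' => Inv (i * (m + 1) + q) M')
      ?_ hmB (by decide) (by decide) (fun k M x h => by simpa [Inv, Memory.writeIdx_idx] using h)
      ?_ ?_
    · simpa [IdxExpr.eval] using hInv.2.2.2
    · simpa using hInv
    · intro q hq M₂ hf2 hc2 hInv2
      have hc' : M₂.idx 20 0 0 = i := by rw [hf2.idx 20 (by decide), hc]
      obtain ⟨h1, h2, h3, h5⟩ := hInv2
      simp only [wp, IdxExpr.eval]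
      simp only [Memory.writeIdx_idx, hc', hc2, h3]
      refine ⟨fun i' q' hq' hlt => ?_, fun r hr => ?_, ?_, ?_⟩
      · simp only [Memory.writeIdx_idx]
        norm_num
        split_ifs with h6
        · rw [h6.1, h6.2]
        · refine h1 i' q' hq' ?_
          by_contra hcon
          have h7 : (i' : ℕ) * (m + 1) + q' = i * (m + 1) + q := by omega
          have h8 := congrArg (· / (m + 1)) h7
          simp only [unit_div hq', unit_div hq] at h8
          rw [h8] at h7
          exact h6 ⟨h8, by omega⟩
      · simp only [Memory.writeIdx_idx]
        norm_num
        split_ifs with h6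
        · rw [h6, unit_div hq]
        · exact h2 r (by omega)
      · simp [Memory.writeIdx_idx, Nat.add_assoc]
      · simp [Memory.writeIdx_idx, h5]
  · rintro M' ⟨h1, h2, h3, h4⟩ hf
    have hm' : M'.idx 0 0 1 = m := by
      rw [hf.idx 0 (by decide)]
      simp [Memory.writeIdx_idx, hm]
    simp only [Memory.writeIdx_idx, h3, hm', h4]
    norm_num
    exact ⟨fun i q hq => h1 i q (by omega) (unit_lt i.2 (by omega)), h2⟩

theorem initSupply_spec {M : Memory} (hm : M.idx 0 0 1 = m) (hmB : m ≤ B) (hok : ok 1) :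
    wp ok B initSupply (fun M' => M'.num 14 0 0 = 1 ∧ ∀ g < m, M'.num 3 g 0 = 1) M := by
  simp only [initSupply, wp]
  refine ⟨hok, ?_⟩
  refine wp_forLoop (N := m) (fun t M' => M'.num 14 0 0 = 1 ∧ ∀ g < t, M'.num 3 g 0 = 1)
    ?_ hmB (by decide) (by decide) (fun k M x h => by simpa using h) ?_ ?_
  · simpa [IdxExpr.eval] using hm
  · simp [Memory.writeNum_num, NumExpr.eval, IdxExpr.eval]
  · rintro g hg M' hf hc ⟨h1, h2⟩
    simp only [wp, IdxExpr.eval, hc, NumExpr.eval, Memory.writeNum_num]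
    norm_num
    exact ⟨hok, h1, fun g' hg' h => h2 g' (by omega)⟩

end Init

/-- The memory before phase `k` of the eating. -/
structure Instance.EatState (I : Instance n m) (k : ℕ) (M : Memory) : Prop where
  supply : ∀ g : Fin m, M.num 3 g 0 = (I.phase k).supply g
  amount : ∀ i : Fin n, M.num 6 i 0 = I.w i * I.clock k
  level : ∀ i : Fin n, ∀ q < m + 1, M.num 7 (i * (m + 1) + q) 0 = unitFill (I.w i * I.clock k) q
  content : ∀ i : Fin n, ∀ q < m + 1, ∀ g : Fin m,
    M.num 8 (i * (m + 1) + q) g = I.fill k i q g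
  outside : ∀ r c, n * (m + 1) ≤ r ∨ m ≤ c → M.num 8 r c = 0

/-- `x` encodes the favorite good of `i` in `S`. -/
def Instance.FavCode (I : Instance n m) (S : Finset (Fin m)) (i : Fin n) (x : ℕ) : Prop :=
  (x = 0 ∧ S = ∅) ∨ ∃ g : Fin m, I.IsFavorite S i g ∧ x = g + 1

theorem Instance.FavCode.eq_iff {I : Instance n m} {S : Finset (Fin m)} {i : Fin n} {x : ℕ}
    (h : I.FavCode S i x) (g : Fin m) : x = g + 1 ↔ I.IsFavorite S i g := by
  rcases h with ⟨rfl, rfl⟩ | ⟨f, hf, rfl⟩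
  · simp [Instance.IsFavorite]
  · constructor
    · intro h
      have : f = g := Fin.ext (by omega)
      exact this ▸ hf
    · intro h
      rw [hf.unique h]

/-- The scan runs through the goods in the fixed order and replaces the candidate only for a
strictly larger value, which resolves ties in favor of the earlier good. -/
theorem Instance.FavCode.step {I : Instance n m} {S : Finset (Fin m)} {i : Fin n} {x : ℕ}
    {g : Fin m} (h : I.FavCode (S.filter fun f : Fin m => (f : ℕ) < g) i x) {val : ℕ → ℝ}
    (hval : ∀ f : Fin m, val f = I.v i f) :
    (g ∈ S ∧ (x = 0 ∨ val (x - 1) < I.v i g) →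
      I.FavCode (S.filter fun f : Fin m => (f : ℕ) < g + 1) i (g + 1)) ∧
    (¬ (g ∈ S ∧ (x = 0 ∨ val (x - 1) < I.v i g)) →
      I.FavCode (S.filter fun f : Fin m => (f : ℕ) < g + 1) i x) := by
  have hcase : ∀ f : Fin m, (f : ℕ) < g + 1 → (f : ℕ) < g ∨ f = g := fun f hf => by
    rcases Nat.lt_succ_iff_lt_or_eq.1 hf with h | h
    · exact Or.inl h
    · exact Or.inr (Fin.ext h)
  constructor
  · rintro ⟨hg, hx⟩
    refine Or.inr ⟨g, ⟨by simp [hg], fun f hf => ?_⟩, rfl⟩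
    rw [Finset.mem_filter] at hf
    rcases hcase f hf.2 with hlt | rfl
    · have hfm : f ∈ S.filter fun f : Fin m => (f : ℕ) < g := Finset.mem_filter.2 ⟨hf.1, hlt⟩
      rcases h with ⟨_, h0⟩ | ⟨b, hb, rfl⟩
      · rw [h0] at hfm; simp at hfm
      · have hbg : I.v i b < I.v i g := by
          rcases hx with hx | hx
          · omega
          · rwa [Nat.add_sub_cancel, hval] at hx
        exact I.before_trans (Or.inl hbg) (hb.2 f hfm)
    · exact I.before_refl i f
  · intro hx
    rcases h with ⟨rfl, h0⟩ | ⟨b, hb, rfl⟩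
    · refine Or.inl ⟨rfl, Finset.filter_eq_empty_iff.2 fun f hf hlt => ?_⟩
      rcases hcase f hlt with hlt | rfl
      · exact Finset.filter_eq_empty_iff.1 h0 hf hlt
      · exact hx ⟨hf, Or.inl rfl⟩
    · have hbS := Finset.mem_filter.1 hb.1
      refine Or.inr ⟨b, ⟨by simp only [Finset.mem_filter]; exact ⟨hbS.1, by omega⟩,
        fun f hf => ?_⟩, rfl⟩
      rw [Finset.mem_filter] at hf
      rcases hcase f hf.2 with hlt | rfl
      · exact hb.2 f (Finset.mem_filter.2 ⟨hf.1, hlt⟩)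
      · have h1 : ¬ I.v i b < I.v i f := by
          intro h2
          refine hx ⟨hf.1, Or.inr ?_⟩
          rwa [Nat.add_sub_cancel, hval]
        rcases (not_lt.1 h1).lt_or_eq with h2 | h2
        · exact Or.inl h2
        · exact Or.inr ⟨h2.symm, hbS.2.le⟩

theorem sum_filter_succ {f : Fin n → ℝ} {p : Fin n → Prop} [DecidablePred p] (j : Fin n) :
    ∑ i ∈ Finset.univ.filter (fun i : Fin n => (i : ℕ) < j + 1 ∧ p i), f i =
      ∑ i ∈ Finset.univ.filter (fun i : Fin n => (i : ℕ) < j ∧ p i), f i +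
        if p j then f j else 0 := by
  have h : ∀ i : Fin n, (if (i : ℕ) < j + 1 ∧ p i then f i else 0) =
      (if (i : ℕ) < j ∧ p i then f i else 0) + if i = j then (if p j then f j else 0) else 0 := by
    intro i
    by_cases hij : i = j
    · subst hij; simp
    · have h1 : (i : ℕ) < j + 1 ↔ (i : ℕ) < j := by
        have : (i : ℕ) ≠ j := fun h => hij (Fin.ext h)
        omega
      simp [hij, h1]
  simp only [Finset.sum_filter, h, Finset.sum_add_distrib, Finset.sum_ite_eq', Finset.mem_univ,
    if_true]

/-! ### One phase of eating: favorites, speeds, duration -/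

section Eating

variable {I : Instance n m} {ok : ℝ → Prop} {B k : ℕ} {M : Memory} {H : AddSubgroup ℝ}

theorem findFavorites_spec (hb : I.Base M) (hs : I.EatState k M) (hnB : n ≤ B) (hmB : m ≤ B) :
    wp ok B findFavorites (fun M' => ∀ i : Fin n, I.FavCode (I.phase k).goods i (M'.idx 6 i 0)) M := by
  have hw : wp ok B findFavorites (fun M' => ∀ i : Fin n, (i : ℕ) < n →
      I.FavCode (I.phase k).goods i (M'.idx 6 i 0)) M := by
    refine wp_forLoop (N := n) (fun j M' => ∀ i : Fin n, (i : ℕ) < j →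
      I.FavCode (I.phase k).goods i (M'.idx 6 i 0)) hb.n_eq hnB (by decide) (by decide)
      (fun k M x h => by simpa [Memory.writeIdx_idx] using h) (fun i hi => by omega) ?_
    intro j hj M₁ hf₁ hc₁ h₁
    have hb₁ := hb.frame hf₁ (by decide) (by decide)
    simp only [wp]
    refine wp_conseq (wp_forLoop (N := m) (fun t M' =>
      I.FavCode ((I.phase k).goods.filter fun f : Fin m => (f : ℕ) < t) ⟨j, hj⟩ (M'.idx 13 0 0))
      ?_ hmB (by decide) (by decide) (fun k M x h => by simpa [Memory.writeIdx_idx] using h)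
      ?_ ?_) ?_
    · simpa [IdxExpr.eval, Memory.writeIdx_idx] using hb₁.m_eq
    · exact Or.inl (by simp [Memory.writeIdx_idx, IdxExpr.eval])
    · intro t ht M₂ hf₂ hc₂ h₂
      have hf₂' : Memory.Frame [6, 13, 20, 21] [] M M₂ := (hf₁.mono (by decide) (by decide)).trans
        ((M₁.frame_writeIdx (by decide) _ _ _).trans (hf₂.mono (by decide) (by decide)))
      have hb₂ := hb.frame hf₂' (by decide) (by decide)
      have hsup : M₂.num 3 t 0 = (I.phase k).supply ⟨t, ht⟩ := by
        rw [hf₂'.num 3 (by decide)]; exact hs.supply ⟨t, ht⟩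
      have hcj : M₂.idx 20 0 0 = j := by
        rw [hf₂.idx 20 (by decide)]; simpa [Memory.writeIdx_idx] using hc₁
      obtain ⟨hA, hB⟩ := h₂.step (g := ⟨t, ht⟩) (val := fun g => M₂.num 0 j g)
        fun f => hb₂.v_eq ⟨j, hj⟩ f
      have hv : M₂.num 0 j t = I.v ⟨j, hj⟩ ⟨t, ht⟩ := hb₂.v_eq ⟨j, hj⟩ ⟨t, ht⟩
      simp only [I.mem_goods] at hA hB
      simp only [wp, Test.Holds, NumRef.eval, IdxExpr.eval, hc₂, hcj, hsup, hv, hb₂.zero_eq,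
        Memory.writeIdx_idx]
      rw [← not_or, not_not]
      exact ⟨hA, hB⟩
    · intro M₂ h₂ hf₂ i hi
      have hc₂ : M₂.idx 20 0 0 = j := by
        rw [hf₂.idx 20 (by decide)]; simpa [Memory.writeIdx_idx] using hc₁
      simp only [IdxExpr.eval, hc₂, Memory.writeIdx_idx]
      norm_num
      split_ifs with hij
      · have : i = ⟨j, hj⟩ := Fin.ext hij
        rw [this]
        convert h₂
        ext f
        simp
      · rw [hf₂.idx 6 (by decide)]
        simp only [Memory.writeIdx_idx, IdxExpr.eval]
        norm_num
        exact h₁ i (by omega)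
  exact wp_mono _ hw fun M' h i => h i i.2

/-- The intermediate sums are sums of entitlements of different agents, so they stay in `H` and
below 1. -/
theorem findSpeeds_spec (hN : I.NumContext ok H) (hb : I.Base M)
    (hfav : ∀ i : Fin n, I.FavCode (I.phase k).goods i (M.idx 6 i 0))
    (hnB : n ≤ B) (hmB : m ≤ B) :
    wp ok B findSpeeds (fun M' => ∀ g : Fin m, M'.num 4 g 0 = I.speed (I.phase k).goods g) M := by
  classical
  have hpart : ∀ (t : ℕ) (g : Fin m), ok (∑ i ∈ Finset.univ.filter
      (fun i : Fin n => (i : ℕ) < t ∧ I.IsFavorite (I.phase k).goods i g), I.w i) := by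
    intro t g
    refine hN.ok_of_mem _ (H.sum_mem fun i _ => hN.w_mem i) ?_
    rw [abs_of_nonneg (Finset.sum_nonneg fun i _ => (I.w_pos i).le)]
    have h1 : ∑ i ∈ Finset.univ.filter
        (fun i : Fin n => (i : ℕ) < t ∧ I.IsFavorite (I.phase k).goods i g), I.w i ≤ 1 := by
      rw [← I.w_sum]
      exact Finset.sum_le_sum_of_subset_of_nonneg (Finset.subset_univ _)
        fun i _ _ => (I.w_pos i).le
    have : (0 : ℝ) ≤ m := Nat.cast_nonneg m
    linarith
  have hw : wp ok B findSpeeds (fun M' => ∀ g : Fin m, (g : ℕ) < m →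
      M'.num 4 g 0 = I.speed (I.phase k).goods g) M := by
    refine wp_forLoop (N := m) (fun j M' => ∀ g : Fin m, (g : ℕ) < j →
      M'.num 4 g 0 = I.speed (I.phase k).goods g) hb.m_eq hmB (by decide) (by decide)
      (fun k M x h => by simpa using h) (fun i hi => by omega) ?_
    intro j hj M₁ hf₁ hc₁ h₁
    have hb₁ := hb.frame hf₁ (by decide) (by decide)
    simp only [wp]
    have hok0 : ok 0 := hN.ok_of_mem 0 (zero_mem H) (by simp; positivity)
    refine ⟨hok0, wp_conseq (wp_forLoop (N := n) (fun t M' => M'.num 10 0 0 =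
      ∑ i ∈ Finset.univ.filter (fun i : Fin n => (i : ℕ) < t ∧
        I.IsFavorite (I.phase k).goods i ⟨j, hj⟩), I.w i)
      ?_ hnB (by decide) (by decide) (fun k M x h => by simpa using h) ?_ ?_) ?_⟩
    · simpa [IdxExpr.eval] using hb₁.n_eq
    · simp [Memory.writeNum_num, NumExpr.eval, IdxExpr.eval]
    · intro t ht M₂ hf₂ hc₂ h₂
      have hf₂' : Memory.Frame [20, 21] [4, 10] M M₂ := (hf₁.mono (by decide) (by decide)).trans
        ((M₁.frame_writeNum (by decide) _ _ _).trans (hf₂.mono (by decide) (by decide)))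
      have hb₂ := hb.frame hf₂' (by decide) (by decide)
      have hcj : M₂.idx 20 0 0 = j := by
        rw [hf₂.idx 20 (by decide)]; simpa using hc₁
      have hw : M₂.num 1 t 0 = I.w ⟨t, ht⟩ := hb₂.w_eq ⟨t, ht⟩
      have hiff : M₂.idx 6 t 0 = j + 1 ↔ I.IsFavorite (I.phase k).goods ⟨t, ht⟩ ⟨j, hj⟩ := by
        rw [hf₂'.idx 6 (by decide)]
        exact (hfav ⟨t, ht⟩).eq_iff ⟨j, hj⟩
      have hsum := sum_filter_succ (f := I.w)
        (p := fun i => I.IsFavorite (I.phase k).goods i ⟨j, hj⟩) ⟨t, ht⟩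
      simp only at hsum
      simp only [wp, Test.Holds, NumExpr.eval, NumRef.eval, IdxExpr.eval, hc₂, hcj, hiff, h₂, hw,
        Memory.writeNum_num]
      constructor
      · intro hfv
        rw [if_pos hfv] at hsum
        rw [← hsum]
        exact ⟨hpart _ _, by simp⟩
      · intro hfv
        rw [if_neg hfv] at hsum
        rw [hsum, add_zero]
    · intro M₂ h₂ hf₂
      have hc₂ : M₂.idx 20 0 0 = j := by
        rw [hf₂.idx 20 (by decide)]; simpa using hc₁
      simp only [NumExpr.eval, NumRef.eval, IdxExpr.eval, hc₂, Memory.writeNum_num, h₂]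
      refine ⟨hpart _ _, fun g hg => ?_⟩
      norm_num
      split_ifs with hij
      · have : g = ⟨j, hj⟩ := Fin.ext hij
        rw [this, Instance.speed]
      · rw [hf₂.num 4 (by decide)]
        simp only [Memory.writeNum_num, IdxExpr.eval]
        norm_num
        exact h₁ g (by omega)
  exact wp_mono _ hw fun M' h g => h g g.2

/-- The value 0 stands for the absence of a candidate. This is unambiguous, since a good eaten at
positive speed has positive supply and thus a positive finish time; it is also the right result when
no good remains. -/
theorem findDuration_spec (hN : I.NumContext ok H) (hk : k < m) (hb : I.Base M)
    (hs : I.EatState k M)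
    (hsp : ∀ g : Fin m, M.num 4 g 0 = I.speed (I.phase k).goods g) (hmB : m ≤ B) :
    wp ok B findDuration (fun M' => M'.num 5 0 0 = I.dur k) M := by
  have hok0 : ok 0 := hN.ok_of_mem 0 (zero_mem H) (by simp; positivity)
  let R : Fin m → ℝ := fun g => (I.phase k).supply g / I.speed (I.phase k).goods g
  have hRpos : ∀ g, I.speed (I.phase k).goods g ≠ 0 → 0 < R g := fun g hg => by
    have h1 : g ∈ (I.phase k).goods := by
      by_contra h; exact hg (I.speed_of_notMem h)
    exact div_pos (I.mem_goods.1 h1) (lt_of_le_of_ne (I.speed_nonneg _ _) (Ne.symm hg))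
  let Inv : ℕ → Memory → Prop := fun t M' =>
    (M'.num 5 0 0 = 0 ∧ ∀ g : Fin m, (g : ℕ) < t → I.speed (I.phase k).goods g = 0) ∨
    ((∃ g : Fin m, I.speed (I.phase k).goods g ≠ 0 ∧ M'.num 5 0 0 = R g) ∧
      ∀ g : Fin m, (g : ℕ) < t → I.speed (I.phase k).goods g ≠ 0 → M'.num 5 0 0 ≤ R g)
  simp only [findDuration, wp]
  refine ⟨hok0, wp_mono _ (wp_forLoop (N := m) Inv ?_ hmB (by decide) (by decide)
    (fun k M x h => by simpa [Inv] using h) ?_ ?_) ?_⟩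
  · simpa [IdxExpr.eval] using hb.m_eq
  · exact Or.inl ⟨by simp [Memory.writeNum_num, NumExpr.eval, IdxExpr.eval], fun g hg => by omega⟩
  · intro t ht M₁ hf₁ hc₁ h₁
    have hf₁' : Memory.Frame [20] [5, 10] M M₁ :=
      (M.frame_writeNum (by decide) _ _ _).trans (hf₁.mono (by decide) (by decide))
    have hb₁ := hb.frame hf₁' (by decide) (by decide)
    have h3 : M₁.num 3 t 0 = (I.phase k).supply ⟨t, ht⟩ := by
      rw [hf₁'.num 3 (by decide)]; exact hs.supply ⟨t, ht⟩
    have h4 : M₁.num 4 t 0 = I.speed (I.phase k).goods ⟨t, ht⟩ := by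
      rw [hf₁'.num 4 (by decide)]; exact hsp ⟨t, ht⟩
    have hcase : ∀ f : Fin m, (f : ℕ) < t + 1 → (f : ℕ) < t ∨ f = ⟨t, ht⟩ := fun f hf => by
      rcases Nat.lt_succ_iff_lt_or_eq.1 hf with h | h
      · exact Or.inl h
      · exact Or.inr (Fin.ext h)
    simp only [wp, Test.Holds, NumExpr.eval, NumRef.eval, IdxExpr.eval, hc₁, h3, h4,
      hb₁.zero_eq, Memory.writeNum_num]
    norm_num
    constructor
    · intro hpos
      have hq := hN.ok_quot k hk ⟨t, ht⟩ hpos.ne'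
      refine ⟨hq, fun hc => ⟨hq, ?_⟩, fun h5 hle => ?_⟩
      · right
        refine ⟨⟨⟨t, ht⟩, hpos.ne', by simp [Memory.writeNum_num, R]⟩, fun f hf hf' => ?_⟩
        simp only [Memory.writeNum_num]
        norm_num
        rcases hcase f hf with hf1 | rfl
        · rcases h₁ with ⟨_, h6⟩ | ⟨⟨g, hg, hg'⟩, h6⟩
          · exact absurd (h6 f hf1) hf'
          · have h7 : M₁.num 5 0 0 ≠ 0 := by rw [hg']; exact (hRpos g hg).ne'
            exact (hc h7).le.trans (h6 f hf1 hf')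
        · exact le_rfl
      · right
        rcases h₁ with ⟨h6, _⟩ | ⟨⟨g, hg, hg'⟩, h6⟩
        · exact absurd h6 h5
        · refine ⟨⟨g, hg, by simpa [Memory.writeNum_num] using hg'⟩, fun f hf hf' => ?_⟩
          simp only [Memory.writeNum_num]
          norm_num
          rcases hcase f hf with hf1 | rfl
          · exact h6 f hf1 hf'
          · exact hle
    · intro hle
      have h0 : I.speed (I.phase k).goods ⟨t, ht⟩ = 0 := le_antisymm hle (I.speed_nonneg _ _)
      rcases h₁ with ⟨h5, h6⟩ | ⟨h5, h6⟩
      · refine Or.inl ⟨h5, fun f hf => ?_⟩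
        rcases hcase f hf with hf1 | rfl
        · exact h6 f hf1
        · exact h0
      · refine Or.inr ⟨h5, fun f hf hf' => ?_⟩
        rcases hcase f hf with hf1 | rfl
        · exact h6 f hf1 hf'
        · exact absurd h0 hf'
  · intro M₁ h₁
    rcases (I.phase k).goods.eq_empty_or_nonempty with h0 | h0
    · rcases h₁ with ⟨h5, _⟩ | ⟨⟨g, hg, _⟩, _⟩
      · rw [h5]; exact (I.phaseLength_of_empty _ h0).symm
      · exact absurd (I.speed_of_notMem (by simp [h0])) hg
    · obtain ⟨⟨f, hf, hf', hd⟩, hmin, _⟩ := I.phaseLength_spec _ h0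
      rcases h₁ with ⟨_, h6⟩ | ⟨⟨g, hg, hg'⟩, h6⟩
      · exact absurd (h6 f f.2) hf'
      · refine le_antisymm ?_ ?_
        · rw [Instance.dur, hd]; exact h6 f f.2 hf'
        · rw [hg']
          exact hmin g (by by_contra h; exact hg (I.speed_of_notMem h)) hg

end Eating

theorem unit_inj {M i q i' q' : ℕ} (hq : q < M) (hq' : q' < M) (h : i * M + q = i' * M + q') :
    i = i' ∧ q = q' := by
  have h1 := congrArg (· / M) h
  simp only [unit_div hq, unit_div hq'] at h1
  subst h1
  exact ⟨rfl, by omega⟩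

open Classical in
theorem Instance.fill_succ (I : Instance n m) (k : ℕ) (i : Fin n) (q : ℕ) (g : Fin m) :
    I.fill (k + 1) i q g = I.fill k i q g + if I.IsFavorite (I.phase k).goods i g then
      unitFill (I.w i * I.clock (k + 1)) q - unitFill (I.w i * I.clock k) q else 0 :=
  Finset.sum_range_succ _ _

theorem Instance.fill_le_one (I : Instance n m) (k : ℕ) (i : Fin n) (q : ℕ) (g : Fin m) :
    I.fill k i q g ≤ 1 := by
  classical
  have h0 : unitFill (I.w i * I.clock 0) q = 0 := by simp [Instance.clock, unitFill]
  calc I.fill k i q g ≤ ∑ j ∈ Finset.range k,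
        (unitFill (I.w i * I.clock (j + 1)) q - unitFill (I.w i * I.clock j) q) := by
        refine Finset.sum_le_sum fun j _ => ?_
        split_ifs
        · exact le_rfl
        · exact sub_nonneg.2 (unitFill_mono (mul_le_mul_of_nonneg_left (I.clock_mono j.le_succ)
            (I.w_pos i).le) q)
    _ = unitFill (I.w i * I.clock k) q := by
        rw [Finset.sum_range_sub fun j => unitFill (I.w i * I.clock j) q, h0, sub_zero]
    _ ≤ 1 := unitFill_le_one _ _

/-! ### Membership of the stored numbers in the grid -/

section Context

variable {I : Instance n m} {ok : ℝ → Prop} {H : AddSubgroup ℝ}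

theorem Instance.NumContext.natCast_mem (hN : I.NumContext ok H) (q : ℕ) : (q : ℝ) ∈ H := by
  have := H.nsmul_mem hN.one_mem q
  simpa using this

theorem Instance.NumContext.amount_mem (hN : I.NumContext ok H) {k : ℕ} (hk : k ≤ m) (i : Fin n) :
    I.w i * I.clock k ∈ H := by
  rw [Instance.clock, Finset.mul_sum]
  refine H.sum_mem fun j hj => ?_
  rw [mul_comm]
  exact hN.dur_mem j (by simp at hj; omega) i

theorem Instance.NumContext.unitFill_mem (hN : I.NumContext ok H) {x : ℝ} (hx : x ∈ H) (q : ℕ) :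
    unitFill x q ∈ H := by
  rw [unitFill_eq]
  split_ifs
  · exact zero_mem _
  · exact hN.one_mem
  · exact sub_mem hx (hN.natCast_mem q)

theorem Instance.NumContext.fill_mem (hN : I.NumContext ok H) {k : ℕ} (hk : k ≤ m) (i : Fin n)
    (q : ℕ) (g : Fin m) : I.fill k i q g ∈ H := by
  classical
  refine H.sum_mem fun j hj => ?_
  rw [Finset.mem_range] at hj
  split_ifs
  · exact sub_mem (hN.unitFill_mem (hN.amount_mem (by omega) i) q)
      (hN.unitFill_mem (hN.amount_mem (by omega) i) q)
  · exact zero_mem _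

theorem Instance.NumContext.ok_unit (hN : I.NumContext ok H) {x : ℝ} (hx : x ∈ H) (h0 : 0 ≤ x)
    (h1 : x ≤ 1) : ok x := by
  refine hN.ok_of_mem x hx ?_
  rw [abs_of_nonneg h0]
  have : (0 : ℝ) ≤ m := Nat.cast_nonneg m
  linarith

end Context

/-! ### Updates of supplies and units, and the padding -/

section Eating

variable {I : Instance n m} {ok : ℝ → Prop} {B k : ℕ} {M : Memory} {H : AddSubgroup ℝ}

theorem updateSupply_spec (hN : I.NumContext ok H) (hk : k < m) (hb : I.Base M)
    (hs : ∀ g : Fin m, M.num 3 g 0 = (I.phase k).supply g)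
    (hsp : ∀ g : Fin m, M.num 4 g 0 = I.speed (I.phase k).goods g) (hd : M.num 5 0 0 = I.dur k)
    (hmB : m ≤ B) :
    wp ok B updateSupply (fun M' => ∀ g : Fin m, M'.num 3 g 0 = (I.phase (k + 1)).supply g) M := by
  have hw : wp ok B updateSupply (fun M' => ∀ g : Fin m, M'.num 3 g 0 =
      if (g : ℕ) < m then (I.phase (k + 1)).supply g else (I.phase k).supply g) M := by
    refine wp_forLoop (N := m) (fun t M' => ∀ g : Fin m, M'.num 3 g 0 =
      if (g : ℕ) < t then (I.phase (k + 1)).supply g else (I.phase k).supply g)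
      hb.m_eq hmB (by decide) (by decide) (fun k M x h => by simpa using h)
      (fun g => by simpa using hs g) ?_
    intro t ht M₁ hf₁ hc₁ h₁
    have hb₁ := hb.frame hf₁ (by decide) (by decide)
    have h4 : M₁.num 4 t 0 = I.speed (I.phase k).goods ⟨t, ht⟩ := by
      rw [hf₁.num 4 (by decide)]; exact hsp ⟨t, ht⟩
    have h5 : M₁.num 5 0 0 = I.dur k := by rw [hf₁.num 5 (by decide), hd]
    have h3 : M₁.num 3 t 0 = (I.phase k).supply ⟨t, ht⟩ := by
      have := h₁ ⟨t, ht⟩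
      simpa using this
    have hsucc := I.supply_succ k ⟨t, ht⟩
    simp only [wp, NumExpr.eval, NumRef.eval, IdxExpr.eval, Memory.writeNum_idx, hc₁,
      Memory.writeNum_num, h4, h5, h3]
    norm_num
    rw [← hsucc]
    refine ⟨hN.ok_unit (I.dur_mul_speed_mem (hN.dur_mem k hk) _ _)
      (mul_nonneg (I.dur_nonneg k) (I.speed_nonneg _ _)) ?_,
      hN.ok_unit (hN.supply_mem (k + 1) hk _) (I.supply_nonneg _ _) (I.supply_le_one _ _),
      fun g => ?_⟩
    · have := I.supply_nonneg (k + 1) ⟨t, ht⟩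
      have := I.supply_le_one k ⟨t, ht⟩
      linarith
    · by_cases hg : (g : ℕ) = t
      · have : g = ⟨t, ht⟩ := Fin.ext hg
        subst this
        simp
      · have h1 : (g : ℕ) ≤ t ↔ (g : ℕ) < t := by omega
        rw [if_neg hg, h₁ g]
        simp only [h1]
  refine wp_mono _ hw fun M' h g => ?_
  rw [h g, if_pos g.2]

theorem clamp_spec {x : ℝ} {q : ℕ} (h0 : M.num 9 0 0 = 0) (h1 : M.num 14 0 0 = 1)
    (hx : M.num 11 0 0 = x - q) (hok : ok (unitFill x q)) :
    wp ok B clamp (fun M' => M'.num 12 0 0 = unitFill x q) M := by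
  rw [unitFill_eq] at *
  simp only [clamp, wp, Test.Holds, NumExpr.eval, NumRef.eval, IdxExpr.eval, Memory.writeNum_num,
    h0, h1, hx]
  refine ⟨fun h => ?_, fun h => ⟨fun h' => ?_, fun h' => ?_⟩⟩
  · rw [if_pos h] at hok ⊢
    simpa using hok
  · rw [if_neg h, if_pos h'] at hok ⊢
    simpa using hok
  · rw [if_neg h, if_neg h'] at hok ⊢
    simpa using hok

/-- The rows of the units before unit `t` have been updated in phase `k`. -/
structure Instance.UnitState (I : Instance n m) (k t : ℕ) (M : Memory) : Prop where
  level : ∀ i : Fin n, ∀ q < m + 1, M.num 7 (i * (m + 1) + q) 0 =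
    unitFill (I.w i * I.clock (if i * (m + 1) + q < t then k + 1 else k)) q
  content : ∀ i : Fin n, ∀ q < m + 1, ∀ g : Fin m, M.num 8 (i * (m + 1) + q) g =
    I.fill (if i * (m + 1) + q < t then k + 1 else k) i q g
  outside : ∀ r c, n * (m + 1) ≤ r ∨ m ≤ c → M.num 8 r c = 0

theorem Instance.UnitState.frame {t : ℕ} {M' : Memory} (h : I.UnitState k t M) {l l' : List ℕ}
    (hf : Memory.Frame l l' M M') (h7 : 7 ∉ l') (h8 : 8 ∉ l') : I.UnitState k t M' := by
  have h7 := hf.num 7 h7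
  have h8 := hf.num 8 h8
  exact ⟨by rw [h7]; exact h.level, by rw [h8]; exact h.content, by rw [h8]; exact h.outside⟩

/-- The update of a single unit. -/
theorem Instance.UnitState.step {M' : Memory} {i : Fin n} {q : ℕ} (hq : q < m + 1)
    (h : I.UnitState k (i * (m + 1) + q) M) {c : ℕ} (hc : c < m)
    (hfav : ∀ g : Fin m, I.IsFavorite (I.phase k).goods i g ↔ (g : ℕ) = c ∧
      (I.phase k).goods.Nonempty)
    (h7 : ∀ r, M'.num 7 r 0 = if r = i * (m + 1) + q then unitFill (I.w i * I.clock (k + 1)) q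
      else M.num 7 r 0)
    (h8 : ∀ r c', M'.num 8 r c' = if r = i * (m + 1) + q ∧ c' = c then
      M.num 8 (i * (m + 1) + q) c + (unitFill (I.w i * I.clock (k + 1)) q -
        unitFill (I.w i * I.clock k) q) else M.num 8 r c') :
    I.UnitState k (i * (m + 1) + (q + 1)) M' := by
  classical
  have hlt : ∀ r, r ≠ i * (m + 1) + q →
      (r < i * (m + 1) + (q + 1) ↔ r < i * (m + 1) + q) := fun r hr => by omega
  refine ⟨fun i' q' hq' => ?_, fun i' q' hq' g => ?_, fun r c' hrc => ?_⟩
  · rw [h7]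
    split_ifs with h1 h2 h2
    · obtain ⟨h3, h4⟩ := unit_inj hq' hq h1
      rw [Fin.ext h3, h4]
    · omega
    · rw [h.level i' q' hq', if_pos ((hlt _ h1).1 h2)]
    · rw [h.level i' q' hq', if_neg (fun h3 => h2 ((hlt _ h1).2 h3))]
  · rw [h8]
    by_cases h1 : (i' : ℕ) * (m + 1) + q' = i * (m + 1) + q
    · obtain ⟨h3, h4⟩ := unit_inj hq' hq h1
      have h3 := Fin.ext h3
      subst h3 h4
      rw [if_pos (show (i' : ℕ) * (m + 1) + q' < i' * (m + 1) + (q' + 1) by omega), I.fill_succ]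
      have h5 := h.content i' q' hq
      simp only [lt_irrefl, if_false] at h5
      by_cases hg : (g : ℕ) = c
      · rw [if_pos ⟨rfl, hg⟩, ← hg, h5]
        congr 1
        split_ifs with h6
        · rfl
        · have h7 : ¬ (I.phase k).goods.Nonempty := fun h8 => h6 ((hfav g).2 ⟨hg, h8⟩)
          rw [Finset.not_nonempty_iff_eq_empty] at h7
          rw [I.clock_succ, show I.dur k = 0 from I.phaseLength_of_empty _ h7]
          simp
      · rw [if_neg (fun h6 => hg h6.2), h5, if_neg (fun h6 => hg ((hfav g).1 h6).1), add_zero]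
    · rw [if_neg (fun h6 => h1 h6.1), h.content i' q' hq']
      simp only [hlt _ h1]
  · rw [h8, if_neg, h.outside r c' hrc]
    rintro ⟨rfl, rfl⟩
    have := unit_lt i.2 hq
    omega

/-- The variable `11` decreases by one from unit to unit, so clamping it yields the new fill level
of unit `q`. The increase over the old level is what this unit receives of the favorite good. -/
theorem updateUnits_spec (hN : I.NumContext ok H) (hk : k < m) (hb : I.Base M)
    (ha : ∀ i : Fin n, M.num 6 i 0 = I.w i * I.clock k) (hu : I.UnitState k 0 M)
    (hd : M.num 5 0 0 = I.dur k)
    (hfav : ∀ i : Fin n, I.FavCode (I.phase k).goods i (M.idx 6 i 0)) (hnB : n ≤ B)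
    (hmB : m + 1 ≤ B) :
    wp ok B updateUnits (fun M' => (∀ i : Fin n, M'.num 6 i 0 = I.w i * I.clock (k + 1)) ∧
      I.UnitState k (n * (m + 1)) M') M := by
  have hw : wp ok B updateUnits (fun M' => (∀ i : Fin n, M'.num 6 i 0 = I.w i *
      I.clock (if (i : ℕ) < n then k + 1 else k)) ∧ I.UnitState k (n * (m + 1)) M') M := by
    -- Units are numbered consecutively, so a single progress index `j * (m + 1) + q` serves both
    -- loops.
    refine wp_forLoop (N := n) (fun j M' => (∀ i : Fin n, M'.num 6 i 0 = I.w i *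
        I.clock (if (i : ℕ) < j then k + 1 else k)) ∧ I.UnitState k (j * (m + 1)) M')
      hb.n_eq hnB (by decide) (by decide)
      (fun k M x h => ⟨by simpa using h.1, h.2.frame (M.frame_writeIdx (l := [20]) (l' := [])
        (by decide) _ _ _) (by decide) (by decide)⟩)
      ⟨fun i => by simpa using ha i, by simpa using hu⟩ ?_
    rintro j hj M₁ hf₁ hc₁ ⟨ha₁, hu₁⟩
    have hb₁ := hb.frame hf₁ (by decide) (by decide)
    have hw₁ : M₁.num 1 j 0 = I.w ⟨j, hj⟩ := hb₁.w_eq ⟨j, hj⟩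
    have hd₁ : M₁.num 5 0 0 = I.dur k := by rw [hf₁.num 5 (by decide), hd]
    have ha₁j : M₁.num 6 j 0 = I.w ⟨j, hj⟩ * I.clock k := by simpa using ha₁ ⟨j, hj⟩
    have hclock : I.w ⟨j, hj⟩ * I.clock k + I.dur k * I.w ⟨j, hj⟩ =
        I.w ⟨j, hj⟩ * I.clock (k + 1) := by rw [I.clock_succ]; ring
    have hnn : ∀ k, 0 ≤ I.w ⟨j, hj⟩ * I.clock k := fun k =>
      mul_nonneg (I.w_pos _).le (I.clock_nonneg k)
    have hle := I.w_mul_clock_le ⟨j, hj⟩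
    have hm0 : (0 : ℝ) ≤ m := Nat.cast_nonneg m
    have hokA : ok (I.w ⟨j, hj⟩ * I.clock (k + 1)) :=
      hN.ok_of_mem _ (hN.amount_mem hk _) (by
        rw [abs_of_nonneg (hnn _)]; linarith [hle (k + 1)])
    have hokD : ok (I.dur k * I.w ⟨j, hj⟩) := by
      have h0 := mul_nonneg (I.dur_nonneg k) (I.w_pos ⟨j, hj⟩).le
      exact hN.ok_of_mem _ (hN.dur_mem k hk _) (by
        rw [abs_of_nonneg h0]; linarith [hle (k + 1), hnn k])
    simp only [wp, NumExpr.eval, NumRef.eval, IdxExpr.eval, Memory.writeNum_idx, hc₁,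
      Memory.writeNum_num, hw₁, hd₁, ha₁j]
    norm_num only
    simp only [and_self, and_true, if_true, if_false, false_and, hclock]
    refine ⟨hokD, hokA, hokA, ?_⟩
    generalize hM₂ : ((M₁.writeNum 10 0 0 (I.dur k * I.w ⟨j, hj⟩)).writeNum 6 j 0
      (I.w ⟨j, hj⟩ * I.clock (k + 1))).writeNum 11 0 0 (I.w ⟨j, hj⟩ * I.clock (k + 1)) = M₂
    have hf₂ : Memory.Frame [] [6, 10, 11] M₁ M₂ := by
      rw [← hM₂]
      exact ((M₁.frame_writeNum (by decide) _ _ _).trans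
        (Memory.frame_writeNum _ (by decide) _ _ _)).trans
        (Memory.frame_writeNum _ (by decide) _ _ _)
    have hb₂ := hb₁.frame hf₂ (by decide) (by decide)
    have ha₂ : ∀ i : Fin n, M₂.num 6 i 0 = I.w i *
        I.clock (if (i : ℕ) < j + 1 then k + 1 else k) := by
      intro i
      simp only [← hM₂, Memory.writeNum_num]
      norm_num
      by_cases hij : (i : ℕ) = j
      · have : i = ⟨j, hj⟩ := Fin.ext hij
        subst this
        simp
      · have h1 : (i : ℕ) ≤ j ↔ (i : ℕ) < j := by omega
        rw [if_neg hij, ha₁ i]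
        simp only [h1]
    have h11₂ : M₂.num 11 0 0 = I.w ⟨j, hj⟩ * I.clock (k + 1) := by
      simp [← hM₂, Memory.writeNum_num]
    have hu₂ := hu₁.frame hf₂ (by decide) (by decide)
    rw [show (j + 1) * (m + 1) = j * (m + 1) + (m + 1) from Nat.succ_mul _ _]
    refine wp_conseq (wp_forLoop (N := m + 1) (fun q M' => M'.num 11 0 0 =
        I.w ⟨j, hj⟩ * I.clock (k + 1) - q ∧ I.UnitState k (j * (m + 1) + q) M') ?_ hmB (by decide)
      (by decide) (fun k M x h => ⟨by simpa using h.1, h.2.frame (M.frame_writeIdx (l := [21])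
        (l' := []) (by decide) _ _ _) (by decide) (by decide)⟩) ⟨by simpa using h11₂, hu₂⟩ ?_) ?_
    · exact hb₂.m1_eq
    · rintro q hq M₃ hf₃ hc₃ ⟨h11₃, hu₃⟩
      have hb₃ := hb₂.frame hf₃ (by decide) (by decide)
      have hcj : M₃.idx 20 0 0 = j := by
        rw [hf₃.idx 20 (by decide), hf₂.idx 20 (by decide), hc₁]
      have hfav₃ : I.FavCode (I.phase k).goods ⟨j, hj⟩ (M₃.idx 6 j 0) := by
        rw [hf₃.idx 6 (by decide), hf₂.idx 6 (by decide), hf₁.idx 6 (by decide)]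
        exact hfav ⟨j, hj⟩
      have hcm : M₃.idx 6 j 0 - 1 < m := by
        rcases hfav₃ with ⟨h1, _⟩ | ⟨g, _, h1⟩
        · rw [h1]; omega
        · rw [h1]; exact g.2
      have hcfav : ∀ g : Fin m, I.IsFavorite (I.phase k).goods ⟨j, hj⟩ g ↔
          (g : ℕ) = M₃.idx 6 j 0 - 1 ∧ (I.phase k).goods.Nonempty := by
        intro g
        rw [← hfav₃.eq_iff g]
        rcases hfav₃ with ⟨h1, h2⟩ | ⟨g', h2, h1⟩
        · rw [h1, h2]; simp
        · have : (I.phase k).goods.Nonempty := ⟨g', h2.1⟩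
          simp only [this, and_true]
          omega
      have hmem1 := hN.unitFill_mem (hN.amount_mem hk ⟨j, hj⟩) q
      have hmem0 := hN.unitFill_mem (hN.amount_mem hk.le ⟨j, hj⟩) q
      have hmono : unitFill (I.w ⟨j, hj⟩ * I.clock k) q ≤
          unitFill (I.w ⟨j, hj⟩ * I.clock (k + 1)) q := unitFill_mono (by
        rw [← hclock]; linarith [mul_nonneg (I.dur_nonneg k) (I.w_pos ⟨j, hj⟩).le]) q
      have hok1 : ok (unitFill (I.w ⟨j, hj⟩ * I.clock (k + 1)) q) :=
        hN.ok_unit hmem1 (unitFill_nonneg _ _) (unitFill_le_one _ _)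
      have hunit : M₃.idx 3 j q = j * (m + 1) + q := hb₃.unit_eq ⟨j, hj⟩ q hq
      have hlev : M₃.num 7 (j * (m + 1) + q) 0 = unitFill (I.w ⟨j, hj⟩ * I.clock k) q := by
        simpa using hu₃.level ⟨j, hj⟩ q hq
      have hcon : M₃.num 8 (j * (m + 1) + q) (M₃.idx 6 j 0 - 1) =
          I.fill k ⟨j, hj⟩ q ⟨M₃.idx 6 j 0 - 1, hcm⟩ := by
        simpa using hu₃.content ⟨j, hj⟩ q hq ⟨M₃.idx 6 j 0 - 1, hcm⟩
      have hokC : ok (I.fill k ⟨j, hj⟩ q ⟨M₃.idx 6 j 0 - 1, hcm⟩ +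
          (unitFill (I.w ⟨j, hj⟩ * I.clock (k + 1)) q - unitFill (I.w ⟨j, hj⟩ * I.clock k) q)) := by
        refine hN.ok_of_mem _ (add_mem (hN.fill_mem hk.le _ _ _) (sub_mem hmem1 hmem0)) ?_
        have h1 := I.fill_nonneg k ⟨j, hj⟩ q ⟨M₃.idx 6 j 0 - 1, hcm⟩
        have h2 := I.fill_le_one k ⟨j, hj⟩ q ⟨M₃.idx 6 j 0 - 1, hcm⟩
        have h3 := unitFill_nonneg (I.w ⟨j, hj⟩ * I.clock k) q
        have h4 := unitFill_le_one (I.w ⟨j, hj⟩ * I.clock (k + 1)) q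
        rw [abs_of_nonneg (by linarith)]
        linarith
      simp only [wp]
      refine wp_conseq (clamp_spec hb₃.zero_eq hb₃.one_eq h11₃ hok1) ?_
      intro M₄ h12 hf₄
      have hi₄ : ∀ a, M₄.idx a = M₃.idx a := fun a => hf₄.idx a (by simp [clamp, Program.idxW])
      have hb₄ := hb₃.frame hf₄ (by decide) (by decide)
      have hu₄ := hu₃.frame hf₄ (by decide) (by decide)
      have h7₄ := hf₄.num 7 (by decide)
      have h8₄ := hf₄.num 8 (by decide)
      have h11₄ := hf₄.num 11 (by decide)
      simp only [NumExpr.eval, NumRef.eval, IdxExpr.eval, Memory.writeNum_idx, hi₄, hc₃, hcj,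
        Memory.writeNum_num, hunit, h12, h7₄, hlev]
      norm_num only
      simp only [and_self, and_true, if_true, if_false, false_and, true_and, h8₄, hcon, h11₄, h11₃,
        hb₄.one_eq]
      refine ⟨hN.ok_unit (sub_mem hmem1 hmem0) (by linarith)
        (by linarith [unitFill_le_one (I.w ⟨j, hj⟩ * I.clock (k + 1)) q,
          unitFill_nonneg (I.w ⟨j, hj⟩ * I.clock k) q]), hok1, hokC, ?_, ?_, ?_⟩
      · refine hN.ok_of_mem _ (sub_mem (sub_mem (hN.amount_mem hk _) (hN.natCast_mem q))
          hN.one_mem) ?_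
        have h1 : (q : ℝ) ≤ m := by exact_mod_cast Nat.lt_succ_iff.1 hq
        have h2 : (0 : ℝ) ≤ q := Nat.cast_nonneg q
        rw [abs_le]
        constructor <;> linarith [hnn (k + 1), hle (k + 1)]
      · push_cast; ring
      · refine hu₄.step (i := ⟨j, hj⟩) hq hcm hcfav (fun r => ?_) fun r c' => ?_
        · simp only [Memory.writeNum_num]
          norm_num
        · simp only [Memory.writeNum_num]
          norm_num
          rw [h8₄, hcon]
    · rintro M₃ ⟨_, hu₃⟩ hf₃
      refine ⟨?_, hu₃⟩
      rw [hf₃.num 6 (by decide)]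
      exact ha₂
  refine wp_mono _ hw fun M' h => ⟨fun i => ?_, h.2⟩
  rw [h.1 i, if_pos i.2]

theorem Instance.EatState.unitState (h : I.EatState k M) : I.UnitState k 0 M :=
  ⟨by simpa using h.level, by simpa using h.content, h.outside⟩

theorem Instance.UnitState.eatState (h : I.UnitState k (n * (m + 1)) M)
    (hs : ∀ g : Fin m, M.num 3 g 0 = (I.phase (k + 1)).supply g)
    (ha : ∀ i : Fin n, M.num 6 i 0 = I.w i * I.clock (k + 1)) : I.EatState (k + 1) M := by
  refine ⟨hs, ha, fun i q hq => ?_, fun i q hq g => ?_, h.outside⟩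
  · rw [h.level i q hq, if_pos (unit_lt i.2 hq)]
  · rw [h.content i q hq, if_pos (unit_lt i.2 hq)]

theorem Instance.EatState.frame {M' : Memory} (h : I.EatState k M) {l l' : List ℕ}
    (hf : Memory.Frame l l' M M') (hl' : ∀ a ∈ [3, 6, 7, 8], a ∉ l') : I.EatState k M' := by
  have hn : ∀ a ∈ [3, 6, 7, 8], M'.num a = M.num a := fun a ha => hf.num a (hl' a ha)
  simp only [List.mem_cons, List.not_mem_nil, or_false, forall_eq_or_imp, forall_eq] at hn
  obtain ⟨h3, h6, h7, h8⟩ := hn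
  exact ⟨by rw [h3]; exact h.supply, by rw [h6]; exact h.amount, by rw [h7]; exact h.level,
    by rw [h8]; exact h.content, by rw [h8]; exact h.outside⟩

theorem eatAll_spec (hN : I.NumContext ok H) (hb : I.Base M) (hs : I.EatState 0 M) (hnB : n ≤ B)
    (hmB : m + 1 ≤ B) : wp ok B eatAll (I.EatState m) M := by
  refine wp_forLoop (N := m) (fun k M' => I.EatState k M') hb.m_eq (by omega) (by decide)
    (by decide) (fun k M x h => h.frame (M.frame_writeIdx (l := [25]) (l' := []) (by decide) _ _ _)
      (by decide)) hs ?_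
  intro k hk M₁ hf₁ _ h₁
  have hb₁ := hb.frame hf₁ (by decide) (by decide)
  simp only [wp]
  refine wp_conseq (findFavorites_spec hb₁ h₁ hnB (by omega)) fun M₂ hfav hf₂ => ?_
  have hb₂ := hb₁.frame hf₂ (by decide) (by decide)
  have h₂ := h₁.frame hf₂ (by decide)
  refine wp_conseq (findSpeeds_spec hN hb₂ hfav hnB (by omega)) fun M₃ hsp hf₃ => ?_
  have hb₃ := hb₂.frame hf₃ (by decide) (by decide)
  have h₃ := h₂.frame hf₃ (by decide)
  refine wp_conseq (findDuration_spec hN hk hb₃ h₃ hsp (by omega)) fun M₄ hd hf₄ => ?_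
  have hb₄ := hb₃.frame hf₄ (by decide) (by decide)
  have h₄ := h₃.frame hf₄ (by decide)
  rw [← hf₄.num 4 (by decide)] at hsp
  refine wp_conseq (updateSupply_spec hN hk hb₄ h₄.supply hsp hd (by omega)) fun M₅ hs' hf₅ => ?_
  have hb₅ := hb₄.frame hf₅ (by decide) (by decide)
  have hu := h₄.unitState.frame hf₅ (by decide) (by decide)
  have ha := h₄.amount
  rw [← hf₅.num 6 (by decide)] at ha
  rw [← hf₅.num 5 (by decide)] at hd
  rw [← hf₃.idx 6 (by decide), ← hf₄.idx 6 (by decide), ← hf₅.idx 6 (by decide)] at hfav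
  refine wp_conseq (updateUnits_spec hN hk hb₅ ha hu hd hfav hnB hmB) fun M₆ h₆ hf₆ => ?_
  rw [← hf₆.num 3 (by decide)] at hs'
  exact h₆.2.eatState hs' h₆.1

/-- The padding is done in place. Its cells lie outside the block holding `F`, where the array is
still zero, and the fill levels supply the row sums, so none have to be computed. -/
theorem padMatrix_spec (hb : I.Base M) {F : ℕ → ℕ → ℝ} (hF : M.num 8 = F)
    (hF0 : ∀ r c, n * (m + 1) ≤ r ∨ m ≤ c → F r c = 0)
    (hlev : ∀ r < n * (m + 1), M.num 7 r 0 = ∑ g ∈ Finset.range m, F r g)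
    (hokF : ∀ r < n * (m + 1), ∀ g < m, ok (F r g))
    (hok1 : ∀ r < n * (m + 1), ok (1 - M.num 7 r 0)) (hRB : n * (m + 1) ≤ B) (hmB : m ≤ B) :
    wp ok B padMatrix (fun M' => ∀ r < n * (m + 1) + m, ∀ c < n * (m + 1) + m,
      M'.num 8 r c = padded (n * (m + 1)) m F r c) M := by
  generalize hR : n * (m + 1) = R at *
  have hRM : M.idx 10 0 0 = R := hR ▸ hb.units_eq
  have hw : wp ok B padMatrix (fun M' => ∀ r < R + m, ∀ c < R + m,
      M'.num 8 r c = if c < m + R then padded R m F r c else 0) M := by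
    refine wp_forLoop (N := R) (fun j M' => ∀ r < R + m, ∀ c < R + m,
        M'.num 8 r c = if c < m + j then padded R m F r c else 0) hRM hRB (by decide) (by decide)
      (fun k M x h => by simpa using h) ?_ ?_
    · intro r hr c hc
      rw [hF]
      split_ifs with h1
      · unfold padded
        split_ifs with h2 h3 h4 h4
        · rfl
        · omega
        · omega
        · exact hF0 r c (by omega)
        · omega
      · exact hF0 r c (by omega)
    · intro j hj M₁ hf₁ hc₁ h₁
      have hb₁ := hb.frame hf₁ (by decide) (by decide)
      have h7 : M₁.num 7 j 0 = M.num 7 j 0 := by rw [hf₁.num 7 (by decide)]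
      simp only [wp, NumExpr.eval, NumRef.eval, IdxExpr.eval, hc₁, hb₁.one_eq, h7, hb₁.m_eq]
      refine ⟨hok1 j hj, ?_⟩
      -- Column `m + j` is built from top to bottom: its part above row `R` is complete once the
      -- defect has been written.
      refine wp_mono _ (wp_forLoop (N := m) (fun t M' => ∀ r < R + m, ∀ c < R + m,
        M'.num 8 r c = if c < m + j ∨ (c = m + j ∧ r < R + t) then padded R m F r c else 0)
        ?_ hmB (by decide) (by decide) (fun k M x h => by simpa using h) ?_ ?_) ?_
      · simpa [IdxExpr.eval] using hb₁.m_eq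
      · intro r hr c hc
        simp only [Memory.writeNum_num, h₁ r hr c hc, hlev j hj]
        norm_num
        by_cases h2 : c = m + j
        · subst h2
          simp only [and_true, lt_irrefl, false_or, if_false, true_and]
          by_cases h3 : r < R
          · rw [if_pos h3]
            by_cases h4 : r = j
            · subst h4; simp [padded, h3]
            · have h5 : ¬ (m + j = m + r) := by omega
              simp [padded, h3, h4, Ne.symm h4]
          · rw [if_neg h3, if_neg (by omega)]
        · simp [h2]
      · intro t ht M₂ hf₂ hc₂ h₂
        have hf₂' : Memory.Frame [20, 21] [8] M M₂ := (hf₁.mono (by decide) (by decide)).trans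
          ((M₁.frame_writeNum (by decide) _ _ _).trans (hf₂.mono (by decide) (by decide)))
        have hb₂ := hb.frame hf₂' (by decide) (by decide)
        have hcj : M₂.idx 20 0 0 = j := by
          rw [hf₂.idx 20 (by decide)]; simpa using hc₁
        have hR₂ : M₂.idx 10 0 0 = R := by rw [hf₂'.idx 10 (by decide), hRM]
        have h8 : M₂.num 8 j t = F j t := by
          rw [h₂ j (by omega) t (by omega), if_pos (Or.inl (by omega)), padded_left hj ht]
        simp only [wp, NumExpr.eval, NumRef.eval, IdxExpr.eval, hc₂, hcj, hb₂.m_eq, hR₂, h8,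
          Memory.writeNum_num]
        refine ⟨hokF j hj t ht, fun r hr c hc => ?_⟩
        norm_num
        by_cases h3 : r = R + t ∧ c = m + j
        · obtain ⟨rfl, rfl⟩ := h3
          simp [padded]
        · rw [if_neg h3, h₂ r hr c hc]
          have : (c < m + j ∨ c = m + j ∧ r < R + t) ↔
              (c < m + j ∨ c = m + j ∧ r < R + (t + 1)) := by omega
          simp only [this]
      · intro M₂ h₂ r hr c hc
        rw [h₂ r hr c hc]
        have : (c < m + j ∨ c = m + j ∧ r < R + m) ↔ c < m + (j + 1) := by omega
        simp only [this]
  refine wp_mono _ hw fun M' h r hr c hc => ?_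
  rw [h r hr c hc, if_pos (by omega)]

end Eating

/-! ### The auction and the decomposition as programs -/

section Decompose

variable {ok : ℝ → Prop} {B K : ℕ} {M : Memory} {H : AddSubgroup ℝ} {σ : ℕ → ℕ}

theorem initAuction_spec (hK : M.idx 11 0 0 = K) (hKB : K ≤ B) :
    wp ok B initAuction (fun M' => ∀ c < K, M'.idx 7 c 0 = 0 ∧ M'.idx 8 c 0 = 0) M := by
  refine wp_forLoop (N := K) (fun t M' => ∀ c < t, M'.idx 7 c 0 = 0 ∧ M'.idx 8 c 0 = 0) hK hKB
    (by decide) (by decide) (fun k M x h => by simpa [Memory.writeIdx_idx] using h)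
    (fun c hc => by omega) ?_
  intro t ht M₁ hf₁ hc₁ h₁ c hc
  simp only [IdxExpr.eval, hc₁, Memory.writeIdx_idx]
  norm_num
  exact ⟨fun h => (h₁ c (by omega)).1, fun h => (h₁ c (by omega)).2⟩

theorem findBidder_spec (hK : M.idx 11 0 0 = K) (hKB : K ≤ B) :
    wp ok B findBidder (fun M' => (M'.idx 14 0 0 = 0 ∧ ∀ c < K, M.idx 7 c 0 ≠ 0) ∨
      ∃ u < K, M'.idx 14 0 0 = u + 1 ∧ M.idx 7 u 0 = 0) M := by
  simp only [findBidder, wp]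
  refine wp_forLoop (N := K) (fun t M' => (M'.idx 14 0 0 = 0 ∧ ∀ c < t, M.idx 7 c 0 ≠ 0) ∨
    ∃ u < K, M'.idx 14 0 0 = u + 1 ∧ M.idx 7 u 0 = 0) ?_ hKB
    (by decide) (by decide) (fun k M x h => by simpa [Memory.writeIdx_idx] using h)
    (Or.inl ⟨by simp [Memory.writeIdx_idx, IdxExpr.eval], fun c hc => by omega⟩) ?_
  · simpa [IdxExpr.eval, Memory.writeIdx_idx] using hK
  · intro t ht M₁ hf₁ hc₁ h₁
    have h7 : M₁.idx 7 = M.idx 7 := by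
      rw [hf₁.idx 7 (by decide)]; funext i j; simp [Memory.writeIdx_idx]
    simp only [wp, Test.Holds, IdxExpr.eval, hc₁, h7]
    refine ⟨fun h => Or.inr ⟨t, ht, by simp [Memory.writeIdx_idx], h⟩, fun h => ?_⟩
    rcases h₁ with ⟨h2, h3⟩ | h2
    · refine Or.inl ⟨h2, fun c hc => ?_⟩
      rcases Nat.lt_succ_iff_lt_or_eq.1 hc with h4 | rfl
      · exact h3 c h4
      · exact h
    · exact Or.inr h2

theorem findRow_spec (hK : M.idx 11 0 0 = K) (hKB : K ≤ B) (h0 : M.num 9 0 0 = 0) {u : ℕ}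
    (hu : M.idx 14 0 0 = u + 1) :
    wp ok B findRow (fun M' => (M'.idx 13 0 0 = 0 ∧ ∀ r < K, ¬ 0 < M.num 8 r u) ∨
      ∃ b < K, M'.idx 13 0 0 = b + 1 ∧ 0 < M.num 8 b u ∧
        ∀ r < K, 0 < M.num 8 r u → M.idx 8 b 0 ≤ M.idx 8 r 0) M := by
  simp only [findRow, wp]
  refine wp_forLoop (N := K) (fun t M' => (M'.idx 13 0 0 = 0 ∧ ∀ r < t, ¬ 0 < M.num 8 r u) ∨
      ∃ b < K, M'.idx 13 0 0 = b + 1 ∧ 0 < M.num 8 b u ∧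
        ∀ r < t, 0 < M.num 8 r u → M.idx 8 b 0 ≤ M.idx 8 r 0) ?_ hKB
    (by decide) (by decide) (fun k M x h => by simpa [Memory.writeIdx_idx] using h)
    (Or.inl ⟨by simp [Memory.writeIdx_idx, IdxExpr.eval], fun c hc => by omega⟩) ?_
  · simpa [IdxExpr.eval, Memory.writeIdx_idx] using hK
  · intro t ht M₁ hf₁ hc₁ h₁
    have hf₁' : Memory.Frame [13, 24] [] M M₁ :=
      (M.frame_writeIdx (by decide) _ _ _).trans (hf₁.mono (by decide) (by decide))
    have hi8 := hf₁'.idx 8 (by decide)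
    have hn8 := hf₁'.num 8 (by decide)
    have hn9 := hf₁'.num 9 (by decide)
    have hi14 := hf₁'.idx 14 (by decide)
    simp only [wp, Test.Holds, NumRef.eval, IdxExpr.eval, hc₁, hi8, hn8, hn9, hi14, hu, h0,
      Nat.add_sub_cancel]
    rw [← not_or, not_not]
    constructor
    · rintro ⟨hpos, hlt⟩
      refine Or.inr ⟨t, ht, by simp [Memory.writeIdx_idx], hpos, fun r hr hrp => ?_⟩
      rcases Nat.lt_succ_iff_lt_or_eq.1 hr with h4 | rfl
      · rcases h₁ with ⟨_, h3⟩ | ⟨b, hb, hb1, hb2, hb3⟩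
        · exact absurd hrp (h3 r h4)
        · rw [hb1, Nat.add_sub_cancel] at hlt
          have := hb3 r h4 hrp
          omega
      · exact le_rfl
    · intro hn
      rcases h₁ with ⟨h2, h3⟩ | ⟨b, hb, hb1, hb2, hb3⟩
      · refine Or.inl ⟨h2, fun r hr hrp => ?_⟩
        rcases Nat.lt_succ_iff_lt_or_eq.1 hr with h4 | rfl
        · exact h3 r h4 hrp
        · exact hn ⟨hrp, Or.inl h2⟩
      · refine Or.inr ⟨b, hb, hb1, hb2, fun r hr hrp => ?_⟩
        rcases Nat.lt_succ_iff_lt_or_eq.1 hr with h4 | rfl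
        · exact hb3 r h4 hrp
        · by_contra hcon
          refine hn ⟨hrp, Or.inr ?_⟩
          rw [hb1, Nat.add_sub_cancel]
          omega

theorem assignRow_spec (hK : M.idx 11 0 0 = K) (hKB : K ≤ B) {u b : ℕ}
    (hu : M.idx 14 0 0 = u + 1) (hb : M.idx 13 0 0 = b + 1) :
    wp ok B assignRow (fun M' =>
      (∀ c < K, M'.idx 7 c 0 = if c = u then b + 1 else
        if M.idx 7 c 0 = b + 1 then 0 else M.idx 7 c 0) ∧
      ∀ r, M'.idx 8 r 0 = if r = b then M.idx 8 r 0 + 1 else M.idx 8 r 0) M := by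
  simp only [assignRow, wp]
  refine wp_conseq (wp_forLoop (N := K) (fun t M' => ∀ c, M'.idx 7 c 0 =
      if c < t ∧ M.idx 7 c 0 = b + 1 then 0 else M.idx 7 c 0) hK hKB
    (by decide) (by decide) (fun k M x h => by simpa [Memory.writeIdx_idx] using h)
    (fun c => by simp) ?_) ?_
  · intro t ht M₁ hf₁ hc₁ h₁
    have h13 : M₁.idx 13 0 0 = b + 1 := by rw [hf₁.idx 13 (by decide), hb]
    have h7t : M₁.idx 7 t 0 = M.idx 7 t 0 := by simpa using h₁ t
    simp only [wp, Test.Holds, IdxExpr.eval, hc₁, h13, h7t]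
    constructor
    · intro h c
      simp only [Memory.writeIdx_idx]
      norm_num
      by_cases hct : c = t
      · subst hct; simp [h]
      · rw [if_neg hct, h₁ c]
        have : c ≤ t ↔ c < t := by omega
        simp only [this]
    · intro h c
      rw [h₁ c]
      by_cases hct : c = t
      · subst hct; simp [h]
      · have : c < t + 1 ↔ c < t := by omega
        simp only [this]
  · intro M₁ h₁ hf₁
    have h13 : M₁.idx 13 0 0 = b + 1 := by rw [hf₁.idx 13 (by decide), hb]
    have h14 : M₁.idx 14 0 0 = u + 1 := by rw [hf₁.idx 14 (by decide), hu]
    have h8 := hf₁.idx 8 (by decide)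
    simp only [IdxExpr.eval, Memory.writeIdx_idx, h13, h14, h8]
    norm_num
    refine ⟨fun c hc => ?_, fun r => ?_⟩
    · rw [h₁ c]
      simp only [hc, true_and]
    · split_ifs with h
      · rw [h]
      · rfl

/-- The holders form a perfect matching `σ` of the support of `Z`. -/
structure Matched (K : ℕ) (Z : ℕ → ℕ → ℝ) (σ : ℕ → ℕ) (M : Memory) : Prop where
  eq : ∀ c < K, M.idx 7 c 0 = σ c + 1
  lt : ∀ c < K, σ c < K
  pos : ∀ c < K, 0 < Z (σ c) c
  inj : ∀ c < K, ∀ c' < K, σ c = σ c' → c = c'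

/-- Every effective round raises the sum of the prices by exactly one. After `K * K` rounds that sum
would contradict `AuctionInv.sum_lt` if a column were still free. Two nested loops realize `K * K`
rounds; those after completion are idle. -/
theorem auction_spec (hK : M.idx 11 0 0 = K) (hKB : K ≤ B) (h0 : M.num 9 0 0 = 0) {μ : ℝ}
    (hZ : DoublyStochastic K (M.num 8) μ) (hμ : 0 < μ) :
    wp ok B auction (fun M' => ∃ σ, Matched K (M.num 8) σ M') M := by
  let Inv : ℕ → Memory → Prop := fun T M' =>
    AuctionInv K (M.num 8) (fun c => M'.idx 7 c 0) (fun r => M'.idx 8 r 0) ∧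
      ((∀ c < K, M'.idx 7 c 0 ≠ 0) ∨ ∑ r ∈ Finset.range K, M'.idx 8 r 0 = T)
  have hInd : ∀ a, a ≠ 7 → a ≠ 8 → ∀ (T : ℕ) (M' : Memory) (x : ℕ), Inv T M' →
      Inv T (M'.writeIdx a 0 0 x) := by
    intro a h7 h8 T M' x h
    simpa [Inv, Memory.writeIdx_idx, h7.symm, h8.symm] using h
  simp only [auction, wp]
  refine wp_conseq (initAuction_spec hK hKB) fun M₁ h₁ hf₁ => ?_
  have hK₁ : M₁.idx 11 0 0 = K := by rw [hf₁.idx 11 (by decide), hK]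
  have h0₁ : M₁.num 9 0 0 = 0 := by rw [hf₁.num 9 (by decide), h0]
  have h8₁ := hf₁.num 8 (by decide)
  refine wp_mono _ (wp_forLoop (N := K) (fun t M' => Inv (t * K) M') hK₁ hKB (by decide)
    (by decide) (fun k M' x h => hInd 22 (by decide) (by decide) _ M' x h) ?_ ?_) ?_
  · refine ⟨⟨fun c hc r hr => ?_, fun c hc c' hc' _ h => ?_, fun r hr h => ?_, fun r hr => ?_⟩,
      Or.inr ?_⟩
    · have := (h₁ c hc).1
      omega
    · exact absurd (h₁ c hc).1 h
    · have := (h₁ r hr).2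
      omega
    · have := (h₁ r hr).2
      omega
    · rw [Nat.zero_mul]
      exact Finset.sum_eq_zero fun r hr => (h₁ r (Finset.mem_range.1 hr)).2
  · intro t ht M₂ hf₂ _ h₂
    have hK₂ : M₂.idx 11 0 0 = K := by rw [hf₂.idx 11 (by decide), hK₁]
    rw [Nat.succ_mul]
    refine wp_forLoop (N := K) (fun s M' => Inv (t * K + s) M') hK₂ hKB (by decide)
      (by decide) (fun k M' x h => hInd 23 (by decide) (by decide) _ M' x h) h₂ ?_
    intro s hs M₃ hf₃ _ h₃
    have hK₃ : M₃.idx 11 0 0 = K := by rw [hf₃.idx 11 (by decide), hK₂]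
    have h8₃ : M₃.num 8 = M.num 8 := by
      rw [hf₃.num 8 (by decide), hf₂.num 8 (by decide), h8₁]
    have h0₃ : M₃.num 9 0 0 = 0 := by
      rw [hf₃.num 9 (by decide), hf₂.num 9 (by decide), h0₁]
    simp only [wp]
    refine wp_conseq (findBidder_spec hK₃ hKB) fun M₄ h₄ hf₄ => ?_
    have hK₄ : M₄.idx 11 0 0 = K := by rw [hf₄.idx 11 (by decide), hK₃]
    have hn8₄ := hf₄.num 8 (by decide)
    have hi7₄ := hf₄.idx 7 (by decide)
    have hi8₄ := hf₄.idx 8 (by decide)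
    have h0₄ : M₄.num 9 0 0 = 0 := by rw [hf₄.num 9 (by decide), h0₃]
    simp only [Test.Holds, IdxExpr.eval]
    refine ⟨fun h14 => ?_, fun h14 => ?_⟩
    · rcases h₄ with ⟨_, h5⟩ | ⟨u, _, h5, _⟩
      · simp only [Inv, hi7₄, hi8₄]
        exact ⟨h₃.1, Or.inl h5⟩
      · omega
    · rcases h₄ with ⟨h5, _⟩ | ⟨u, hu, h5, hu0⟩
      · exact absurd h5 h14
      · refine wp_conseq (findRow_spec hK₄ hKB h0₄ h5) fun M₅ h₅ hf₅ => ?_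
        rw [hn8₄, hi8₄, h8₃] at h₅
        -- The column sum is positive, so the search for a row cannot fail.
        obtain ⟨r₀, hr₀, hr₀'⟩ := hZ.exists_pos hμ hu
        rcases h₅ with ⟨_, h6⟩ | ⟨b, hb, hb13, hbu, hbmin⟩
        · exact absurd hr₀' (h6 r₀ hr₀)
        · have hK₅ : M₅.idx 11 0 0 = K := by rw [hf₅.idx 11 (by decide), hK₄]
          have h14₅ : M₅.idx 14 0 0 = u + 1 := by rw [hf₅.idx 14 (by decide), h5]
          refine wp_mono _ (assignRow_spec hK₅ hKB h14₅ hb13) ?_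
          rintro M₆ ⟨h7, h8⟩
          rw [hf₅.idx 7 (by decide), hi7₄] at h7
          rw [hf₅.idx 8 (by decide), hi8₄] at h8
          refine ⟨h₃.1.bid hZ hμ hu hu0 hb hbu hbmin h7 fun r _ => h8 r, ?_⟩
          rcases h₃.2 with h9 | h9
          · exact absurd hu0 (h9 u hu)
          · right
            have h10 : ∀ r ∈ Finset.range K, M₆.idx 8 r 0 =
                M₃.idx 8 r 0 + if r = b then 1 else 0 := fun r _ => by
              rw [h8 r]; split_ifs <;> rfl
            rw [Finset.sum_congr rfl h10, Finset.sum_add_distrib, h9, Finset.sum_ite_eq',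
              if_pos (Finset.mem_range.2 hb), Nat.add_assoc]
  · rintro M₂ ⟨h2, h3⟩
    have h4 : ∀ c < K, M₂.idx 7 c 0 ≠ 0 := by
      rcases h3 with h3 | h3
      · exact h3
      · intro c hc hc0
        have := h2.sum_lt hZ hμ hc hc0
        omega
    have h5 : ∀ c < K, M₂.idx 7 c 0 = (M₂.idx 7 c 0 - 1) + 1 := fun c hc => by
      have := h4 c hc; omega
    refine ⟨fun c => M₂.idx 7 c 0 - 1, h5, fun c hc => (h2.cheap c hc _ (h5 c hc)).1,
      fun c hc => (h2.cheap c hc _ (h5 c hc)).2.1, fun c hc c' hc' h => ?_⟩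
    refine h2.inj c hc c' hc' ?_ (h4 c hc)
    have := h5 c hc
    have := h5 c' hc'
    omega

theorem findWeight_spec (hK : M.idx 11 0 0 = K) (hKB : K ≤ B) (hK0 : 0 < K)
    (hσ : Matched K (M.num 8) σ M) (hok : ∀ r < K, ∀ c < K, ok (M.num 8 r c)) :
    wp ok B findWeight (fun M' => (∃ c < K, M.num 8 (σ c) c = M'.num 13 0 0) ∧
      ∀ c < K, M'.num 13 0 0 ≤ M.num 8 (σ c) c) M := by
  simp only [findWeight, wp, NumExpr.eval, NumRef.eval, IdxExpr.eval, hσ.eq 0 hK0,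
    Nat.add_sub_cancel]
  refine ⟨hok _ (hσ.lt 0 hK0) _ hK0, ?_⟩
  refine wp_forLoop (N := K) (fun t M' => (∃ c < K, M.num 8 (σ c) c = M'.num 13 0 0) ∧
      ∀ c < t, M'.num 13 0 0 ≤ M.num 8 (σ c) c) ?_ hKB (by decide) (by decide)
    (fun k M x h => by simpa using h) ?_ ?_
  · simpa [IdxExpr.eval] using hK
  · exact ⟨⟨0, hK0, by simp [Memory.writeNum_num]⟩, fun c hc => by omega⟩
  · rintro t ht M₁ hf₁ hc₁ ⟨⟨c₀, hc₀, h₁⟩, h₂⟩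
    have hf₁' : Memory.Frame [22] [13] M M₁ :=
      (M.frame_writeNum (by decide) _ _ _).trans (hf₁.mono (by decide) (by decide))
    have h7 : M₁.idx 7 t 0 = σ t + 1 := by rw [hf₁'.idx 7 (by decide), hσ.eq t ht]
    have h8 := hf₁'.num 8 (by decide)
    simp only [wp, Test.Holds, NumExpr.eval, NumRef.eval, IdxExpr.eval, hc₁, h7,
      Nat.add_sub_cancel, h8, Memory.writeNum_num]
    constructor
    · intro hlt
      refine ⟨hok _ (hσ.lt t ht) _ ht, ⟨t, ht, by simp⟩, fun c hc => ?_⟩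
      norm_num
      rcases Nat.lt_succ_iff_lt_or_eq.1 hc with h4 | rfl
      · exact hlt.le.trans (h₂ c h4)
      · exact le_rfl
    · intro hlt
      refine ⟨⟨c₀, hc₀, h₁⟩, fun c hc => ?_⟩
      rcases Nat.lt_succ_iff_lt_or_eq.1 hc with h4 | rfl
      · exact h₂ c h4
      · exact not_lt.1 hlt

/-- Only the columns of goods are read, and each matched unit is replaced by its owner through the
table in array `4`. -/
theorem output_spec (hm : M.idx 0 0 1 = m) (hmB : m ≤ B) (hmK : m ≤ K)
    (hσ : ∀ c < K, M.idx 7 c 0 = σ c + 1) (hok : ok (M.num 13 0 0)) :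
    wp ok B output (fun M' => M'.idx 1 0 0 = M.idx 1 0 0 + 1 ∧
      (∀ k, M'.num 2 k 0 = if k = M.idx 1 0 0 then M.num 13 0 0 else M.num 2 k 0) ∧
      ∀ k, ∀ g < m, M'.idx 2 k g =
        if k = M.idx 1 0 0 then M.idx 4 (σ g) 0 else M.idx 2 k g) M := by
  simp only [output, wp, NumExpr.eval, NumRef.eval, IdxExpr.eval]
  refine ⟨hok, wp_conseq (wp_forLoop (N := m) (fun t M' => ∀ k, ∀ g < m, M'.idx 2 k g =
        if k = M.idx 1 0 0 ∧ g < t then M.idx 4 (σ g) 0 else M.idx 2 k g)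
    ?_ hmB (by decide) (by decide) (fun k M x h => by simpa [Memory.writeIdx_idx] using h)
    ?_ ?_) ?_⟩
  · simpa [IdxExpr.eval] using hm
  · intro k g _
    simp
  · intro t ht M₁ hf₁ hc₁ h₁ k g hg
    have h1 : M₁.idx 1 0 0 = M.idx 1 0 0 := by rw [hf₁.idx 1 (by decide)]; rfl
    have h4 : M₁.idx 4 = M.idx 4 := by rw [hf₁.idx 4 (by decide)]; rfl
    have h7 : M₁.idx 7 t 0 = σ t + 1 := by
      rw [hf₁.idx 7 (by decide)]; exact hσ t (by omega)
    simp only [IdxExpr.eval, hc₁, h1, h4, h7, Nat.add_sub_cancel, Memory.writeIdx_idx, true_and]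
    by_cases h : k = M.idx 1 0 0 ∧ g = t
    · rw [if_pos h, if_pos ⟨h.1, by omega⟩, h.2]
    · rw [if_neg h, h₁ k g hg]
      have : (k = M.idx 1 0 0 ∧ g < t) ↔ (k = M.idx 1 0 0 ∧ g < t + 1) := by omega
      simp only [this]
  · intro M₁ h₁ hf₁
    have h1 : M₁.idx 1 0 0 = M.idx 1 0 0 := by rw [hf₁.idx 1 (by decide)]; rfl
    simp only [Memory.writeIdx_idx, Memory.writeIdx_num, h1]
    norm_num
    refine ⟨fun k => ?_, fun k g hg => ?_⟩
    · rw [hf₁.num 2 (by decide)]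
      simp [Memory.writeNum_num]
    · rw [h₁ k g hg]
      simp only [hg, and_true]

theorem subtract_spec (hK : M.idx 11 0 0 = K) (hKB : K ≤ B)
    (hσ : ∀ c < K, M.idx 7 c 0 = σ c + 1)
    (hok : ∀ c < K, ok (M.num 8 (σ c) c - M.num 13 0 0))
    (hok' : ok (M.num 15 0 0 - M.num 13 0 0)) :
    wp ok B subtract (fun M' => M'.num 15 0 0 = M.num 15 0 0 - M.num 13 0 0 ∧
      ∀ r, ∀ c < K, M'.num 8 r c =
        if σ c = r then M.num 8 r c - M.num 13 0 0 else M.num 8 r c) M := by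
  simp only [subtract, wp]
  refine wp_conseq (wp_forLoop (N := K) (fun t M' => ∀ r c, M'.num 8 r c =
      if c < t ∧ σ c = r then M.num 8 r c - M.num 13 0 0 else M.num 8 r c)
    hK hKB (by decide) (by decide) (fun k M x h => by simpa using h) (fun r c => by simp) ?_) ?_
  · intro t ht M₁ hf₁ hc₁ h₁
    have h7 : M₁.idx 7 t 0 = σ t + 1 := by rw [hf₁.idx 7 (by decide), hσ t ht]
    have h13 := hf₁.num 13 (by decide)
    have h8 : M₁.num 8 (σ t) t = M.num 8 (σ t) t := by simpa using h₁ (σ t) t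
    simp only [wp, NumExpr.eval, NumRef.eval, IdxExpr.eval, hc₁, h7, h13, h8,
      Nat.add_sub_cancel, Memory.writeNum_num, true_and]
    refine ⟨hok t ht, fun r c => ?_⟩
    by_cases h : r = σ t ∧ c = t
    · obtain ⟨rfl, rfl⟩ := h
      simp
    · rw [if_neg h, h₁ r c]
      have : (c < t ∧ σ c = r) ↔ (c < t + 1 ∧ σ c = r) := by
        constructor
        · exact fun h' => ⟨by omega, h'.2⟩
        · rintro ⟨h', h''⟩
          refine ⟨?_, h''⟩
          rcases Nat.lt_succ_iff_lt_or_eq.1 h' with h4 | rfl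
          · exact h4
          · exact absurd ⟨h''.symm, rfl⟩ h
      simp only [this]
  · intro M₁ h₁ hf₁
    have h13 := hf₁.num 13 (by decide)
    have h15 := hf₁.num 15 (by decide)
    simp only [NumExpr.eval, NumRef.eval, IdxExpr.eval, h13, h15, Memory.writeNum_num]
    norm_num
    refine ⟨hok', fun r c hc => ?_⟩
    rw [h₁ r c]
    simp only [hc, true_and]

/-- The memory during the decomposition. -/
def DecompState (m K : ℕ) (Z₀ : ℕ → ℕ → ℝ) (H : AddSubgroup ℝ) (owner : ℕ → ℕ) (T : ℕ)
    (M : Memory) : Prop :=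
  ∃ ρ, DecompInv K Z₀ (M.num 8) (M.num 15 0 0) (M.idx 1 0 0) (fun k => M.num 2 k 0) ρ ∧
    (∀ k < M.idx 1 0 0, ∀ g < m, M.idx 2 k g = owner (ρ k g)) ∧
    (M.num 15 0 0 = 0 ∨ supportCard K (M.num 8) + T ≤ K * K) ∧
    (∀ r < K, ∀ c < K, M.num 8 r c ∈ H) ∧ M.num 15 0 0 ∈ H

/-- Each effective round removes an entry from the support, which has at most `K * K` elements, so
after `K * K` rounds no weight remains. Stored numbers arise by subtraction within `H` and stay in
`[0, 1]`, so repeated subtraction does not enlarge denominators. -/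
theorem decompose_spec (hK : M.idx 11 0 0 = K) (hKB : K ≤ B) (hm : M.idx 0 0 1 = m) (hmK : m ≤ K)
    (h0 : M.num 9 0 0 = 0) (hK0 : 0 < K) (hH : ∀ x ∈ H, 0 ≤ x → x ≤ 1 → ok x)
    (h1 : (1 : ℝ) ∈ H) (hZ : DoublyStochastic K (M.num 8) 1)
    (hZH : ∀ r < K, ∀ c < K, M.num 8 r c ∈ H) :
    wp ok B decompose (fun M' => ∃ ρ Z, DecompInv K (M.num 8) Z 0 (M'.idx 1 0 0)
      (fun k => M'.num 2 k 0) ρ ∧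
      ∀ k < M'.idx 1 0 0, ∀ g < m, M'.idx 2 k g = M.idx 4 (ρ k g) 0) M := by
  let Inv : ℕ → Memory → Prop := DecompState m K (M.num 8) H fun r => M.idx 4 r 0
  have hInd : ∀ a, a ≠ 1 → a ≠ 2 → ∀ (T : ℕ) (M' : Memory) (x : ℕ), Inv T M' →
      Inv T (M'.writeIdx a 0 0 x) := by
    intro a h1 h2 T M' x h
    simpa [Inv, DecompState, Memory.writeIdx_idx, h1.symm, h2.symm] using h
  simp only [decompose, wp, NumExpr.eval, IdxExpr.eval]
  refine ⟨hH 1 h1 zero_le_one le_rfl, ?_⟩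
  refine wp_mono _ (wp_forLoop (N := K) (fun t M' => Inv (t * K) M') ?_ hKB (by decide)
    (by decide) (fun k M' x h => hInd 20 (by decide) (by decide) _ M' x h) ?_ ?_) ?_
  · simpa [IdxExpr.eval, Memory.writeIdx_idx] using hK
  · have h8w : ∀ x, (M.writeNum 15 0 0 x).num 8 = M.num 8 := fun x => by
      funext i j
      simp [Memory.writeNum_num]
    refine ⟨fun _ _ => 0, ⟨?_, ?_, ?_, ?_, ?_, ?_⟩, ?_, ?_, ?_, ?_⟩
    · simpa [h8w, Memory.writeNum_num] using hZ
    all_goals simp only [Memory.writeIdx_idx, Memory.writeIdx_num, Memory.writeNum_num]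
    · simp
    · simp
    · simp
    · simp
    · simp
    · simp
    · right
      simpa [h8w] using supportCard_le K (M.num 8)
    · simpa using hZH
    · simpa using h1
  · intro t ht M₁ hf₁ hc₁ h₁
    have hf₁' : Memory.Frame [1, 2, 7, 8, 13, 14, 20, 21, 22, 23, 24] [2, 8, 13, 15] M M₁ :=
      ((M.frame_writeNum (by decide) _ _ _).trans (Memory.frame_writeIdx _ (by decide) _ _ _)).trans
        (hf₁.mono (by decide) (by decide))
    have hK₁ : M₁.idx 11 0 0 = K := by rw [hf₁'.idx 11 (by decide), hK]
    rw [Nat.succ_mul]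
    refine wp_forLoop (N := K) (fun s M' => Inv (t * K + s) M') hK₁ hKB (by decide)
      (by decide) (fun k M' x h => hInd 21 (by decide) (by decide) _ M' x h) h₁ ?_
    rintro s hs M₂ hf₂ hc₂ ⟨ρ, hD, hal, hcard, hZH₂, hμH⟩
    have hf₂' := hf₁'.trans (hf₂.mono (by decide) (by decide))
    have hK₂ : M₂.idx 11 0 0 = K := by rw [hf₂'.idx 11 (by decide), hK]
    have h0₂ : M₂.num 9 0 0 = 0 := by rw [hf₂'.num 9 (by decide), h0]
    have h4₂ := hf₂'.idx 4 (by decide)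
    have hm₂ : M₂.idx 0 0 1 = m := by rw [hf₂'.idx 0 (by decide), hm]
    have hμ0 : 0 ≤ M₂.num 15 0 0 := by
      rw [← hD.ds.row 0 hK0]
      exact Finset.sum_nonneg fun c hc => hD.ds.nonneg 0 hK0 c (Finset.mem_range.1 hc)
    have hμ1 : M₂.num 15 0 0 ≤ 1 := by
      have := Finset.sum_nonneg fun k hk => (hD.pos k (Finset.mem_range.1 hk)).le
      rw [hD.sum] at this
      linarith
    simp only [wp, Test.Holds, NumRef.eval, IdxExpr.eval, h0₂]
    refine ⟨fun hμ => ?_, fun hμ => ?_⟩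
    · have hok8 : ∀ r < K, ∀ c < K, ok (M₂.num 8 r c) := fun r hr c hc =>
        hH _ (hZH₂ r hr c hc) (hD.ds.nonneg r hr c hc) ((hD.ds.le hr hc).trans hμ1)
      refine wp_conseq (auction_spec hK₂ hKB h0₂ hD.ds hμ) ?_
      rintro M₃ ⟨σ, hσ⟩ hf₃
      have h8₃ := hf₃.num 8 (by decide)
      have hK₃ : M₃.idx 11 0 0 = K := by rw [hf₃.idx 11 (by decide), hK₂]
      rw [← h8₃] at hσ
      refine wp_conseq (findWeight_spec hK₃ hKB hK0 hσ (by rw [h8₃]; exact hok8)) ?_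
      rintro M₄ ⟨⟨c₀, hc₀, hw⟩, hle⟩ hf₄
      rw [h8₃] at hw hle
      have hK₄ : M₄.idx 11 0 0 = K := by rw [hf₄.idx 11 (by decide), hK₃]
      have hm₄ : M₄.idx 0 0 1 = m := by
        rw [hf₄.idx 0 (by decide), hf₃.idx 0 (by decide), hm₂]
      have hσ₄ : ∀ c < K, M₄.idx 7 c 0 = σ c + 1 := by
        rw [hf₄.idx 7 (by decide)]; exact hσ.eq
      have h8₄ : M₄.num 8 = M₂.num 8 := by rw [hf₄.num 8 (by decide), h8₃]
      have h15₄ : M₄.num 15 = M₂.num 15 := by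
        rw [hf₄.num 15 (by decide), hf₃.num 15 (by decide)]
      have h1₄ : M₄.idx 1 = M₂.idx 1 := by rw [hf₄.idx 1 (by decide), hf₃.idx 1 (by decide)]
      have h2₄ : M₄.idx 2 = M₂.idx 2 := by rw [hf₄.idx 2 (by decide), hf₃.idx 2 (by decide)]
      have hn2₄ : M₄.num 2 = M₂.num 2 := by rw [hf₄.num 2 (by decide), hf₃.num 2 (by decide)]
      have h4₄ : M₄.idx 4 = M.idx 4 := by
        rw [hf₄.idx 4 (by decide), hf₃.idx 4 (by decide), h4₂]
      generalize hl : M₄.num 13 0 0 = l at *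
      have hlpos : 0 < l := by
        rw [← hw, ← h8₃]; exact hσ.pos c₀ hc₀
      have hlH : l ∈ H := by rw [← hw]; exact hZH₂ _ (hσ.lt c₀ hc₀) _ hc₀
      have hlμ : l ≤ M₂.num 15 0 0 := by rw [← hw]; exact hD.ds.le (hσ.lt c₀ hc₀) hc₀
      refine wp_conseq (output_spec hm₄ (hmK.trans hKB) hmK hσ₄
        (by rw [hl]; exact hH l hlH hlpos.le (hlμ.trans hμ1))) ?_
      rintro M₅ ⟨h1₅, hn2₅, h2₅⟩ hf₅
      have hK₅ : M₅.idx 11 0 0 = K := by rw [hf₅.idx 11 (by decide), hK₄]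
      have hσ₅ : ∀ c < K, M₅.idx 7 c 0 = σ c + 1 := by
        rw [hf₅.idx 7 (by decide)]; exact hσ₄
      have h8₅ : M₅.num 8 = M₂.num 8 := by rw [hf₅.num 8 (by decide), h8₄]
      have h15₅ : M₅.num 15 = M₂.num 15 := by rw [hf₅.num 15 (by decide), h15₄]
      have h13₅ : M₅.num 13 0 0 = l := by rw [hf₅.num 13 (by decide), hl]
      rw [h1₄] at h1₅ hn2₅ h2₅
      rw [hl, hn2₄] at hn2₅
      rw [h2₄, h4₄] at h2₅
      have hsub : ∀ c < K, M₂.num 8 (σ c) c - l ∈ H := fun c hc =>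
        sub_mem (hZH₂ _ (hσ.lt c hc) c hc) hlH
      refine wp_conseq (subtract_spec hK₅ hKB hσ₅ (fun c hc => ?_) ?_) ?_
      · rw [h8₅, h13₅]
        refine hH _ (hsub c hc) (sub_nonneg.2 (hle c hc)) ?_
        have := hD.ds.le (hσ.lt c hc) hc
        linarith
      · rw [h15₅, h13₅]
        exact hH _ (sub_mem hμH hlH) (sub_nonneg.2 hlμ) (by linarith)
      · rintro M₆ ⟨h15₆, h8₆⟩ hf₆
        rw [h15₅, h13₅] at h15₆
        rw [h8₅, h13₅] at h8₆
        have h8₆' : ∀ r < K, ∀ c < K, M₆.num 8 r c =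
            if σ c = r then M₂.num 8 r c - l else M₂.num 8 r c := fun r _ c hc => h8₆ r c hc
        have h1₆ : M₆.idx 1 0 0 = M₂.idx 1 0 0 + 1 := by rw [hf₆.idx 1 (by decide), h1₅]
        have h2₆ := hf₆.idx 2 (by decide)
        have hn2₆ := hf₆.num 2 (by decide)
        -- The new permutation is appended at the current size of the lottery.
        refine ⟨fun k => if k = M₂.idx 1 0 0 then σ else ρ k, ?_, ?_, ?_, ?_, ?_⟩
        · rw [h1₆, h15₆]
          refine hD.step hσ.lt hσ.inj hlpos hle (fun k hk => ?_) ?_ (fun k hk => ?_) ?_ h8₆'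
          · rw [hn2₆, hn2₅, if_neg hk.ne]
          · rw [hn2₆, hn2₅, if_pos rfl]
          · rw [if_neg hk.ne]
          · simp
        · intro k hk g hg
          rw [h1₆] at hk
          rw [h2₆, h2₅ k g hg]
          by_cases hks : k = M₂.idx 1 0 0
          · rw [if_pos hks]; simp only [hks, if_true]
          · rw [if_neg hks]; simp only [hks, if_false]
            exact hal k (by omega) g hg
        · right
          have h9 := supportCard_lt hlpos h8₆' hle hc₀ (hσ.lt c₀ hc₀) hw
          rcases hcard with h10 | h10
          · exact absurd h10 hμ.ne'
          · omega
        · intro r hr c hc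
          rw [h8₆ r c hc]
          split_ifs with h9
          · rw [← h9]; exact hsub c hc
          · exact hZH₂ r hr c hc
        · rw [h15₆]; exact sub_mem hμH hlH
    · exact ⟨ρ, hD, hal, Or.inl (le_antisymm (not_lt.1 hμ) hμ0), hZH₂, hμH⟩
  · rintro M₁ ⟨ρ, hD, hal, hcard, _, _⟩
    have hμ : M₁.num 15 0 0 = 0 := by
      rcases hcard with h2 | h2
      · exact h2
      · exact hD.ds.eq_zero_of_supportCard hK0 (by omega)
    rw [hμ] at hD
    exact ⟨ρ, _, hD, hal⟩

end Decompose

/-! ### The main theorem -/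

/-- Untouched arrays are zero. This provides the initial amounts, levels and contents, and array
`9`, which is never written, as the constant 0. -/
theorem Instance.input_frame (I : Instance n m) {l l' : List ℕ} {M : Memory}
    (h : Memory.Frame l l' I.input M) {a : ℕ} (ha : a ∉ l') (ha0 : a ≠ 0) (ha1 : a ≠ 1)
    (i j : ℕ) : M.num a i j = 0 := by
  rw [h.num a ha]
  simp [Instance.input, ha0, ha1]

theorem lotteryProgram_spec (I : Instance n m) {ok : ℝ → Prop} {H : AddSubgroup ℝ}
    (hN : I.NumContext ok H) {B : ℕ} (hB : n * (m + 1) + m ≤ B) :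
    wp ok B lotteryProgram (fun M' => ∃ L : Lottery n m, L.StoredIn M' ∧
      I.IsUGDecomposition I.eating L ∧ I.WSDEF L.mean ∧ I.WEF L.mean ∧
      ∀ k, I.WPROP1 (L.alloc k) ∧ I.WEFxy 1 1 (L.alloc k)) I.input := by
  have hn := I.agents_pos
  have hnB : n ≤ B := by nlinarith
  have hmB : m + 1 ≤ B := by nlinarith
  simp only [lotteryProgram, wp]
  refine wp_conseq (numberUnits_spec (n := n) (m := m) (by simp [Instance.input])
    (by simp [Instance.input]) hnB hmB) fun M₁ h₁ hf₁ => ?_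
  have hm₁ : M₁.idx 0 0 1 = m := by
    rw [hf₁.idx 0 (by decide)]; simp [Instance.input]
  refine wp_conseq (initSupply_spec hm₁ (by omega) (hN.ok_unit hN.one_mem zero_le_one le_rfl))
    fun M₂ h₂ hf₂ => ?_
  have hf₂' : Memory.Frame [3, 4, 10, 11, 12, 20, 21] [3, 14] I.input M₂ :=
    (hf₁.mono (by decide) (by decide)).trans (hf₂.mono (by decide) (by decide))
  have hb : I.Base M₂ := by
    obtain ⟨h3, h4, h10, h11, h12⟩ := h₁
    constructor
    · rw [hf₂'.idx 0 (by decide)]; simp [Instance.input]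
    · rw [hf₂'.idx 0 (by decide)]; simp [Instance.input]
    · rw [hf₂'.num 0 (by decide)]; simp [Instance.input]
    · rw [hf₂'.num 1 (by decide)]; simp [Instance.input]
    · rw [hf₂.idx 3 (by decide)]; exact h3
    · rw [hf₂.idx 4 (by decide)]; exact h4
    · rw [hf₂.idx 10 (by decide)]; exact h10
    · rw [hf₂.idx 11 (by decide)]; exact h11
    · rw [hf₂.idx 12 (by decide)]; exact h12
    · exact I.input_frame hf₂' (by decide) (by decide) (by decide) _ _
    · exact h₂.1
  have hs : I.EatState 0 M₂ := by
    have hz : ∀ a ∈ [6, 7, 8], ∀ i j, M₂.num a i j = 0 := fun a ha i j => by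
      refine I.input_frame hf₂' ?_ ?_ ?_ i j <;>
        · simp only [List.mem_cons, List.not_mem_nil, or_false] at ha
          rcases ha with rfl | rfl | rfl <;> decide
    refine ⟨fun g => ?_, fun i => ?_, fun i q _ => ?_, fun i q _ g => ?_, fun r c _ => ?_⟩
    · rw [h₂.2 g g.2]; rfl
    · rw [hz 6 (by decide)]; simp [Instance.clock]
    · rw [hz 7 (by decide)]; simp [Instance.clock, unitFill]
    · rw [hz 8 (by decide)]; simp [Instance.fill]
    · exact hz 8 (by decide) _ _
  refine wp_conseq (eatAll_spec hN hb hs hnB hmB) fun M₃ h₃ hf₃ => ?_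
  have hb₃ := hb.frame hf₃ (by decide) (by decide)
  have hF : I.IsUnitMatrix (M₃.num 8) := h₃.content
  have hFmem : ∀ r < n * (m + 1), ∀ g < m, M₃.num 8 r g ∈ H := by
    intro r hr g hg
    obtain ⟨i, q, hq, rfl⟩ := exists_unit hr
    rw [hF i q hq ⟨g, hg⟩]
    exact hN.fill_mem le_rfl _ _ _
  refine wp_conseq (padMatrix_spec hb₃ rfl h₃.outside (fun r hr => ?_) (fun r hr g hg => ?_)
    (fun r hr => ?_) (by omega) (by omega)) fun M₄ h₄ hf₄ => ?_
  · obtain ⟨i, q, hq, rfl⟩ := exists_unit hr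
    rw [h₃.level i q hq, hF.row_sum i hq]
  · obtain ⟨i, q, hq, rfl⟩ := exists_unit hr
    rw [hF i q hq ⟨g, hg⟩]
    exact hN.ok_unit (hN.fill_mem le_rfl _ _ _) (I.fill_nonneg _ _ _ _) (I.fill_le_one _ _ _ _)
  · obtain ⟨i, q, hq, rfl⟩ := exists_unit hr
    rw [h₃.level i q hq]
    exact hN.ok_unit (sub_mem hN.one_mem (hN.unitFill_mem (hN.amount_mem le_rfl i) q))
      (sub_nonneg.2 (unitFill_le_one _ _)) (by linarith [unitFill_nonneg (I.w i * I.clock m) q])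
  have hb₄ := hb₃.frame hf₄ (by decide) (by decide)
  have hZ : DoublyStochastic (n * (m + 1) + m) (M₄.num 8) 1 := by
    have h5 := hF.doublyStochastic
    refine ⟨fun r hr c hc => ?_, fun r hr => ?_, fun c hc => ?_⟩
    · rw [h₄ r hr c hc]; exact h5.nonneg r hr c hc
    · rw [← h5.row r hr]
      exact Finset.sum_congr rfl fun c hc => h₄ r hr c (Finset.mem_range.1 hc)
    · rw [← h5.col c hc]
      exact Finset.sum_congr rfl fun r hr => h₄ r (Finset.mem_range.1 hr) c hc
  refine wp_conseq (decompose_spec hb₄.size_eq hB hb₄.m_eq (by omega) hb₄.zero_eq (by nlinarith)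
    (fun x hx hx0 hx1 => hN.ok_unit hx hx0 hx1) hN.one_mem hZ fun r hr c hc => ?_)
    fun M₅ h₅ hf₅ => ?_
  · rw [h₄ r hr c hc]
    unfold padded
    split_ifs with h5 h6 h7 h8
    · exact hFmem r h5 c h6
    · exact sub_mem hN.one_mem (H.sum_mem fun g hg => hFmem r h5 g (Finset.mem_range.1 hg))
    · exact zero_mem H
    · exact zero_mem H
    · exact hFmem _ (by omega) _ (by omega)
  · obtain ⟨ρ, Z, hD, hal⟩ := h₅
    -- The memory agrees with the padded matrix only inside the square, which is all that the
    -- decomposition refers to.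
    have hD' : DecompInv (n * (m + 1) + m) (padded (n * (m + 1)) m (M₃.num 8)) Z 0 (M₅.idx 1 0 0)
        (fun k => M₅.num 2 k 0) ρ :=
      ⟨hD.ds, hD.pos, hD.sum, hD.lt, hD.inj, fun r hr c hc => by
        rw [← h₄ r hr c hc]; exact hD.eq r hr c hc⟩
    refine hD'.exists_lottery hF rfl fun k hk => ⟨rfl, fun g hg => ?_⟩
    rw [hal k hk g hg, hb₄.owner_eq _ (hD'.lt_units hk hg)]

end FairDivision

theorem mainTheorem1 :
    FairDivision.ComputableInStronglyPolynomialTime fun I L =>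
      I.IsUGDecomposition I.eating L ∧
      I.WSDEF L.mean ∧ I.WEF L.mean ∧
      ∀ k, I.WPROP1 (L.alloc k) ∧ I.WEFxy 1 1 (L.alloc k) := by
  refine ⟨FairDivision.lotteryProgram,
    FairDivision.lotteryProgram.time.comp ((Polynomial.X + 1) ^ 2), FairDivision.bitBound,
    fun n m I => ?_⟩
  obtain ⟨H, hN⟩ := I.exists_numContext
  obtain ⟨t, M, h1, h2, L, h3, h4⟩ := FairDivision.exec_of_wp _
    -- The longest loop runs over the `n * (m + 1) + m` rows of the padded matrix; this square
    -- dominates it and is a polynomial in `n + m`.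
    (FairDivision.lotteryProgram_spec I hN (B := (n + m + 1) ^ 2) (by nlinarith))
  refine ⟨L, t, M, h1, ?_, h3, h4⟩
  simpa [Polynomial.eval_comp] using h2
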